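/- Theorem 8.5. Fix sets of function symbols, predicate symbols, variables and labels, each symbol having an arity. A *schema* is a finite sequence of statements, each of which is an assignment $y := f^{(l)}(\mathbf x);$, or "if $p^{(l)}(\mathbf x)$ then $\{T_1\}$ else $\{T_2\}$", or "while $p^{(l)}(\mathbf x)$ do $\{T\}$", where $T_1,T_2,T$ are schemas (skip is the empty sequence); $f^{(l)}$ is a function symbol and $p^{(l)}$ a predicate symbol with label $l$, and distinct occurrences of a symbol in a schema have distinct labels. Write $\mathrm{Sym}^{\mathcal L}(S)$ for the set of labelled symbols of $S$. Subschemas of $S$ are obtained by deleting statements (at any depth). The (syntactic) paths through $S$ are the words of assignments and predicate tests obtained by choosing the outcome of each test freely; a path-segment is a subword of a terminated path, and it is terminal if it is a suffix of one. A *Herbrand interpretation* has the set of terms as its domain and interprets each function symbol as the term constructor. $S$ is *free* if every finite prefix of a path through $S$ is executed under some Herbrand interpretation from the initial state $v\mapsto v$; it is *liberal* if no two assignments along a path executed under a Herbrand interpretation from this state assign the same term; it is *predicate-linear* if no predicate symbol occurs twice in it. $S$ is *special* if it is predicate-linear, free and liberal, and whenever a function symbol $f$ occurs as $f^{(l)}$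 in the true part and as $f^{(m)}$ in the false part of an if-predicate, $f^{(l)}$ and $f^{(m)}$ assign to different variables. For a variable $u$, a subschema $T$ of $S$ is a *$u$-slice* of $S$ if for every domain, interpretation and initial state for which $S$ terminates, $T$ also terminates, with the same final value of $u$. *Weiser's set* $\mathcal N(u)$ of $S$ is the least set of labelled symbols such that - $f^{(l)}\in\mathcal N(u)$ if, after some terminal path-segment of $S$, symbolically executed from the state $v\mapsto v$, the outermost function symbol of the term of $u$ was created by the assignment $f^{(l)}$; - $f^{(l)}\in\mathcal N(u)$ if some $x\in\mathcal N(u)$ is data dependent on $f^{(l)}$, that is, along some path-segment of $S$ symbolically executed from the state $v\mapsto v$, some argument of $x$, when $x$ is reached, is a term whose outermost function symbol was created by the assignment $f^{(l)}$ within the segment; - $p^{(l)}\in\mathcal N(u)$ if some $x\in\mathcal N(u)$ lies in the body or in the true or false part of $p^{(l)}$. Let $S$ be a special schema and $u$ a variable. There is exactly one subschema $T$ of $S$ with $\mathrm{Sym}^{\mathcal L}(T)=\mathcal N(u)$. Moreover: 1. If $T$ is a subschema of $S$ with $\mathrm{Sym}^{\mathcal L}(T)=\mathcal N(u)$, then $T$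 is a $u$-slice of $S$. 2. Every $u$-slice of $S$ contains at least one occurrence of every symbol that occurs (with some label) in $\mathcal N(u)$. In particular, if $T$ is a subschema of $S$ with $\mathrm{Sym}^{\mathcal L}(T)=\mathcal N(u)$ and $T'\neq T$ is a subschema of $T$ that is a $u$-slice of $S$, then there is a function symbol $f$ such that $T$ contains at least two occurrences of $f$ and $T'$ contains at least one, but not all, of the occurrences of $f$ lying in $T$. -/

import Mathlib

open scoped Computability

universe u

namespace ProgramSchema

/-- The fixed sets of function symbols, predicate symbols, variables and labels,
with the arities of the symbols. -/
structure Signature where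
  Func : Type u
  Pred : Type u
  Var : Type u
  Label : Type u
  /-- number of arguments of a function symbol -/
  farity : Func → ℕ
  /-- number of arguments of a predicate symbol -/
  parity : Pred → ℕ

/-- Terms over function symbols `F` with arities `ar` and variables `V`. -/
inductive Term (F : Type u) (ar : F → ℕ) (V : Type u) : Type u
  | var (v : V) : Term F ar V
  | app (f : F) (ts : Fin (ar f) → Term F ar V) : Term F ar V

/-- `t.IsWordTerm w`: the term `t` is a `w`-term for the nonempty word `w` of function symbols.
Any `f(t₁,…,tₙ)` is an `f`-term, and `g(t₁,…,tₙ)` is a `wg`-term if some `tᵢ` is a `w`-term. -/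
inductive Term.IsWordTerm {F : Type u} {ar : F → ℕ} {V : Type u} :
    List F → Term F ar V → Prop
  | single (f : F) (ts : Fin (ar f) → Term F ar V) : IsWordTerm [f] (Term.app f ts)
  | snoc (w : List F) (g : F) (ts : Fin (ar g) → Term F ar V) (k : Fin (ar g)) :
      IsWordTerm w (ts k) → IsWordTerm (w ++ [g]) (Term.app g ts)

namespace Signature

/-- Herbrand domain: terms over the function symbols and the variables. -/
abbrev HTerm (Γ : Signature.{u}) : Type u := Term Γ.Func Γ.farity Γ.Var

/-- Terms over labelled function symbols; the labels record which labelled assignment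
created a subterm. -/
abbrev LTerm (Γ : Signature.{u}) : Type u :=
  Term (Γ.Func × Γ.Label) (fun fl => Γ.farity fl.1) Γ.Var

/-- Symbols: function symbols and predicate symbols. -/
abbrev Sym (Γ : Signature.{u}) : Type u := Γ.Func ⊕ Γ.Pred

/-- Labelled symbols. -/
abbrev LSym (Γ : Signature.{u}) : Type u := Γ.Sym × Γ.Label

end Signature

/-- Structured schemas, that is, finite sequences of statements.  `skip` is the empty sequence
(so that it is the unit of sequencing, and sequencing is associative); the other constructors
put one statement, namely an assignment `y := f⁽ˡ⁾(x);`, an if-statement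
`if p⁽ˡ⁾(x) then {T₁} else {T₂}` or a while-statement `while p⁽ˡ⁾(x) do {T}`,
in front of the schema `rest`. -/
inductive Schema (Γ : Signature.{u}) : Type u
  | skip : Schema Γ
  | assign (y : Γ.Var) (f : Γ.Func) (l : Γ.Label) (x : Fin (Γ.farity f) → Γ.Var)
      (rest : Schema Γ) : Schema Γ
  | ifte (p : Γ.Pred) (l : Γ.Label) (x : Fin (Γ.parity p) → Γ.Var)
      (T₁ T₂ : Schema Γ) (rest : Schema Γ) : Schema Γ
  | loop (p : Γ.Pred) (l : Γ.Label) (x : Fin (Γ.parity p) → Γ.Var)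
      (T : Schema Γ) (rest : Schema Γ) : Schema Γ

/-- Letters of the alphabet of a schema: the underlined assignments and the underlined pairs
`p⁽ˡ⁾, Z`.  The letter of a predicate also carries the vector of variables that it references. -/
inductive Letter (Γ : Signature.{u}) : Type u
  | assign (y : Γ.Var) (f : Γ.Func) (l : Γ.Label) (x : Fin (Γ.farity f) → Γ.Var) : Letter Γ
  | test (p : Γ.Pred) (l : Γ.Label) (x : Fin (Γ.parity p) → Γ.Var) (Z : Bool) : Letter Γ

/-- An interpretation of the function and predicate symbols in the domain `D`. -/
structure Interp (Γ : Signature.{u}) (D : Type u) where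
  func : ∀ f : Γ.Func, (Fin (Γ.farity f) → D) → D
  pred : ∀ p : Γ.Pred, (Fin (Γ.parity p) → D) → Bool

/-- Herbrand interpretations: the function symbols act as term constructors; the predicate
symbols are unrestricted. -/
def Interp.IsHerbrand {Γ : Signature.{u}} (i : Interp Γ Γ.HTerm) : Prop :=
  ∀ (f : Γ.Func) (ts : Fin (Γ.farity f) → Γ.HTerm), i.func f ts = Term.app f ts

open Classical in
/-- Effect of one letter on a (non-`⊥`) state. -/
noncomputable def Interp.step {Γ : Signature.{u}} {D : Type u} (i : Interp Γ D)
    (d : Γ.Var → D) : Letter Γ → (Γ.Var → D)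
  | .assign y f _ x => Function.update d y (i.func f (fun k => d (x k)))
  | .test _ _ _ _ => d

/-- Final state of the predicate-free schema given by the assignments along the word `σ`,
started in the state `d`. -/
noncomputable def Interp.run {Γ : Signature.{u}} {D : Type u} (i : Interp Γ D)
    (d : Γ.Var → D) (σ : List (Letter Γ)) : Γ.Var → D :=
  σ.foldl i.step d

/-- The word `σ` agrees with the interpretation `i` and initial state `d` at every predicate
along it. -/
def Interp.Follows {Γ : Signature.{u}} {D : Type u} (i : Interp Γ D)
    (d : Γ.Var → D) (σ : List (Letter Γ)) : Prop :=
  ∀ (τ : List (Letter Γ)) (p : Γ.Pred) (l : Γ.Label) (x : Fin (Γ.parity p) → Γ.Var) (Z : Bool),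
    τ ++ [Letter.test p l x Z] <+: σ → i.pred p (fun k => i.run d τ (x k)) = Z

open Classical in
/-- The labelled Herbrand terms of the variables after the assignments along the word `σ`,
started in the natural state `v ↦ v`. -/
noncomputable def symbolic {Γ : Signature.{u}} (σ : List (Letter Γ)) : Γ.Var → Γ.LTerm :=
  σ.foldl
    (fun d a =>
      match a with
      | .assign y f l x =>
          Function.update d y
            (Term.app (ar := fun fl : Γ.Func × Γ.Label => Γ.farity fl.1) (f, l)
              (fun k => d (x k)))
      | .test _ _ _ _ => d)
    Term.var

namespace Schema

variable {Γ : Signature.{u}}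

/-- Sequencing of schemas. -/
def seq : Schema Γ → Schema Γ → Schema Γ
  | skip, T => T
  | assign y f l x R, T => assign y f l x (R.seq T)
  | ifte p l x T₁ T₂ R, T => ifte p l x T₁ T₂ (R.seq T)
  | loop p l x T₀ R, T => loop p l x T₀ (R.seq T)

/-- The occurrences of labelled symbols in a schema, in textual order. -/
def occs : Schema Γ → List Γ.LSym
  | skip => []
  | assign _ f l _ R => (Sum.inl f, l) :: R.occs
  | ifte p l _ T₁ T₂ R => (Sum.inr p, l) :: (T₁.occs ++ T₂.occs ++ R.occs)
  | loop p l _ T R => (Sum.inr p, l) :: (T.occs ++ R.occs)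

/-- The set of labelled symbols of a schema. -/
def lsym (S : Schema Γ) : Set Γ.LSym := {x | x ∈ S.occs}

/-- The set of (unlabelled) symbols of a schema. -/
def sym (S : Schema Γ) : Set Γ.Sym := Prod.fst '' S.lsym

/-- The labels of the occurrences of the function symbol `f` in a schema. -/
def funcOccs (S : Schema Γ) (f : Γ.Func) : Set Γ.Label := {l | (Sum.inl f, l) ∈ S.lsym}

/-- Distinct occurrences of a symbol have distinct labels. -/
def DistinctLabels (S : Schema Γ) : Prop := S.occs.Nodup

/-- No predicate symbol occurs more than once. -/
def PredicateLinear (S : Schema Γ) : Prop :=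
  (S.occs.filterMap (fun x => x.1.getRight?)).Nodup

/-- The assignment labelled `f⁽ˡ⁾` occurs in the schema and assigns to the variable `v`. -/
def Assigns : Schema Γ → Γ.Func → Γ.Label → Γ.Var → Prop
  | skip, _, _, _ => False
  | assign y g m _ R, f, l, v => (g = f ∧ m = l ∧ y = v) ∨ R.Assigns f l v
  | ifte _ _ _ T₁ T₂ R, f, l, v => T₁.Assigns f l v ∨ T₂.Assigns f l v ∨ R.Assigns f l v
  | loop _ _ _ T R, f, l, v => T.Assigns f l v ∨ R.Assigns f l v

/-- `S.Controls q m Z x`: in `S` the labelled symbol `x` lies in the `Z`-part of the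
if-predicate `q⁽ᵐ⁾`, or `Z` is true and `x` lies in the body of the while-predicate `q⁽ᵐ⁾`. -/
def Controls : Schema Γ → Γ.Pred → Γ.Label → Bool → Γ.LSym → Prop
  | skip, _, _, _, _ => False
  | assign _ _ _ _ R, q, m, Z, x => R.Controls q m Z x
  | ifte p l _ T₁ T₂ R, q, m, Z, x =>
      (p = q ∧ l = m ∧ ((Z = true ∧ x ∈ T₁.lsym) ∨ (Z = false ∧ x ∈ T₂.lsym))) ∨
        T₁.Controls q m Z x ∨ T₂.Controls q m Z x ∨ R.Controls q m Z x
  | loop p l _ T R, q, m, Z, x =>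
      (p = q ∧ l = m ∧ Z = true ∧ x ∈ T.lsym) ∨ T.Controls q m Z x ∨ R.Controls q m Z x

/-- The terminated paths through a schema, as a formal language over the letters. -/
def paths : Schema Γ → Language (Letter Γ)
  | skip => 1
  | assign y f l x R => {[Letter.assign y f l x]} * R.paths
  | ifte p l x T₁ T₂ R =>
      ({[Letter.test p l x true]} * T₁.paths + {[Letter.test p l x false]} * T₂.paths) * R.paths
  | loop p l x T R =>
      ({[Letter.test p l x true]} * T.paths)∗ * {[Letter.test p l x false]} * R.paths

/-- Finite prefixes of the terminated paths. -/
def pathPrefixes (S : Schema Γ) : Set (List (Letter Γ)) := {σ | ∃ τ, σ ++ τ ∈ S.paths}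

/-- Path-segments of a schema. -/
def pathSegments (S : Schema Γ) : Set (List (Letter Γ)) := {μ | ∃ α β, α ++ μ ++ β ∈ S.paths}

/-- Terminal path-segments of a schema. -/
def terminalSegments (S : Schema Γ) : Set (List (Letter Γ)) := {ν | ∃ μ, μ ++ ν ∈ S.paths}

/-- The finite prefixes of the (possibly infinite) path that is executed by the schema
under the interpretation `i` from the initial state `d`. -/
def execPrefixes {D : Type u} (S : Schema Γ) (i : Interp Γ D) (d : Γ.Var → D) :
    Set (List (Letter Γ)) :=
  {σ | σ ∈ S.pathPrefixes ∧ i.Follows d σ}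

open Classical in
/-- The final state of the schema under `i` from the initial state `d`; `none` is `⊥`,
that is, non-termination.  The executed path is finite exactly if one of its prefixes is a
terminated path, which is then unique. -/
noncomputable def meaning {D : Type u} (S : Schema Γ) (i : Interp Γ D) (d : Γ.Var → D) :
    Option (Γ.Var → D) :=
  if h : ∃ σ, σ ∈ S.paths ∧ σ ∈ S.execPrefixes i d then some (i.run d h.choose) else none

/-- Every path prefix is executed under some Herbrand interpretation from the natural state. -/
def Free (S : Schema Γ) : Prop :=
  ∀ σ ∈ S.pathPrefixes, ∃ i : Interp Γ Γ.HTerm, i.IsHerbrand ∧ σ ∈ S.execPrefixes i Term.var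

/-- No two assignments along an executed Herbrand path (from the natural state) create the
same term. -/
def Liberal (S : Schema Γ) : Prop :=
  ∀ (i : Interp Γ Γ.HTerm), i.IsHerbrand →
    ∀ (μ ν : List (Letter Γ))
      (v : Γ.Var) (f : Γ.Func) (l : Γ.Label) (a : Fin (Γ.farity f) → Γ.Var)
      (w : Γ.Var) (g : Γ.Func) (m : Γ.Label) (b : Fin (Γ.farity g) → Γ.Var),
      μ ++ [Letter.assign v f l a] ++ ν ++ [Letter.assign w g m b] ∈ S.execPrefixes i Term.var →
        i.run Term.var (μ ++ [Letter.assign v f l a]) v ≠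
          i.run Term.var (μ ++ [Letter.assign v f l a] ++ ν ++ [Letter.assign w g m b]) w

/-- Special schemas: predicate-linear, free and liberal, and occurrences of the same function
symbol in the two parts of an if-predicate assign to different variables. -/
def IsSpecial (S : Schema Γ) : Prop :=
  S.PredicateLinear ∧ S.Free ∧ S.Liberal ∧
    ∀ (p : Γ.Pred) (k : Γ.Label) (f : Γ.Func) (l m : Γ.Label) (v w : Γ.Var),
      S.Controls p k true (Sum.inl f, l) → S.Controls p k false (Sum.inl f, m) →
        S.Assigns f l v → S.Assigns f m w → v ≠ w

/-- `Subschema T S`: `T` is a subschema of `S`. -/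
inductive Subschema : Schema Γ → Schema Γ → Prop
  | skip (S : Schema Γ) : Subschema skip S
  | left (S₁ S₂ : Schema Γ) : Subschema S₁ (S₁.seq S₂)
  | right (S₁ S₂ : Schema Γ) : Subschema S₂ (S₁.seq S₂)
  | seq_left (S' S T : Schema Γ) : Subschema S' S → Subschema (S'.seq T) (S.seq T)
  | seq_right (S' S T : Schema Γ) : Subschema S' S → Subschema (T.seq S') (T.seq S)
  | body (p : Γ.Pred) (l : Γ.Label) (x : Fin (Γ.parity p) → Γ.Var) (T' T : Schema Γ) :
      Subschema T' T → Subschema (loop p l x T' skip) (loop p l x T skip)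
  | true_part (p : Γ.Pred) (l : Γ.Label) (x : Fin (Γ.parity p) → Γ.Var) (T' T U : Schema Γ) :
      Subschema T' T → Subschema (ifte p l x T' U skip) (ifte p l x T U skip)
  | false_part (p : Γ.Pred) (l : Γ.Label) (x : Fin (Γ.parity p) → Γ.Var) (T' T U : Schema Γ) :
      Subschema T' T → Subschema (ifte p l x U T' skip) (ifte p l x U T skip)
  | trans (R T S : Schema Γ) : Subschema R T → Subschema T S → Subschema R S

/-- The subschema `T` is a `u`-slice of `S`: whenever `S` terminates, `T` terminates with the
same final value of the variable `u`, for all domains, interpretations and initial states. -/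
def IsSlice (v : Γ.Var) (T S : Schema Γ) : Prop :=
  Subschema T S ∧
    ∀ (D : Type u) (i : Interp Γ D) (d d₁ : Γ.Var → D), S.meaning i d = some d₁ →
      ∃ d₂, T.meaning i d = some d₂ ∧ d₁ v = d₂ v

/-- Data dependence of a labelled symbol on the labelled function symbol `f⁽ˡ⁾`: there is an
`f⁽ˡ⁾ x`-path-segment in `S`. -/
def DataDep (S : Schema Γ) (f : Γ.Func) (l : Γ.Label) : Γ.LSym → Prop
  | (Sum.inl g, m) =>
      ∃ σ ∈ S.pathSegments, ∃ w : Γ.Var, (symbolic σ w).IsWordTerm [(f, l), (g, m)]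
  | (Sum.inr p, m) =>
      ∃ (σ : List (Letter Γ)) (x : Fin (Γ.parity p) → Γ.Var) (Z : Bool),
        σ ++ [Letter.test p m x Z] ∈ S.pathSegments ∧
          ∃ k, (symbolic σ (x k)).IsWordTerm [(f, l)]

/-- Dependence of the final value of the variable `v` on the labelled function symbol `f⁽ˡ⁾`. -/
def FinalDep (S : Schema Γ) (f : Γ.Func) (l : Γ.Label) (v : Γ.Var) : Prop :=
  ∃ σ ∈ S.terminalSegments, (symbolic σ v).IsWordTerm [(f, l)]

/-- Weiser's labelled symbol set of the variable `v`: the least set of labelled symbols that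
contains those on which the final value of `v` depends and is closed under backward data
dependence and under control. -/
inductive need (S : Schema Γ) (v : Γ.Var) : Set Γ.LSym
  | final (f : Γ.Func) (l : Γ.Label) : S.FinalDep f l v → need S v (Sum.inl f, l)
  | data (f : Γ.Func) (l : Γ.Label) (x : Γ.LSym) :
      need S v x → S.DataDep f l x → need S v (Sum.inl f, l)
  | control (p : Γ.Pred) (l : Γ.Label) (Z : Bool) (x : Γ.LSym) :
      need S v x → S.Controls p l Z x → need S v (Sum.inr p, l)

end Schema

end ProgramSchema

/-!
The heart of the matter is that every slice needs the symbols of Weiser's set; that the restriction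
of the schema to Weiser's set is a slice (`restrict_need_isSlice`) is seen by executing the two side
by side, and a subschema is the restriction of the schema to its own symbols
(`Subschema.eq_restrict`).

Consider Herbrand executions in which only finitely many *queries*, that is, predicate symbols with
vectors of terms as arguments, have the answer true.  In a free schema a query is never made twice,
as the path could be continued with either answer.  Hence such executions terminate
(`exists_run_out`), and the final value of `v` is a function of the finite set `e` of true queries
(`out`).  If changing the answer to one query changes this value, then every slice has to make the
same query, so that it contains the predicate symbol and all function symbols in the arguments
(`IsSlice.mem_sym_of_out_insert_ne`).  It remains to be shown that the outcome of each test in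
Weiser's set matters, at whatever configuration the test is made, in some execution.

The difficulty is that differences can be hidden again by what happens afterwards.  They are
controlled by a syntactic notion of influence with a *cost*, the number of tests with outcome true
that it takes (`Influence`).  In executions in which all tests are false, nothing is hidden: the
variables in which the states differ are propagated by assignments, and by liberality and the last
condition on special schemas, the two outcomes of a test lead at its join precisely to differences
in the variables assigned on the all-false paths to the join (`setOf_after_ne_eq_assigned`).
Two inductions then match the cost with the number of true queries:

* if a test matters in an execution with `k` true queries, it has an influence of cost at most `k`
  (`exists_influence_of_out_ne`); so queries whose tests have only more costly influences can be
  made false at will (`out_insert_eq`);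
* conversely, if `k` is the least cost of an influence of a test, then at each of its configurations
  at most `k` true queries suffice for it to matter (`exists_out_ne_of_influence`).  Here one passes
  from a test to a cheaper one, the answer to whose query affects just one of the two executions
  that are compared, because the other one does not come to this test while enough true queries
  are left.

Finally, Weiser's dependences yield influences of some finite cost (`influences_of_mem_need`).  For
control dependence, a test or a variable with an influence somewhere inside a block is first
replaced by one on the all-false path through the block (`Influences.exists_mem_falsePath`,
`Influences.mem_assigned_or`).
-/

namespace ProgramSchema

variable {Γ : Signature.{u}}

namespace Schema

/-! ### Schemas as small-step machines -/

/-- The schema that remains to be executed after the first statement of a schema has been started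
with outcome `Z` (which is irrelevant if that statement is an assignment). -/
def next : Bool → Schema Γ → Schema Γ
  | _, skip => skip
  | _, assign _ _ _ _ R => R
  | true, ifte _ _ _ T₁ _ R => T₁.seq R
  | false, ifte _ _ _ _ T₂ R => T₂.seq R
  | true, loop p l x T R => T.seq (loop p l x T R)
  | false, loop _ _ _ _ R => R

/-- The first statement of the schema is an if- or a while-statement with test `p⁽ˡ⁾(x)`. -/
inductive IsTest : Schema Γ → (p : Γ.Pred) → Γ.Label → (Fin (Γ.parity p) → Γ.Var) → Prop
  | ifte (p l x T₁ T₂ R) : IsTest (ifte p l x T₁ T₂ R) p l x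
  | loop (p l x T R) : IsTest (loop p l x T R) p l x

/-- One step along a syntactic path. -/
inductive Step : Schema Γ → Letter Γ → Schema Γ → Prop
  | assign (y f l x R) : Step (assign y f l x R) (.assign y f l x) R
  | test {P : Schema Γ} {p l x} (h : IsTest P p l x) (Z : Bool) :
      Step P (.test p l x Z) (next Z P)

/-- `Run P σ Q`: the word `σ` leads from the schema `P` to the remaining schema `Q`. -/
inductive Run : Schema Γ → List (Letter Γ) → Schema Γ → Prop
  | nil (P) : Run P [] P
  | cons {P a Q σ R} : Step P a Q → Run Q σ R → Run P (a :: σ) R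

theorem seq_skip (S : Schema Γ) : S.seq skip = S := by
  induction S <;> simp_all [seq]

theorem seq_assoc (S T U : Schema Γ) : (S.seq T).seq U = S.seq (T.seq U) := by
  induction S <;> simp_all [seq]

/-- The number of statements of a schema, at all depths. -/
def size : Schema Γ → ℕ
  | skip => 0
  | assign _ _ _ _ R => 1 + R.size
  | ifte _ _ _ T₁ T₂ R => 1 + T₁.size + T₂.size + R.size
  | loop _ _ _ T R => 1 + T.size + R.size

theorem size_seq (S T : Schema Γ) : (S.seq T).size = S.size + T.size := by
  induction S <;> simp_all [seq, size, Nat.add_assoc]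

theorem size_next_false {P : Schema Γ} (h : P ≠ skip) : (next false P).size < P.size := by
  cases P <;> simp_all [next, size, size_seq]

theorem next_seq {A : Schema Γ} (h : A ≠ skip) (Z : Bool) (J : Schema Γ) :
    next Z (A.seq J) = (next Z A).seq J := by
  cases A <;> cases Z <;> simp_all [next, seq, seq_assoc]

theorem IsTest.seq {A : Schema Γ} {p l x} (h : IsTest A p l x) (J : Schema Γ) :
    IsTest (A.seq J) p l x := by
  cases h <;> constructor

theorem IsTest.ne_skip {A : Schema Γ} {p l x} (h : IsTest A p l x) : A ≠ skip := by
  cases h <;> simp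

theorem Run.append {P Q R : Schema Γ} {σ τ} (h : Run P σ Q) (h' : Run Q τ R) :
    Run P (σ ++ τ) R := by
  induction h with
  | nil => exact h'
  | cons hs _ ih => exact .cons hs (ih h')

theorem Run.single {P Q : Schema Γ} {a} (h : Step P a Q) : Run P [a] Q := .cons h (.nil _)

theorem run_append_iff {P R : Schema Γ} {σ τ} :
    Run P (σ ++ τ) R ↔ ∃ Q, Run P σ Q ∧ Run Q τ R := by
  constructor
  · intro h
    induction σ generalizing P with
    | nil => exact ⟨P, .nil _, h⟩
    | cons a σ ih =>
      cases h with
      | cons hs h =>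
        obtain ⟨Q, h1, h2⟩ := ih h
        exact ⟨Q, .cons hs h1, h2⟩
  · rintro ⟨Q, h1, h2⟩
    exact h1.append h2

theorem run_cons_iff {P R : Schema Γ} {a σ} :
    Run P (a :: σ) R ↔ ∃ Q, Step P a Q ∧ Run Q σ R :=
  ⟨fun h => by cases h with | cons h1 h2 => exact ⟨_, h1, h2⟩, fun ⟨_, h1, h2⟩ => .cons h1 h2⟩

theorem Step.seq {P Q : Schema Γ} {a} (h : Step P a Q) (J : Schema Γ) :
    Step (P.seq J) a (Q.seq J) := by
  cases h with
  | assign => exact .assign _ _ _ _ _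
  | test h Z =>
    rw [← next_seq h.ne_skip]
    exact .test (h.seq J) Z

theorem Run.seq {P Q : Schema Γ} {σ} (h : Run P σ Q) (J : Schema Γ) :
    Run (P.seq J) σ (Q.seq J) := by
  induction h with
  | nil => exact .nil _
  | cons hs _ ih => exact .cons (hs.seq J) ih

/-- From every point of a schema there is a path to its end. -/
theorem exists_run_skip (P : Schema Γ) : ∃ σ, Run P σ skip := by
  induction hn : P.size using Nat.strong_induction_on generalizing P with
  | _ n ih =>
    subst hn
    by_cases h : P = skip
    · exact ⟨[], h ▸ .nil _⟩
    · obtain ⟨σ, hσ⟩ := ih _ (size_next_false h) _ rfl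
      have : ∃ a, Step P a (next false P) := by
        cases P with
        | skip => exact absurd rfl h
        | assign => exact ⟨_, .assign _ _ _ _ _⟩
        | ifte => exact ⟨_, .test (.ifte _ _ _ _ _ _) false⟩
        | loop => exact ⟨_, .test (.loop _ _ _ _ _) false⟩
      obtain ⟨a, ha⟩ := this
      exact ⟨_, .cons ha hσ⟩

theorem paths_seq (S T : Schema Γ) : (S.seq T).paths = S.paths * T.paths := by
  induction S <;> simp_all [seq, paths, mul_assoc]

theorem paths_ifte (p l x) (T₁ T₂ R : Schema Γ) :
    (ifte p l x T₁ T₂ R).paths =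
      {[Letter.test p l x true]} * (T₁.seq R).paths +
        {[Letter.test p l x false]} * (T₂.seq R).paths := by
  rw [paths, paths_seq, paths_seq, add_mul, mul_assoc, mul_assoc]

theorem paths_loop (p l x) (T R : Schema Γ) :
    (loop p l x T R).paths =
      {[Letter.test p l x true]} * (T.seq (loop p l x T R)).paths +
        {[Letter.test p l x false]} * R.paths := by
  rw [paths_seq, paths]
  conv_lhs => rw [← Language.one_add_self_mul_kstar_eq_kstar]
  simp only [add_mul, one_mul, mul_assoc]
  rw [add_comm]

theorem mem_singleton_mul {α : Type*} {a : α} {L : Language α} {σ : List α} :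
    σ ∈ ({[a]} : Language α) * L ↔ ∃ τ, σ = a :: τ ∧ τ ∈ L := by
  rw [Language.mem_mul]
  constructor
  · rintro ⟨_, rfl, τ, hτ, rfl⟩
    exact ⟨τ, rfl, hτ⟩
  · rintro ⟨τ, rfl, hτ⟩
    exact ⟨_, rfl, τ, hτ, rfl⟩

/-- The terminated paths are the words that lead to the empty schema. -/
theorem mem_paths_iff {P : Schema Γ} {σ : List (Letter Γ)} : σ ∈ P.paths ↔ Run P σ skip := by
  constructor
  · intro h
    induction σ generalizing P with
    | nil =>
      cases P with
      | skip => exact .nil _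
      | assign => rw [paths, mem_singleton_mul] at h; simp at h
      | ifte =>
        rw [paths_ifte, Language.mem_add, mem_singleton_mul, mem_singleton_mul] at h; simp at h
      | loop =>
        rw [paths_loop, Language.mem_add, mem_singleton_mul, mem_singleton_mul] at h; simp at h
    | cons a σ ih =>
      cases P with
      | skip => rw [paths, Language.mem_one] at h; simp at h
      | assign =>
        rw [paths, mem_singleton_mul] at h
        obtain ⟨τ, h1, h2⟩ := h
        cases h1
        exact .cons (.assign _ _ _ _ _) (ih h2)
      | ifte =>
        rw [paths_ifte, Language.mem_add, mem_singleton_mul, mem_singleton_mul] at h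
        rcases h with ⟨τ, h1, h2⟩ | ⟨τ, h1, h2⟩ <;> cases h1
        · exact .cons (.test (.ifte _ _ _ _ _ _) true) (ih h2)
        · exact .cons (.test (.ifte _ _ _ _ _ _) false) (ih h2)
      | loop =>
        rw [paths_loop, Language.mem_add, mem_singleton_mul, mem_singleton_mul] at h
        rcases h with ⟨τ, h1, h2⟩ | ⟨τ, h1, h2⟩ <;> cases h1
        · exact .cons (.test (.loop _ _ _ _ _) true) (ih h2)
        · exact .cons (.test (.loop _ _ _ _ _) false) (ih h2)
  · intro h
    generalize hQ : skip = Q at h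
    induction h with
    | nil => subst hQ; rfl
    | cons hs _ ih =>
      have := ih hQ
      cases hs with
      | assign => rw [paths, mem_singleton_mul]; exact ⟨_, rfl, this⟩
      | test ht Z =>
        cases ht with
        | ifte =>
          rw [paths_ifte, Language.mem_add, mem_singleton_mul, mem_singleton_mul]
          cases Z
          · exact .inr ⟨_, rfl, this⟩
          · exact .inl ⟨_, rfl, this⟩
        | loop =>
          rw [paths_loop, Language.mem_add, mem_singleton_mul, mem_singleton_mul]
          cases Z
          · exact .inr ⟨_, rfl, this⟩
          · exact .inl ⟨_, rfl, this⟩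

theorem mem_pathPrefixes_iff {P : Schema Γ} {σ : List (Letter Γ)} :
    σ ∈ P.pathPrefixes ↔ ∃ Q, Run P σ Q := by
  constructor
  · rintro ⟨τ, h⟩
    obtain ⟨Q, h, -⟩ := run_append_iff.1 (mem_paths_iff.1 h)
    exact ⟨Q, h⟩
  · rintro ⟨Q, h⟩
    obtain ⟨τ, hτ⟩ := exists_run_skip Q
    exact ⟨τ, mem_paths_iff.2 (h.append hτ)⟩

theorem mem_pathSegments_iff {P : Schema Γ} {μ : List (Letter Γ)} :
    μ ∈ P.pathSegments ↔ ∃ α Q R, Run P α Q ∧ Run Q μ R := by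
  constructor
  · rintro ⟨α, β, h⟩
    obtain ⟨R, h, -⟩ := run_append_iff.1 (mem_paths_iff.1 h)
    obtain ⟨Q, h1, h2⟩ := run_append_iff.1 h
    exact ⟨α, Q, R, h1, h2⟩
  · rintro ⟨α, Q, R, h1, h2⟩
    obtain ⟨τ, hτ⟩ := exists_run_skip R
    exact ⟨α, τ, mem_paths_iff.2 ((h1.append h2).append hτ)⟩

theorem mem_terminalSegments_iff {P : Schema Γ} {ν : List (Letter Γ)} :
    ν ∈ P.terminalSegments ↔ ∃ α Q, Run P α Q ∧ Run Q ν skip := by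
  constructor
  · rintro ⟨α, h⟩
    obtain ⟨Q, h1, h2⟩ := run_append_iff.1 (mem_paths_iff.1 h)
    exact ⟨α, Q, h1, h2⟩
  · rintro ⟨α, Q, h1, h2⟩
    exact ⟨α, mem_paths_iff.2 (h1.append h2)⟩

/-! ### Control points -/

/-- The labelled symbol of the first statement of a schema. -/
def head? : Schema Γ → Option Γ.LSym
  | skip => none
  | assign _ f l _ _ => some (.inl f, l)
  | ifte p l _ _ _ _ => some (.inr p, l)
  | loop p l _ _ _ => some (.inr p, l)

/-- The control points inside the schema `A` when it is followed by `J`: for each occurrence of a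
labelled symbol in `A`, in textual order, the schema that remains to be executed when control
has reached that occurrence. -/
def points : Schema Γ → Schema Γ → List (Schema Γ)
  | skip, _ => []
  | assign y f l x R, J => (assign y f l x R).seq J :: R.points J
  | ifte p l x T₁ T₂ R, J =>
      (ifte p l x T₁ T₂ R).seq J :: (T₁.points (R.seq J) ++ T₂.points (R.seq J) ++ R.points J)
  | loop p l x T R, J =>
      (loop p l x T R).seq J :: (T.points ((loop p l x T R).seq J) ++ R.points J)

theorem map_head?_points (A J : Schema Γ) : (A.points J).map head? = A.occs.map some := by
  induction A generalizing J <;> simp_all [points, occs, seq, head?]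

theorem seq_mem_points (A J : Schema Γ) : A.seq J ∈ A.points J ∨ A.seq J = J := by
  cases A <;> simp [points, seq]

theorem ne_skip_of_mem_points {A J P : Schema Γ} (h : P ∈ A.points J) : P ≠ skip := by
  rintro rfl
  have : head? (skip : Schema Γ) ∈ (A.points J).map head? := List.mem_map_of_mem h
  rw [map_head?_points] at this
  simp [head?] at this

theorem Step.mem_points {A J P Q : Schema Γ} {a} (hP : P ∈ A.points J) (h : Step P a Q) :
    Q ∈ A.points J ∨ Q = J := by
  induction A generalizing J with
  | skip => simp [points] at hP
  | assign y f l x R ih =>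
    simp only [points, List.mem_cons] at hP ⊢
    rcases hP with rfl | hP
    · cases h with
      | assign => rcases seq_mem_points R J with h | h <;> simp [h]
      | test h => cases h
    · rcases ih hP with h | h <;> simp [h]
  | ifte p l x T₁ T₂ R ih₁ ih₂ ih =>
    have hR := seq_mem_points R J
    have h₁ := seq_mem_points T₁ (R.seq J)
    have h₂ := seq_mem_points T₂ (R.seq J)
    simp only [points, List.mem_cons, List.mem_append] at hP ⊢
    rcases hP with rfl | (hP | hP) | hP
    · have key : Q = T₁.seq (R.seq J) ∨ Q = T₂.seq (R.seq J) := by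
        rw [Schema.seq] at h
        cases h with
        | test h Z => cases Z <;> simp [next]
      grind
    · rcases ih₁ hP with h | h <;> grind
    · rcases ih₂ hP with h | h <;> grind
    · rcases ih hP with h | h <;> grind
  | loop p l x T R ihT ih =>
    have hR := seq_mem_points R J
    have h₁ := seq_mem_points T ((loop p l x T R).seq J)
    simp only [points, List.mem_cons, List.mem_append] at hP ⊢
    rcases hP with rfl | hP | hP
    · have key : Q = T.seq ((loop p l x T R).seq J) ∨ Q = R.seq J := by
        rw [Schema.seq] at h ⊢
        cases h with
        | test h Z => cases Z <;> simp [next]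
      grind
    · rcases ihT hP with h | h <;> grind
    · rcases ih hP with h | h <;> grind

theorem Run.mem_points {A J P Q : Schema Γ} {σ} (hP : P ∈ A.points J ∨ P = skip) (h : Run P σ Q)
    (hJ : J = skip) : Q ∈ A.points J ∨ Q = skip := by
  induction h with
  | nil => exact hP
  | cons hs _ ih =>
    rcases hP with hP | rfl
    · exact ih (hJ ▸ hs.mem_points hP)
    · cases hs with | test h => cases h

/-- In a schema with distinct labels, a labelled symbol determines its control point. -/
theorem point_unique {S P Q : Schema Γ} (hS : S.DistinctLabels) {σ τ} (hP : Run S σ P)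
    (hQ : Run S τ Q) (h : P.head? = Q.head?) : P = Q := by
  have hS' := seq_mem_points S skip
  rw [seq_skip] at hS'
  have key : ∀ {P σ}, Run S σ P → P ∈ S.points skip ∨ P = skip := fun h => h.mem_points hS' rfl
  have hn : ((S.points skip).map head?).Nodup := by
    rw [map_head?_points]
    exact hS.map (Option.some_injective _)
  have none_iff : ∀ {P : Schema Γ}, P.head? = none → P = skip := by
    intro P h; cases P <;> simp_all [head?]
  rcases key hP with hP | rfl
  · rcases key hQ with hQ | rfl
    · exact List.inj_on_of_nodup_map hn hP hQ h
    · exact none_iff h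
  · exact (none_iff h.symm).symm

/-- Every control point is reached by some path. -/
theorem exists_run_of_mem_points {A J P : Schema Γ} (h : P ∈ A.points J) :
    ∃ σ, Run (A.seq J) σ P := by
  have key : ∀ A J : Schema Γ, ∃ σ, Run (A.seq J) σ J := fun A J => by
    obtain ⟨σ, h⟩ := exists_run_skip A
    exact ⟨σ, h.seq J⟩
  induction A generalizing J with
  | skip => simp [points] at h
  | assign y f l x R ih =>
    simp only [points, List.mem_cons] at h
    rcases h with rfl | h
    · exact ⟨[], .nil _⟩
    · obtain ⟨σ, h⟩ := ih h
      exact ⟨_, .cons (.assign _ _ _ _ _) h⟩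
  | ifte p l x T₁ T₂ R ih₁ ih₂ ih =>
    simp only [points, List.mem_cons, List.mem_append] at h
    rcases h with rfl | (h | h) | h
    · exact ⟨[], .nil _⟩
    · obtain ⟨σ, h⟩ := ih₁ h
      exact ⟨_, .cons (.test (.ifte _ _ _ _ _ _) true) h⟩
    · obtain ⟨σ, h⟩ := ih₂ h
      exact ⟨_, .cons (.test (.ifte _ _ _ _ _ _) false) h⟩
    · obtain ⟨σ, h⟩ := ih h
      obtain ⟨τ, h'⟩ := key T₂ (R.seq J)
      exact ⟨_, .cons (.test (.ifte _ _ _ _ _ _) false) (h'.append h)⟩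
  | loop p l x T R ihT ih =>
    simp only [points, List.mem_cons, List.mem_append] at h
    rcases h with rfl | h | h
    · exact ⟨[], .nil _⟩
    · obtain ⟨σ, h⟩ := ihT h
      exact ⟨_, .cons (.test (.loop _ _ _ _ _) true) h⟩
    · obtain ⟨σ, h⟩ := ih h
      exact ⟨_, .cons (.test (.loop _ _ _ _ _) false) h⟩

end Schema

/-! ### Words of letters and the states they produce -/

/-- The variable to which a letter assigns. -/
def Letter.target : Letter Γ → Option Γ.Var
  | .assign y _ _ _ => some y
  | .test _ _ _ _ => none

/-- A word either does not assign to `x`, or it has a last assignment to `x`. -/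
theorem last_assign (σ : List (Letter Γ)) (x : Γ.Var) :
    (∀ b ∈ σ, b.target ≠ some x) ∨
      ∃ μ f l a ν, σ = μ ++ Letter.assign x f l a :: ν ∧ ∀ b ∈ ν, b.target ≠ some x := by
  induction σ with
  | nil => simp
  | cons c σ ih =>
    rcases ih with ih | ⟨μ, f, l, a, ν, rfl, h⟩
    · cases c with
      | assign y f l a =>
        by_cases hy : y = x
        · subst hy
          exact .inr ⟨[], f, l, a, σ, rfl, ih⟩
        · left
          simpa [Letter.target, hy] using ih
      | test =>
        left
        simpa [Letter.target] using ih
    · exact .inr ⟨c :: μ, f, l, a, ν, rfl, h⟩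

theorem Interp.run_append {D : Type u} (i : Interp Γ D) (d : Γ.Var → D) (σ τ : List (Letter Γ)) :
    i.run d (σ ++ τ) = i.run (i.run d σ) τ := List.foldl_append

theorem Interp.run_cons {D : Type u} (i : Interp Γ D) (d : Γ.Var → D) (a) (τ : List (Letter Γ)) :
    i.run d (a :: τ) = i.run (i.step d a) τ := rfl

theorem Interp.run_of_forall_ne {D : Type u} (i : Interp Γ D) (d : Γ.Var → D)
    {σ : List (Letter Γ)} {x : Γ.Var} (h : ∀ b ∈ σ, b.target ≠ some x) : i.run d σ x = d x := by
  induction σ generalizing d with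
  | nil => rfl
  | cons c σ ih =>
    rw [i.run_cons, ih _ fun b hb => h b (List.mem_cons_of_mem _ hb)]
    have := h c List.mem_cons_self
    cases c with
    | assign y f l a =>
      have hy : x ≠ y := by rintro rfl; simp [Letter.target] at this
      simp [Interp.step, hy]
    | test => rfl

theorem Interp.run_last {D : Type u} (i : Interp Γ D) (d : Γ.Var → D) (μ : List (Letter Γ))
    {ν : List (Letter Γ)} {x : Γ.Var} (f l a) (h : ∀ b ∈ ν, b.target ≠ some x) :
    i.run d (μ ++ Letter.assign x f l a :: ν) x = i.func f fun k => i.run d μ (a k) := by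
  rw [i.run_append, i.run_cons, i.run_of_forall_ne _ h]
  simp [Interp.step]

theorem Interp.follows_append {D : Type u} (i : Interp Γ D) (d : Γ.Var → D)
    (σ τ : List (Letter Γ)) :
    i.Follows d (σ ++ τ) ↔ i.Follows d σ ∧ i.Follows (i.run d σ) τ := by
  constructor
  · refine fun h => ⟨fun ρ p l x Z hρ => h ρ p l x Z (hρ.trans (List.prefix_append _ _)),
      fun ρ p l x Z hρ => ?_⟩
    have := h (σ ++ ρ) p l x Z
      (by rw [List.append_assoc]; exact (List.prefix_append_right_inj σ).2 hρ)
    rwa [i.run_append] at this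
  · rintro ⟨h1, h2⟩ ρ p l x Z hρ
    rcases List.prefix_or_prefix_of_prefix hρ (List.prefix_append σ τ) with h | ⟨ρ', h⟩
    · exact h1 ρ p l x Z h
    · rcases List.eq_nil_or_concat ρ' with rfl | ⟨ρ₁, b, rfl⟩
      · rw [List.append_nil] at h
        exact h1 ρ p l x Z (h ▸ List.prefix_rfl)
      · rw [List.concat_eq_append, ← List.append_assoc] at h
        obtain ⟨rfl, hb⟩ := List.append_inj' h rfl
        rw [i.run_append]
        refine h2 ρ₁ p l x Z ?_
        rw [List.append_assoc] at hρ
        exact (List.prefix_append_right_inj σ).1 hρ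

theorem Interp.follows_test {D : Type u} (i : Interp Γ D) (d : Γ.Var → D) (p l x Z) :
    i.Follows d [Letter.test p l x Z] ↔ i.pred p (fun k => d (x k)) = Z := by
  constructor
  · exact fun h => h [] p l x Z List.prefix_rfl
  · intro h ρ p' l' x' Z' hρ
    have hl := hρ.length_le
    have : ρ = [] := by
      cases ρ <;> simp_all
    subst this
    have := List.IsPrefix.eq_of_length hρ rfl
    simp only [List.nil_append, List.cons.injEq, Letter.test.injEq, and_true] at this
    obtain ⟨rfl, rfl, hx, rfl⟩ := this
    cases hx
    exact h

theorem Interp.follows_assign {D : Type u} (i : Interp Γ D) (d : Γ.Var → D) (y f l x) :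
    i.Follows d [Letter.assign y f l x] := by
  intro ρ p' l' x' Z' hρ
  have hl := hρ.length_le
  have : ρ = [] := by
    cases ρ <;> simp_all
  subst this
  have := List.IsPrefix.eq_of_length hρ rfl
  simp at this

theorem Interp.follows_cons {D : Type u} (i : Interp Γ D) (d : Γ.Var → D) (a)
    (τ : List (Letter Γ)) :
    i.Follows d (a :: τ) ↔ i.Follows d [a] ∧ i.Follows (i.step d a) τ :=
  i.follows_append d [a] τ

theorem symbolic_concat (σ : List (Letter Γ)) (y f l x) :
    symbolic (σ ++ [Letter.assign y f l x]) y =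
      Term.app (ar := fun fl : Γ.Func × Γ.Label => Γ.farity fl.1) (f, l)
        (fun k => symbolic σ (x k)) := by
  simp [symbolic, List.foldl_append]

theorem symbolic_append_of_forall_ne (σ : List (Letter Γ)) {τ : List (Letter Γ)} {x : Γ.Var}
    (h : ∀ b ∈ τ, b.target ≠ some x) : symbolic (σ ++ τ) x = symbolic σ x := by
  induction τ using List.reverseRecOn with
  | nil => simp
  | append_singleton τ c ih =>
    have h1 : symbolic (σ ++ τ) x = symbolic σ x :=
      ih fun b hb => h b (List.mem_append_left _ hb)
    rw [← h1]
    have := h c (by simp)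
    cases c with
    | assign y f l a =>
      have hy : x ≠ y := by rintro rfl; simp [Letter.target] at this
      simp [symbolic, List.foldl_append, hy]
    | test => simp [symbolic, List.foldl_append]

theorem symbolic_last (μ : List (Letter Γ)) {ν : List (Letter Γ)} {x : Γ.Var} (f l a)
    (h : ∀ b ∈ ν, b.target ≠ some x) :
    symbolic (μ ++ Letter.assign x f l a :: ν) x =
      Term.app (ar := fun fl : Γ.Func × Γ.Label => Γ.farity fl.1) (f, l)
        (fun k => symbolic μ (a k)) := by
  rw [← List.singleton_append, ← List.append_assoc, symbolic_append_of_forall_ne _ h,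
    symbolic_concat]

/-- If the symbolic value of a variable is a function application, it was created by the last
assignment to that variable. -/
theorem exists_of_symbolic_eq_app {σ : List (Letter Γ)} {x : Γ.Var} {f l ts}
    (h : symbolic σ x =
      Term.app (ar := fun fl : Γ.Func × Γ.Label => Γ.farity fl.1) (f, l) ts) :
    ∃ μ a ν, σ = μ ++ Letter.assign x f l a :: ν ∧ (∀ b ∈ ν, b.target ≠ some x) ∧
      ∀ k, ts k = symbolic μ (a k) := by
  rcases last_assign σ x with h' | ⟨μ, g, m, a, ν, rfl, h'⟩
  · have := symbolic_append_of_forall_ne [] h'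
    rw [List.nil_append, h] at this
    simp [symbolic] at this
  · rw [symbolic_last _ _ _ _ h'] at h
    simp only [Term.app.injEq, Prod.mk.injEq] at h
    obtain ⟨⟨rfl, rfl⟩, h⟩ := h
    exact ⟨μ, a, ν, rfl, h', fun k => (congrFun (eq_of_heq h) k).symm⟩

/-! ### Herbrand executions -/

/-- States over the Herbrand domain. -/
abbrev State (Γ : Signature.{u}) : Type u := Γ.Var → Γ.HTerm

/-- A query to a Herbrand interpretation: a predicate symbol with a vector of arguments. -/
abbrev Query (Γ : Signature.{u}) : Type u := Σ p : Γ.Pred, (Fin (Γ.parity p) → Γ.HTerm)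

open Classical in
/-- The Herbrand interpretation in which precisely the queries in `e` have the answer true. -/
noncomputable def herb (e : Finset (Query Γ)) : Interp Γ Γ.HTerm where
  func f ts := Term.app f ts
  pred p ts := decide ((⟨p, ts⟩ : Query Γ) ∈ e)

theorem herb_isHerbrand (e : Finset (Query Γ)) : (herb e).IsHerbrand := fun _ _ => rfl

/-- The state reached from `d` after the assignments along a word in a Herbrand execution; it does
not depend on the interpretation of the predicate symbols. -/
noncomputable def after (d : State Γ) (σ : List (Letter Γ)) : State Γ := (herb ∅).run d σ

theorem Interp.IsHerbrand.run_eq {i : Interp Γ Γ.HTerm} (h : i.IsHerbrand) (d : State Γ)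
    (σ : List (Letter Γ)) : i.run d σ = after d σ := by
  have : i.step = (herb ∅).step := by
    funext d a
    cases a with
    | assign y f l x => simp [Interp.step, h f, herb]
    | test => rfl
  rw [after, Interp.run, Interp.run, this]

theorem after_append (d : State Γ) (σ τ : List (Letter Γ)) :
    after d (σ ++ τ) = after (after d σ) τ := Interp.run_append _ _ _ _

namespace Schema

/-- The query made by the first statement of a schema in the state `d`. -/
def query : Schema Γ → State Γ → Option (Query Γ)
  | ifte p _ x _ _ _, d => some ⟨p, fun k => d (x k)⟩
  | loop p _ x _ _, d => some ⟨p, fun k => d (x k)⟩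
  | _, _ => none

open Classical in
/-- The effect of the first statement of a schema on the state. -/
noncomputable def upd : Schema Γ → State Γ → State Γ
  | assign y f _ x _, d => Function.update d y (Term.app f fun k => d (x k))
  | _, d => d

/-- A configuration of a Herbrand execution: the schema that remains to be executed and the
current state. -/
abbrev Cfg (Γ : Signature.{u}) : Type u := Schema Γ × State Γ

/-- The configuration after one step, in which a test has outcome `Z`. -/
noncomputable def adv (Z : Bool) (c : Cfg Γ) : Cfg Γ := (next Z c.1, upd c.1 c.2)

theorem IsTest.query_eq {P : Schema Γ} {p l x} (h : IsTest P p l x) (d : State Γ) :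
    P.query d = some ⟨p, fun k => d (x k)⟩ := by cases h <;> rfl

theorem IsTest.upd_eq {P : Schema Γ} {p l x} (h : IsTest P p l x) (d : State Γ) :
    P.upd d = d := by cases h <;> rfl

theorem exists_isTest_of_query {P : Schema Γ} {d : State Γ} {q} (h : P.query d = some q) :
    ∃ p l x, IsTest P p l x ∧ q = ⟨p, fun k => d (x k)⟩ := by
  cases P with
  | skip => simp [query] at h
  | assign => simp [query] at h
  | ifte => simp only [query, Option.some.injEq] at h; exact ⟨_, _, _, .ifte _ _ _ _ _ _, h.symm⟩
  | loop => simp only [query, Option.some.injEq] at h; exact ⟨_, _, _, .loop _ _ _ _ _, h.symm⟩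

theorem Step.exists_next {P Q : Schema Γ} {a} (h : Step P a Q) (d : State Γ) :
    ∃ Z, Q = next Z P ∧ after d [a] = upd P d := by
  cases h with
  | assign => exact ⟨true, rfl, rfl⟩
  | test h Z => exact ⟨Z, rfl, (h.upd_eq d).symm⟩

theorem exists_step {P : Schema Γ} (h : P ≠ skip) (Z : Bool) (d : State Γ) :
    ∃ a, Step P a (next Z P) ∧ after d [a] = upd P d := by
  have : ∃ a, Step P a (next Z P) := by
    cases P with
    | skip => exact absurd rfl h
    | assign => exact ⟨_, .assign _ _ _ _ _⟩
    | ifte => exact ⟨_, .test (.ifte _ _ _ _ _ _) Z⟩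
    | loop => exact ⟨_, .test (.loop _ _ _ _ _) Z⟩
  obtain ⟨a, ha⟩ := this
  obtain ⟨-, -, h⟩ := ha.exists_next d
  exact ⟨a, ha, h⟩

/-- The configuration `c` lies on a syntactic path of `S` from the natural state. -/
def Reach (S : Schema Γ) (c : Cfg Γ) : Prop :=
  ∃ σ, Run S σ c.1 ∧ c.2 = after Term.var σ

/-- The configuration `c'` lies on a syntactic path from `c`. -/
def Leads (c c' : Cfg Γ) : Prop := ∃ σ, Run c.1 σ c'.1 ∧ c'.2 = after c.2 σ

theorem Leads.refl (c : Cfg Γ) : Leads c c := ⟨[], .nil _, rfl⟩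

theorem Leads.trans {c c' c'' : Cfg Γ} (h : Leads c c') (h' : Leads c' c'') : Leads c c'' := by
  obtain ⟨σ, h1, h2⟩ := h
  obtain ⟨τ, h3, h4⟩ := h'
  exact ⟨σ ++ τ, h1.append h3, by rw [after_append, h4, h2]⟩

theorem leads_adv (c : Cfg Γ) (Z : Bool) : Leads c (adv Z c) := by
  obtain ⟨P, d⟩ := c
  by_cases h : P = skip
  · subst h; exact .refl _
  · obtain ⟨a, h1, h2⟩ := exists_step h Z d
    exact ⟨[a], .single h1, h2.symm⟩

theorem Reach.leads {S : Schema Γ} {c c' : Cfg Γ} (h : Reach S c) (h' : Leads c c') :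
    Reach S c' := by
  obtain ⟨σ, h1, h2⟩ := h
  obtain ⟨τ, h3, h4⟩ := h'
  exact ⟨σ ++ τ, h1.append h3, by rw [after_append, h4, h2]⟩

theorem Reach.adv {S : Schema Γ} {c : Cfg Γ} (h : Reach S c) (Z : Bool) : Reach S (adv Z c) :=
  h.leads (leads_adv c Z)

/-- The query `q` is not made on any syntactic path from `c`. -/
def Fresh (q : Query Γ) (c : Cfg Γ) : Prop := ∀ c', Leads c c' → c'.1.query c'.2 ≠ some q

theorem Fresh.leads {q : Query Γ} {c c' : Cfg Γ} (h : Fresh q c) (h' : Leads c c') : Fresh q c' :=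
  fun c'' h'' => h c'' (h'.trans h'')

theorem Fresh.adv {q : Query Γ} {c : Cfg Γ} (h : Fresh q c) (Z : Bool) : Fresh q (adv Z c) :=
  h.leads (leads_adv c Z)

/-- In a free schema, no query is made twice along a path: the path could be continued by the two
different outcomes. -/
theorem Reach.fresh {S : Schema Γ} (hS : S.Free) {c : Cfg Γ} (h : Reach S c) {q : Query Γ}
    (hq : c.1.query c.2 = some q) (Z : Bool) : Fresh q (Schema.adv Z c) := by
  rintro c' ⟨τ, h1, h2⟩ hq'
  obtain ⟨σ, h3, h4⟩ := h
  obtain ⟨p, l, x, ht, rfl⟩ := exists_isTest_of_query hq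
  obtain ⟨p', l', x', ht', he⟩ := exists_isTest_of_query hq'
  have hupd : (Schema.adv Z c).2 = c.2 := ht.upd_eq _
  rw [hupd] at h2
  have hw : Run S (σ ++ ([Letter.test p l x Z] ++ (τ ++ [Letter.test p' l' x' !Z]))) (next (!Z) c'.1) :=
    h3.append ((Run.single (.test ht Z)).append (h1.append (.single (.test ht' _))))
  obtain ⟨i, hi, -, hf⟩ := hS _ (mem_pathPrefixes_iff.2 ⟨_, hw⟩)
  rw [i.follows_append, i.follows_append, i.follows_append, i.follows_test, i.follows_test,
    hi.run_eq, hi.run_eq, hi.run_eq, ← h4] at hf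
  have h5 : after c.2 [Letter.test p l x Z] = c.2 := rfl
  rw [h5, ← h2] at hf
  obtain ⟨-, hf1, -, hf2⟩ := hf
  obtain ⟨rfl, he⟩ := Sigma.mk.inj_iff.1 he
  rw [← eq_of_heq he, hf1] at hf2
  cases Z <;> simp at hf2

/-- In a free and liberal schema, an assignment always creates a term that is not the value of any
variable at an earlier point of the path. -/
theorem Reach.ne_of_assigned {S : Schema Γ} (hS : S.Free) (hL : S.Liberal) {c : Cfg Γ}
    (h : Reach S c) {σ Q} (hσ : Run c.1 σ Q) {x : Γ.Var} (hx : ∃ b ∈ σ, b.target = some x)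
    (z : Γ.Var) : after c.2 σ x ≠ c.2 z := by
  rcases last_assign σ x with h' | ⟨μ, f, l, a, ν, rfl, h'⟩
  · obtain ⟨b, hb, hb'⟩ := hx
    exact absurd hb' (h' b hb)
  obtain ⟨τ, h1, h2⟩ := h
  rw [h2, after, Interp.run_last _ _ _ _ _ _ h']
  rcases last_assign τ z with h3 | ⟨μ', g, m, b, ν', rfl, h3⟩
  · rw [after, Interp.run_of_forall_ne _ _ h3]
    simp [herb]
  · intro heq
    have hw : Run S ((μ' ++ Letter.assign z g m b :: ν') ++ μ ++ [Letter.assign x f l a] ++ ν) Q := by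
      simpa using h1.append hσ
    rw [run_append_iff] at hw
    obtain ⟨M, hw, -⟩ := hw
    have hp := mem_pathPrefixes_iff.2 ⟨_, hw⟩
    obtain ⟨i, hi, he⟩ := hS _ hp
    have hl := hL i hi μ' (ν' ++ μ) z g m b x f l a (by simpa using he)
    rw [hi.run_eq, hi.run_eq] at hl
    apply hl
    have e1 : after Term.var (μ' ++ [Letter.assign z g m b]) z =
        after Term.var (μ' ++ Letter.assign z g m b :: ν') z := by
      rw [after, after, Interp.run_last _ _ _ _ _ _ h3,
        Interp.run_last (ν := []) _ _ _ _ _ _ (by simp)]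
    have e2 : μ' ++ [Letter.assign z g m b] ++ (ν' ++ μ) ++ [Letter.assign x f l a] =
        (μ' ++ Letter.assign z g m b :: ν') ++ (μ ++ Letter.assign x f l a :: []) := by simp
    rw [e1, ← heq, e2]
    refine Eq.symm ((congrFun (after_append _ _ _) x).trans ?_)
    exact Interp.run_last (ν := []) _ _ μ f l a fun b hb => absurd hb List.not_mem_nil

/-! ### The outcome of an execution as a function of the true queries -/

open Classical in
/-- One step of the execution in which precisely the queries in `e` are true. -/
noncomputable def mach (e : Finset (Query Γ)) (c : Cfg Γ) : Cfg Γ :=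
  adv (decide (∃ q ∈ e, c.1.query c.2 = some q)) c

open Classical in
/-- The final value of the variable `v` in the execution from `c` in which precisely the queries
in `e` are true.  For an execution that does not terminate, the value is irrelevant. -/
noncomputable def out (v : Γ.Var) (e : Finset (Query Γ)) (c : Cfg Γ) : Γ.HTerm :=
  if h : ∃ n, ((mach e)^[n] c).1 = skip then ((mach e)^[h.choose] c).2 v else Term.var v

theorem mach_skip (e : Finset (Query Γ)) {c : Cfg Γ} (h : c.1 = skip) : mach e c = c := by
  obtain ⟨P, d⟩ := c
  subst h
  simp [mach, adv, next, upd]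

theorem out_eq_of_iterate {v : Γ.Var} {e : Finset (Query Γ)} {c : Cfg Γ} {n : ℕ}
    (h : ((mach e)^[n] c).1 = skip) : out v e c = ((mach e)^[n] c).2 v := by
  have hex : ∃ n, ((mach e)^[n] c).1 = skip := ⟨n, h⟩
  rw [out, dif_pos hex]
  have key : ∀ m k, ((mach e)^[m] c).1 = skip → (mach e)^[m + k] c = (mach e)^[m] c := by
    intro m k hm
    rw [Nat.add_comm, Function.iterate_add_apply]
    exact Function.iterate_fixed (mach_skip e hm) k
  rcases le_total n hex.choose with hle | hle
  · obtain ⟨k, hk⟩ := Nat.exists_eq_add_of_le hle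
    rw [hk, key n k h]
  · obtain ⟨k, hk⟩ := Nat.exists_eq_add_of_le hle
    conv_rhs => rw [hk, key _ k hex.choose_spec]

theorem out_skip {v : Γ.Var} {e : Finset (Query Γ)} {c : Cfg Γ} (h : c.1 = skip) :
    out v e c = c.2 v := out_eq_of_iterate (n := 0) h

theorem out_mach (v : Γ.Var) (e : Finset (Query Γ)) (c : Cfg Γ) :
    out v e (mach e c) = out v e c := by
  by_cases h : ∃ n, ((mach e)^[n] c).1 = skip
  · obtain ⟨n, hn⟩ := h
    have : ((mach e)^[n + 1] c) = (mach e)^[n] c := by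
      rw [Function.iterate_succ_apply', mach_skip e hn]
    rw [out_eq_of_iterate hn, ← this, Function.iterate_succ_apply]
    exact out_eq_of_iterate (by rw [← Function.iterate_succ_apply, this]; exact hn)
  · have h' : ¬ ∃ n, ((mach e)^[n] (mach e c)).1 = skip := by
      rintro ⟨n, hn⟩
      exact h ⟨n + 1, by rwa [Function.iterate_succ_apply]⟩
    rw [out, dif_neg h', out, dif_neg h]

theorem out_adv_of_none {v : Γ.Var} {e : Finset (Query Γ)} {c : Cfg Γ}
    (h : c.1.query c.2 = none) : out v e c = out v e (adv false c) := by
  rw [← out_mach, mach]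
  simp [h]

theorem out_adv_true {v : Γ.Var} {e : Finset (Query Γ)} {c : Cfg Γ} {q}
    (h : c.1.query c.2 = some q) (hq : q ∈ e) : out v e c = out v e (adv true c) := by
  rw [← out_mach, mach]
  simp [h, hq]

theorem out_adv_false {v : Γ.Var} {e : Finset (Query Γ)} {c : Cfg Γ} {q}
    (h : c.1.query c.2 = some q) (hq : q ∉ e) : out v e c = out v e (adv false c) := by
  rw [← out_mach, mach]
  simp [h, hq]

/-- Fresh queries do not matter for the outcome. -/
theorem out_congr {v : Γ.Var} {e e' : Finset (Query Γ)} {c : Cfg Γ}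
    (h : ∀ q, (q ∈ e ↔ q ∈ e') ∨ Fresh q c) : out v e c = out v e' c := by
  have key : ∀ n, (mach e)^[n] c = (mach e')^[n] c := by
    intro n
    induction n generalizing c with
    | zero => rfl
    | succ n ih =>
      have hm : mach e c = mach e' c := by
        unfold mach
        congr 2
        apply propext
        refine exists_congr fun q => and_congr_left fun hq => ?_
        exact (h q).resolve_right fun hf => hf c (.refl c) hq
      rw [Function.iterate_succ_apply, Function.iterate_succ_apply, ← hm]
      exact ih fun q => (h q).imp_right fun hf => hf.adv _
  by_cases hn : ∃ n, ((mach e)^[n] c).1 = skip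
  · obtain ⟨n, hn⟩ := hn
    rw [out_eq_of_iterate hn, out_eq_of_iterate (key n ▸ hn), key n]
  · have hn' : ¬ ∃ n, ((mach e')^[n] c).1 = skip := by simpa only [key] using hn
    rw [out, dif_neg hn, out, dif_neg hn']

open Classical in
theorem Fresh.out_erase {v : Γ.Var} {e : Finset (Query Γ)} {q : Query Γ} {c : Cfg Γ}
    (h : Fresh q c) : out v (e.erase q) c = out v e c :=
  out_congr fun q' => by by_cases hq : q' = q <;> simp [hq, h]

open Classical in
theorem Fresh.out_insert {v : Γ.Var} {e : Finset (Query Γ)} {q : Query Γ} {c : Cfg Γ}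
    (h : Fresh q c) : out v (insert q e) c = out v e c :=
  out_congr fun q' => by by_cases hq : q' = q <;> simp [hq, h]

/-! ### Structure of the control points -/

theorem Run.mem_points_skip {S P : Schema Γ} {σ} (h : Run S σ P) (hP : P ≠ skip) :
    P ∈ S.points skip := by
  have hS := seq_mem_points S skip
  rw [seq_skip] at hS
  exact (h.mem_points hS rfl).resolve_right hP

theorem IsTest.head?_eq {P : Schema Γ} {p l x} (h : IsTest P p l x) :
    P.head? = some (Sum.inr p, l) := by cases h <;> rfl

theorem head?_mem_occs {A J P : Schema Γ} (h : P ∈ A.points J) {y} (hy : P.head? = some y) :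
    y ∈ A.occs := by
  have : head? P ∈ (A.points J).map head? := List.mem_map_of_mem h
  rw [map_head?_points, hy] at this
  simpa using this

theorem exists_point_of_mem_occs {A : Schema Γ} {y} (hy : y ∈ A.occs) (J : Schema Γ) :
    ∃ P ∈ A.points J, P.head? = some y := by
  have : some y ∈ (A.points J).map head? := by
    rw [map_head?_points]
    exact List.mem_map_of_mem hy
  simpa using this

theorem label_unique {S : Schema Γ} (hS : S.PredicateLinear) {p l l'}
    (h : (Sum.inr p, l) ∈ S.occs) (h' : (Sum.inr p, l') ∈ S.occs) : l = l' := by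
  by_contra hne
  rw [PredicateLinear, List.Nodup, List.pairwise_filterMap] at hS
  have hsymm : Std.Symm (fun a a' : Γ.LSym => ∀ b, a.1.getRight? = some b →
      ∀ b', a'.1.getRight? = some b' → b ≠ b') :=
    ⟨fun a a' h b hb b' hb' => (h b' hb' b hb).symm⟩
  exact hS.forall h h' (by simpa using hne) p rfl p rfl rfl

/-- In a predicate-linear schema with distinct labels, a predicate symbol determines its control
point. -/
theorem test_unique {S P Q : Schema Γ} (hlab : S.DistinctLabels) (hS : S.PredicateLinear)
    {σ τ} (hP : Run S σ P) (hQ : Run S τ Q) {p l x l' x'} (h : IsTest P p l x)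
    (h' : IsTest Q p l' x') : P = Q := by
  have h1 := head?_mem_occs (hP.mem_points_skip h.ne_skip) h.head?_eq
  have h2 := head?_mem_occs (hQ.mem_points_skip h'.ne_skip) h'.head?_eq
  obtain rfl := label_unique hS h1 h2
  exact point_unique hlab hP hQ (by rw [h.head?_eq, h'.head?_eq])

theorem size_lt_of_mem_points {A J P : Schema Γ} (h : P ∈ A.points J) : J.size < P.size := by
  induction A generalizing J with
  | skip => simp [points] at h
  | assign y f l x R ih =>
    simp only [points, List.mem_cons] at h
    rcases h with rfl | h
    · simp [size_seq, size]
    · exact ih h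
  | ifte p l x T₁ T₂ R ih₁ ih₂ ih =>
    simp only [points, List.mem_cons, List.mem_append] at h
    rcases h with rfl | (h | h) | h
    · simp [size_seq, size]
    · have := ih₁ h; rw [size_seq] at this; omega
    · have := ih₂ h; rw [size_seq] at this; omega
    · exact ih h
  | loop p l x T R ihT ih =>
    simp only [points, List.mem_cons, List.mem_append] at h
    rcases h with rfl | h | h
    · simp [size_seq, size]
    · have := ihT h; rw [size_seq] at this; omega
    · exact ih h

theorem assigns_of_mem_points {A J : Schema Γ} {y f l x R} (h : assign y f l x R ∈ A.points J) :
    A.Assigns f l y := by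
  induction A generalizing J with
  | skip => simp [points] at h
  | assign y' f' l' x' R' ih =>
    simp only [points, List.mem_cons] at h
    rcases h with h | h
    · simp only [seq, assign.injEq] at h
      exact .inl ⟨h.2.1.symm, h.2.2.1.symm, h.1.symm⟩
    · exact .inr (ih h)
  | ifte p l x T₁ T₂ R ih₁ ih₂ ih =>
    simp only [points, List.mem_cons, List.mem_append] at h
    rcases h with h | (h | h) | h
    · simp [seq] at h
    · exact .inl (ih₁ h)
    · exact .inr (.inl (ih₂ h))
    · exact .inr (.inr (ih h))
  | loop p l x T R ihT ih =>
    simp only [points, List.mem_cons, List.mem_append] at h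
    rcases h with h | h | h
    · simp [seq] at h
    · exact .inl (ihT h)
    · exact .inr (ih h)

/-- The parts of an if-statement at a control point are under its control. -/
theorem controls_of_mem_points {A J : Schema Γ} {p l x T₁ T₂ R}
    (h : ifte p l x T₁ T₂ R ∈ A.points J) (y : Γ.LSym) :
    (y ∈ T₁.occs → A.Controls p l true y) ∧ (y ∈ T₂.occs → A.Controls p l false y) := by
  induction A generalizing J with
  | skip => simp [points] at h
  | assign y' f' l' x' R' ih =>
    simp only [points, List.mem_cons] at h
    rcases h with h | h
    · simp [seq] at h
    · exact ih h
  | ifte p' l' x' T₁' T₂' R' ih₁ ih₂ ih =>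
    simp only [points, List.mem_cons, List.mem_append] at h
    rcases h with h | (h | h) | h
    · simp only [seq, ifte.injEq] at h
      obtain ⟨rfl, rfl, -, rfl, rfl, -⟩ := h
      exact ⟨fun hy => .inl ⟨rfl, rfl, .inl ⟨rfl, hy⟩⟩, fun hy => .inl ⟨rfl, rfl, .inr ⟨rfl, hy⟩⟩⟩
    · exact (ih₁ h).imp (fun h hy => .inr (.inl (h hy))) (fun h hy => .inr (.inl (h hy)))
    · exact (ih₂ h).imp (fun h hy => .inr (.inr (.inl (h hy)))) (fun h hy => .inr (.inr (.inl (h hy))))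
    · exact (ih h).imp (fun h hy => .inr (.inr (.inr (h hy)))) (fun h hy => .inr (.inr (.inr (h hy))))
  | loop p l x T R ihT ih =>
    simp only [points, List.mem_cons, List.mem_append] at h
    rcases h with h | h | h
    · simp [seq] at h
    · exact (ihT h).imp (fun h hy => .inr (.inl (h hy))) (fun h hy => .inr (.inl (h hy)))
    · exact (ih h).imp (fun h hy => .inr (.inr (h hy))) (fun h hy => .inr (.inr (h hy)))

theorem disjoint_of_mem_points {A J : Schema Γ} (hA : A.occs.Nodup) {p l x T₁ T₂ R}
    (h : ifte p l x T₁ T₂ R ∈ A.points J) : T₁.occs.Disjoint T₂.occs := by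
  induction A generalizing J with
  | skip => simp [points] at h
  | assign y' f' l' x' R' ih =>
    simp only [points, List.mem_cons, occs, List.nodup_cons] at h hA
    rcases h with h | h
    · simp [seq] at h
    · exact ih hA.2 h
  | ifte p' l' x' T₁' T₂' R' ih₁ ih₂ ih =>
    simp only [points, List.mem_cons, List.mem_append, occs, List.nodup_cons,
      List.nodup_append'] at h hA
    obtain ⟨-, ⟨h1, h2, h12⟩, h3, -⟩ := hA
    rcases h with h | (h | h) | h
    · simp only [seq, ifte.injEq] at h
      obtain ⟨rfl, rfl, -, rfl, rfl, -⟩ := h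
      exact h12
    · exact ih₁ h1 h
    · exact ih₂ h2 h
    · exact ih h3 h
  | loop p l x T R ihT ih =>
    simp only [points, List.mem_cons, List.mem_append, occs, List.nodup_cons,
      List.nodup_append'] at h hA
    obtain ⟨-, h1, h2, -⟩ := hA
    rcases h with h | h | h
    · simp [seq] at h
    · exact ihT h1 h
    · exact ih h2 h

/-! ### Paths on which all tests are false -/

/-- `FalsePath P L Q`: if all tests are false, control passes from the point `P` through the points
in `L`, the first of which is `P`, to the point `Q`. -/
inductive FalsePath : Schema Γ → List (Schema Γ) → Schema Γ → Prop
  | nil (P) : FalsePath P [] P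
  | cons {P L Q} : P ≠ skip → FalsePath (next false P) L Q → FalsePath P (P :: L) Q

theorem FalsePath.append {P L Q L' R} (h : FalsePath (Γ := Γ) P L Q) (h' : FalsePath Q L' R) :
    FalsePath P (L ++ L') R := by
  induction h with
  | nil => exact h'
  | cons h0 _ ih => exact .cons h0 (ih h')

theorem FalsePath.size_le {P L Q} (h : FalsePath (Γ := Γ) P L Q) : Q.size ≤ P.size := by
  induction h with
  | nil => exact le_rfl
  | cons h0 _ ih => exact ih.trans (size_next_false h0).le

theorem FalsePath.unique {P L L' Q} (h : FalsePath (Γ := Γ) P L Q) (h' : FalsePath P L' Q) :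
    L = L' := by
  induction h generalizing L' with
  | nil P =>
    cases h' with
    | nil => rfl
    | cons h0 h1 => exact absurd h1.size_le (size_next_false h0).not_ge
  | cons h0 h1 ih =>
    cases h' with
    | nil => exact absurd h1.size_le (size_next_false h0).not_ge
    | cons _ h2 => rw [ih h2]

/-- Two all-false paths from the same point run along each other. -/
theorem FalsePath.mem_or {P L L' Q R} (h : FalsePath (Γ := Γ) P L Q) (h' : FalsePath P L' R) :
    R ∈ L ∨ ∃ L'', FalsePath Q L'' R := by
  induction h generalizing L' with
  | nil P => exact .inr ⟨_, h'⟩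
  | cons h0 h1 ih =>
    cases h' with
    | nil => exact .inl List.mem_cons_self
    | cons _ h2 => exact (ih h2).imp_left (List.mem_cons_of_mem _)

theorem FalsePath.split {P L Q R} (h : FalsePath (Γ := Γ) P L Q) (hR : R ∈ L) :
    ∃ L', FalsePath P L' R ∧ L' ⊆ L := by
  induction h with
  | nil P => simp at hR
  | cons h0 h1 ih =>
    rcases List.mem_cons.1 hR with rfl | hR
    · exact ⟨[], .nil _, by simp⟩
    · obtain ⟨L', h2, h3⟩ := ih hR
      exact ⟨_, .cons h0 h2, List.cons_subset_cons _ h3⟩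

/-- The all-false path through a block stays at control points of the block. -/
theorem exists_falsePath_block (A J : Schema Γ) :
    ∃ L, FalsePath (A.seq J) L J ∧ ∀ Q ∈ L, Q ∈ A.points J := by
  induction A generalizing J with
  | skip => exact ⟨[], .nil _, by simp⟩
  | assign y f l x R ih =>
    obtain ⟨L, h1, h2⟩ := ih J
    refine ⟨_, .cons (by simp [seq]) h1, ?_⟩
    simp only [List.mem_cons, points, forall_eq_or_imp, true_or, true_and]
    exact fun Q hQ => .inr (h2 Q hQ)
  | ifte p l x T₁ T₂ R _ ih₂ ih =>
    obtain ⟨L, h1, h2⟩ := ih J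
    obtain ⟨L', h3, h4⟩ := ih₂ (R.seq J)
    refine ⟨_, .cons (by simp [seq]) (h3.append h1), ?_⟩
    simp only [List.mem_cons, points, forall_eq_or_imp, true_or, true_and, List.mem_append]
    exact fun Q hQ => .inr (hQ.elim (fun h => .inl (.inr (h4 Q h))) fun h => .inr (h2 Q h))
  | loop p l x T R _ ih =>
    obtain ⟨L, h1, h2⟩ := ih J
    refine ⟨_, .cons (by simp [seq]) h1, ?_⟩
    simp only [List.mem_cons, points, forall_eq_or_imp, true_or, true_and, List.mem_append]
    exact fun Q hQ => .inr (.inr (h2 Q hQ))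

/-- The point at which the two outcomes of the test at the head of a schema come together.  For a
while-statement the all-false path after the outcome true runs through the body, back to the test,
and from there to this point.  The value is irrelevant if the first statement is not a test. -/
def join : Schema Γ → Schema Γ
  | ifte _ _ _ _ _ R => R
  | loop _ _ _ _ R => R
  | P => P

theorem exists_falsePath_join {K : Schema Γ} {p l x} (h : IsTest K p l x) (Z : Bool) :
    ∃ L, FalsePath (next Z K) L (join K) := by
  cases h with
  | ifte p l x T₁ T₂ R =>
    cases Z
    · exact (exists_falsePath_block T₂ R).imp fun _ h => h.1
    · exact (exists_falsePath_block T₁ R).imp fun _ h => h.1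
  | loop p l x T R =>
    cases Z
    · exact ⟨[], .nil _⟩
    · obtain ⟨L, h, -⟩ := exists_falsePath_block T (loop p l x T R)
      exact ⟨_, h.append (.cons (by simp) (.nil _))⟩

/-- An all-false path that starts with one outcome of a test does not meet the points that lie
between the other outcome and the join. -/
theorem not_falsePath_of_mem {S K : Schema Γ} (hlab : S.DistinctLabels) {σ} (hK : Run S σ K)
    {p l x} (ht : IsTest K p l x) {Z L Q} (hL : FalsePath (next Z K) L (join K)) (hQ : Q ∈ L)
    (hne : Q ≠ K) (L') : ¬ FalsePath (next (!Z) K) L' Q := by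
  intro hL'
  cases ht with
  | loop p l x T R =>
    cases Z
    · obtain rfl := hL.unique (.nil _)
      simp at hQ
    · -- the points in the body are larger than the point after the loop
      obtain ⟨L₁, h1, h2⟩ := exists_falsePath_block T (loop p l x T R)
      obtain rfl := hL.unique (h1.append (.cons (by simp) (.nil _)))
      simp only [List.mem_append, List.mem_singleton, hne, or_false] at hQ
      have h3 := size_lt_of_mem_points (h2 Q hQ)
      have h4 := hL'.size_le
      simp only [next, Bool.not_true] at h4
      simp only [size] at h3
      omega
  | ifte p l x T₁ T₂ R =>
    have key : ∀ A B : Schema Γ, A.occs.Disjoint B.occs → ∀ {L L'}, FalsePath (A.seq R) L R →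
        Q ∈ L → ¬ FalsePath (B.seq R) L' Q := by
      intro A B hAB L L' hL hQ hL'
      obtain ⟨L₁, h1, h2⟩ := exists_falsePath_block A R
      obtain ⟨L₂, h3, h4⟩ := exists_falsePath_block B R
      obtain rfl := hL.unique h1
      have hQA := h2 Q hQ
      rcases h3.mem_or hL' with h | ⟨L'', h⟩
      · have hQB := h4 Q h
        cases hh : Q.head? with
        | none =>
          have := ne_skip_of_mem_points hQA
          cases Q <;> simp_all [head?]
        | some y => exact hAB (head?_mem_occs hQA hh) (head?_mem_occs hQB hh)
      · exact absurd h.size_le (size_lt_of_mem_points hQA).not_ge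
    have hd := disjoint_of_mem_points hlab (hK.mem_points_skip (by simp))
    cases Z
    · exact key T₂ T₁ hd.symm hL hQ hL'
    · exact key T₁ T₂ hd hL hQ hL'

/-! ### Influence and its cost -/

/-- The variables assigned at the points in a list. -/
def assigned (L : List (Schema Γ)) : Set Γ.Var := {y | ∃ f l x R, assign y f l x R ∈ L}

/-- The variables whose values depend on values in `D` after an assignment to `y` that references
the vector `x`. -/
def taint {n : ℕ} (D : Set Γ.Var) (y : Γ.Var) (x : Fin n → Γ.Var) : Set Γ.Var :=
  {z | (z = y ∧ ∃ k, x k ∈ D) ∨ (z ≠ y ∧ z ∈ D)}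

/-- Syntactic influence on the final value of `v`, at the cost of `n` tests with outcome true.
`Influence v P (some D) n` says that the values of the variables in `D` at the point `P` may
influence the final value of `v`; `Influence v K none n` says the same of the outcome of the test
at the point `K`.

Differing values reach the end (`final`), are propagated by an assignment, are carried past a test
that answers alike in both executions (`pass_false`, `pass_true`), or are referenced by a test that
has itself an influence (`hit`).  Differing outcomes of the test `K` make differ the variables that
are assigned on the all-false paths to its join (`flow`), or they decide whether a test `Q` on such
a path is reached that has itself an influence (`zone`).  In `hit` and `zone` one test more is
counted, because `K` or `Q` has to be true in one of the two executions to be compared. -/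
inductive Influence (v : Γ.Var) : Schema Γ → Option (Set Γ.Var) → ℕ → Prop
  | final {D} : v ∈ D → Influence v skip (some D) 0
  | assign {y f l x R D n} : Influence v R (some (taint D y x)) n →
      Influence v (assign y f l x R) (some D) n
  | pass_false {P : Schema Γ} {p l x D n} : IsTest P p l x →
      Influence v (next false P) (some D) n → Influence v P (some D) n
  | pass_true {P : Schema Γ} {p l x D n} : IsTest P p l x →
      Influence v (next true P) (some D) n → Influence v P (some D) (n + 1)
  | hit {P : Schema Γ} {p l x D n} (k) : IsTest P p l x → x k ∈ D →
      Influence v P none n → Influence v P (some D) (n + 1)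
  | flow {K : Schema Γ} {p l x L₁ L₂ n} : IsTest K p l x → FalsePath (next true K) L₁ (join K) →
      FalsePath (next false K) L₂ (join K) →
      Influence v (join K) (some (assigned (L₁ ++ L₂))) n → Influence v K none n
  | zone {K : Schema Γ} {p l x Z L Q n} : IsTest K p l x → FalsePath (next Z K) L (join K) →
      Q ∈ L → Influence v Q none n → Influence v K none (n + 1)

theorem Influence.isTest {v : Γ.Var} {K : Schema Γ} {n} (h : Influence v K none n) :
    ∃ p l x, IsTest K p l x := by
  cases h with
  | flow h => exact ⟨_, _, _, h⟩
  | zone h => exact ⟨_, _, _, h⟩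

theorem FalsePath.exists_run {P : Schema Γ} {L Q} (h : FalsePath P L Q) : ∃ σ, Run P σ Q := by
  induction h with
  | nil => exact ⟨[], .nil _⟩
  | cons h0 _ ih =>
    obtain ⟨σ, h1⟩ := ih
    obtain ⟨a, h2, -⟩ := exists_step h0 false Term.var
    exact ⟨_, .cons h2 h1⟩

/-- Executing an all-false path: its queries have to be false, and they are not made again. -/
theorem FalsePath.exec {S : Schema Γ} (hS : S.Free) {v : Γ.Var} {P : Schema Γ} {L Q}
    (h : FalsePath P L Q) {d : State Γ} (hr : Reach S (P, d)) :
    ∃ σ, Run P σ Q ∧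
      (∀ y f l a, Letter.assign y f l a ∈ σ ↔ ∃ R, Schema.assign y f l a R ∈ L) ∧
      ∃ F : Finset (Query Γ), (∀ q ∈ F, Fresh q (Q, after d σ)) ∧
        (∀ q ∈ F, ∃ R ∈ L, ∃ l x, IsTest R q.1 l x) ∧
        ∀ e, Disjoint e F → out v e (P, d) = out v e (Q, after d σ) := by
  classical
  induction h generalizing d with
  | nil P => exact ⟨[], .nil _, by simp, ∅, by simp, by simp, fun e _ => rfl⟩
  | @cons P L Q h0 hL ih =>
    obtain ⟨σ, h1, h2, F, h3, h4, h5⟩ := ih (hr.adv false)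
    have hlead : Leads (next false P, upd P d) (Q, after (upd P d) σ) := ⟨σ, h1, rfl⟩
    have test : ∀ {p l x}, IsTest P p l x → ∃ σ, Run P σ Q ∧
        (∀ y f l a, Letter.assign y f l a ∈ σ ↔ ∃ R, Schema.assign y f l a R ∈ P :: L) ∧
        ∃ F : Finset (Query Γ), (∀ q ∈ F, Fresh q (Q, after d σ)) ∧
          (∀ q ∈ F, ∃ R ∈ P :: L, ∃ l x, IsTest R q.1 l x) ∧
          ∀ e, Disjoint e F → out v e (P, d) = out v e (Q, after d σ) := by
      intro p l x ht
      have hq := ht.query_eq d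
      have hfr : Fresh _ (next false P, upd P d) := hr.fresh hS hq false
      rw [ht.upd_eq] at h3 h5 hlead hfr
      refine ⟨_, .cons (.test ht false) h1, fun y f l a => ?_,
        insert ⟨p, fun k => d (x k)⟩ F, ?_, ?_, ?_⟩
      · rw [List.mem_cons, h2]
        cases ht <;> simp
      · intro q hq
        rcases Finset.mem_insert.1 hq with rfl | hq
        · exact hfr.leads hlead
        · exact h3 q hq
      · intro q hq
        rcases Finset.mem_insert.1 hq with rfl | hq
        · exact ⟨P, List.mem_cons_self, l, x, ht⟩
        · obtain ⟨R, hR, h⟩ := h4 q hq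
          exact ⟨R, List.mem_cons_of_mem _ hR, h⟩
      · intro e he
        rw [Finset.disjoint_insert_right] at he
        rw [out_adv_false (c := (P, d)) hq he.1]
        unfold adv
        rw [ht.upd_eq]
        exact h5 e he.2
    cases P with
    | skip => exact absurd rfl h0
    | assign y f l x R =>
      refine ⟨_, .cons (.assign y f l x R) h1, fun y' f' l' a' => ?_, F, h3,
        fun q hq => ?_, fun e he => ?_⟩
      · rw [List.mem_cons, h2]
        constructor
        · rintro (h | ⟨R', h⟩)
          · cases h; exact ⟨R, List.mem_cons_self⟩
          · exact ⟨R', List.mem_cons_of_mem _ h⟩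
        · rintro ⟨R', h⟩
          rcases List.mem_cons.1 h with h | h
          · cases h; exact .inl rfl
          · exact .inr ⟨R', h⟩
      · obtain ⟨R, hR, h⟩ := h4 q hq
        exact ⟨R, List.mem_cons_of_mem _ hR, h⟩
      · rw [out_adv_of_none rfl]
        exact h5 e he
    | ifte => exact test (.ifte _ _ _ _ _ _)
    | loop => exact test (.loop _ _ _ _ _)

/-- In a special schema, after the two outcomes of a test have come together again on all-false
paths, the states differ precisely in the variables assigned on these paths. -/
theorem setOf_after_ne_eq_assigned {S : Schema Γ} (hS : S.IsSpecial)
    {K : Schema Γ} {d : State Γ} (hr : Reach S (K, d)) {p l x} (ht : IsTest K p l x) {L₁ L₂ σ₁ σ₂}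
    (hL₁ : FalsePath (next true K) L₁ (join K)) (hL₂ : FalsePath (next false K) L₂ (join K))
    (hσ₁ : Run (next true K) σ₁ (join K)) (hσ₂ : Run (next false K) σ₂ (join K))
    (h₁ : ∀ y f l a, Letter.assign y f l a ∈ σ₁ ↔ ∃ R, Schema.assign y f l a R ∈ L₁)
    (h₂ : ∀ y f l a, Letter.assign y f l a ∈ σ₂ ↔ ∃ R, Schema.assign y f l a R ∈ L₂) :
    {z | after d σ₁ z ≠ after d σ₂ z} = assigned (L₁ ++ L₂) := by
  obtain ⟨hlin, hfree, hlib, hspec⟩ := hS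
  have hr₁ : Reach S (next true K, d) := by simpa [adv, ht.upd_eq] using hr.adv true
  have hr₂ : Reach S (next false K, d) := by simpa [adv, ht.upd_eq] using hr.adv false
  have target : ∀ {b : Letter Γ} {z}, b.target = some z → ∃ f l a, b = Letter.assign z f l a := by
    intro b z h
    cases b with
    | assign y f l a => simp only [Letter.target, Option.some.injEq] at h; exact ⟨f, l, a, h ▸ rfl⟩
    | test => simp [Letter.target] at h
  ext z
  have hmem : z ∈ assigned (L₁ ++ L₂) ↔
      (∃ f l a, Letter.assign z f l a ∈ σ₁) ∨ ∃ f l a, Letter.assign z f l a ∈ σ₂ := by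
    simp only [h₁, h₂, assigned, List.mem_append, Set.mem_ofPred_eq]
    constructor
    · rintro ⟨f, l, a, R, h | h⟩
      · exact .inl ⟨f, l, a, R, h⟩
      · exact .inr ⟨f, l, a, R, h⟩
    · rintro (⟨f, l, a, R, h⟩ | ⟨f, l, a, R, h⟩)
      · exact ⟨f, l, a, R, .inl h⟩
      · exact ⟨f, l, a, R, .inr h⟩
  rw [hmem, Set.mem_ofPred_eq]
  rcases last_assign σ₁ z with n₁ | ⟨μ, f, l', a, ν, e₁, n₁⟩ <;>
    rcases last_assign σ₂ z with n₂ | ⟨μ', g, m, b, ν', e₂, n₂⟩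
  · have c1 : ¬ ∃ f l a, Letter.assign z f l a ∈ σ₁ := fun ⟨f, l, a, h⟩ => n₁ _ h rfl
    have c2 : ¬ ∃ f l a, Letter.assign z f l a ∈ σ₂ := fun ⟨f, l, a, h⟩ => n₂ _ h rfl
    rw [after, after, Interp.run_of_forall_ne _ _ n₁, Interp.run_of_forall_ne _ _ n₂]
    simp [c1, c2]
  · have m2 : Letter.assign z g m b ∈ σ₂ := by rw [e₂]; simp
    have := hr₂.ne_of_assigned hfree hlib hσ₂ ⟨_, m2, rfl⟩ z
    rw [after, Interp.run_of_forall_ne _ _ n₁]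
    exact iff_of_true this.symm (.inr ⟨_, _, _, m2⟩)
  · have m1 : Letter.assign z f l' a ∈ σ₁ := by rw [e₁]; simp
    have := hr₁.ne_of_assigned hfree hlib hσ₁ ⟨_, m1, rfl⟩ z
    rw [after, after, Interp.run_of_forall_ne _ _ n₂]
    exact iff_of_true this (.inl ⟨_, _, _, m1⟩)
  · have m1 : Letter.assign z f l' a ∈ σ₁ := by rw [e₁]; simp
    have m2 : Letter.assign z g m b ∈ σ₂ := by rw [e₂]; simp
    refine iff_of_true (fun heq => ?_) (.inl ⟨_, _, _, m1⟩)
    rw [e₁, e₂, after, after, Interp.run_last _ _ _ _ _ _ n₁, Interp.run_last _ _ _ _ _ _ n₂] at heq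
    simp only [herb, Term.app.injEq] at heq
    obtain ⟨rfl, -⟩ := heq
    obtain ⟨R₁, m1⟩ := (h₁ _ _ _ _).1 m1
    obtain ⟨R₂, m2⟩ := (h₂ _ _ _ _).1 m2
    obtain ⟨τ, hτ, -⟩ := hr
    obtain ⟨τ₁, hτ₁, -⟩ := hr₁
    obtain ⟨τ₂, hτ₂, -⟩ := hr₂
    have reach : ∀ {P L Q R τ}, Run S τ P → FalsePath P L Q → R ∈ L → ∃ τ, Run S τ R := by
      intro P L Q R τ hτ hL hR
      obtain ⟨L', h, -⟩ := hL.split hR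
      obtain ⟨σ, h⟩ := h.exists_run
      exact ⟨_, hτ.append h⟩
    obtain ⟨τ₃, hτ₃⟩ := reach hτ₁ hL₁ m1
    obtain ⟨τ₄, hτ₄⟩ := reach hτ₂ hL₂ m2
    have a1 := assigns_of_mem_points (hτ₃.mem_points_skip (by simp))
    have a2 := assigns_of_mem_points (hτ₄.mem_points_skip (by simp))
    cases ht with
    | loop p l x T R =>
      obtain rfl := hL₂.unique (.nil _)
      simp at m2
    | ifte p l x T₁ T₂ R =>
      have hK := hτ.mem_points_skip (by simp)
      obtain ⟨L₁', f1, f2⟩ := exists_falsePath_block T₁ R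
      obtain ⟨L₂', f3, f4⟩ := exists_falsePath_block T₂ R
      -- the last assignments to `z` in the two parts have the same function symbol, which the
      -- last condition on special schemas excludes
      obtain rfl := hL₁.unique f1
      obtain rfl := hL₂.unique f3
      have o1 := head?_mem_occs (f2 _ m1) rfl
      have o2 := head?_mem_occs (f4 _ m2) rfl
      exact hspec p l f l' m z z ((controls_of_mem_points hK _).1 o1)
        ((controls_of_mem_points hK _).2 o2) a1 a2 rfl

/-! ### The cost of an influence bounds the number of true queries from below -/

open Classical in
/-- Suppose that a test matters in an execution with fewer than `k` true queries only if its
influence costs at most their number.  Then the answer to a query `q` does not matter in an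
execution with fewer true queries than the influence of the test of `q` costs: as long as the other
queries are false, the execution goes on to smaller points, and each true query that is met can be
spent, because it is not made again. -/
theorem out_insert_eq {S : Schema Γ} (hfree : S.Free) {v : Γ.Var} {k : ℕ}
    (hB : ∀ e : Finset (Query Γ), e.card < k → ∀ c p l x, Reach S c → IsTest c.1 p l x →
      out v e (adv true c) ≠ out v e (adv false c) → ∃ m ≤ e.card, Influence v c.1 none m)
    (q : Query Γ) (e : Finset (Query Γ)) (c : Cfg Γ) (he : e.card < k) (hc : Reach S c)
    (hq : ∀ c' l x, Reach S c' → IsTest c'.1 q.1 l x → ∀ m ≤ e.card, ¬ Influence v c'.1 none m) :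
    out v (insert q e) c = out v e c := by
  by_cases hqe : q ∈ e
  · rw [Finset.insert_eq_of_mem hqe]
  by_cases hskip : c.1 = skip
  · rw [out_skip hskip, out_skip hskip]
  have hsize := size_next_false hskip
  cases hquery : c.1.query c.2 with
  | none =>
    rw [out_adv_of_none hquery, out_adv_of_none hquery]
    exact out_insert_eq hfree hB q e (adv false c) he (hc.adv _) hq
  | some t =>
    have hfT := hc.fresh hfree hquery true
    by_cases htq : t = q
    · subst htq
      rw [out_adv_true hquery (Finset.mem_insert_self _ _), out_adv_false hquery hqe,
        hfT.out_insert]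
      by_contra hne
      obtain ⟨p, l, x, ht, rfl⟩ := exists_isTest_of_query hquery
      obtain ⟨m, hm, h⟩ := hB e he c p l x hc ht hne
      exact hq c l x hc ht m hm h
    by_cases hte : t ∈ e
    · have hcard := Finset.card_erase_lt_of_mem hte
      rw [out_adv_true hquery (Finset.mem_insert_of_mem hte), out_adv_true hquery hte,
        ← hfT.out_erase, ← hfT.out_erase (e := e), Finset.erase_insert_of_ne (Ne.symm htq)]
      exact out_insert_eq hfree hB q (e.erase t) (adv true c) (hcard.trans he) (hc.adv _)
        fun c' l x h1 h2 m hm => hq c' l x h1 h2 m (hm.trans hcard.le)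
    · rw [out_adv_false hquery (by simp [htq, hte]), out_adv_false hquery hte]
      exact out_insert_eq hfree hB q e (adv false c) he (hc.adv _) hq
termination_by (e.card, c.1.size)
decreasing_by
  · exact Prod.Lex.right _ hsize
  · exact Prod.Lex.left _ _ hcard
  · exact Prod.Lex.right _ hsize

open Classical in
/-- True queries whose tests have no influence of a cost less than the number of true queries can be
made false. -/
theorem out_sdiff_eq {S : Schema Γ} (hfree : S.Free) {v : Γ.Var} {k : ℕ}
    (hB : ∀ e : Finset (Query Γ), e.card < k → ∀ c p l x, Reach S c → IsTest c.1 p l x →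
      out v e (adv true c) ≠ out v e (adv false c) → ∃ m ≤ e.card, Influence v c.1 none m)
    {e : Finset (Query Γ)} (he : e.card ≤ k) (F : Finset (Query Γ))
    (hF : ∀ q ∈ F, ∀ c' l x, Reach S c' → IsTest c'.1 q.1 l x →
      ∀ m < e.card, ¬ Influence v c'.1 none m) {c : Cfg Γ} (hc : Reach S c) :
    out v (e \ F) c = out v e c := by
  induction F using Finset.induction_on with
  | empty => simp
  | insert q F _ ih =>
    have ih := ih fun q' hq' => hF q' (Finset.mem_insert_of_mem hq')
    rw [← ih, Finset.sdiff_insert]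
    by_cases hq : q ∈ e \ F
    · have h1 := Finset.card_erase_lt_of_mem hq
      have h2 := Finset.card_le_card (Finset.sdiff_subset (s := e) (t := F))
      conv_rhs => rw [← Finset.insert_erase hq]
      exact (out_insert_eq hfree hB q _ c (by omega) hc fun c' l x h3 h4 m hm =>
        hF q (Finset.mem_insert_self _ _) c' l x h3 h4 m (by omega)).symm
    · rw [Finset.erase_eq_of_notMem hq]

/-- An assignment propagates differences between states precisely as `taint` says, because function
symbols act as term constructors. -/
theorem setOf_upd_ne {y f l x} {R : Schema Γ} (d d' : State Γ) :
    {z | (assign y f l x R).upd d z ≠ (assign y f l x R).upd d' z} =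
      taint {z | d z ≠ d' z} y x := by
  ext z
  by_cases hz : z = y
  · subst hz
    simp [upd, taint, funext_iff]
  · simp [upd, taint, hz]

open Classical in
/-- If two executions from the same point have different outcomes, then the variables in which
their states differ have an influence of cost at most the number of true queries. -/
theorem exists_influence_of_out_ne_of_same_point {S : Schema Γ} (hlab : S.DistinctLabels)
    (hlin : S.PredicateLinear) (hfree : S.Free) {v : Γ.Var} {k : ℕ}
    (hB : ∀ e : Finset (Query Γ), e.card < k → ∀ c p l x, Reach S c → IsTest c.1 p l x →
      out v e (adv true c) ≠ out v e (adv false c) → ∃ m ≤ e.card, Influence v c.1 none m)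
    (e : Finset (Query Γ)) (P : Schema Γ) (d d' : State Γ) (he : e.card ≤ k)
    (hc : Reach S (P, d)) (hc' : Reach S (P, d')) (hne : out v e (P, d) ≠ out v e (P, d')) :
    ∃ m ≤ e.card, Influence v P (some {z | d z ≠ d' z}) m := by
  by_cases hskip : P = skip
  · subst hskip
    rw [out_skip rfl, out_skip rfl] at hne
    exact ⟨0, Nat.zero_le _, .final hne⟩
  have hsize := size_next_false hskip
  have hT := hc.adv true
  have hF := hc.adv false
  have hT' := hc'.adv true
  have hF' := hc'.adv false
  by_cases htest : ∃ p l x, IsTest P p l x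
  · obtain ⟨p, l, x, ht⟩ := htest
    have hq := ht.query_eq d
    have hq' := ht.query_eq d'
    have fT := hc.fresh hfree hq true
    have fT' := hc'.fresh hfree hq' true
    have eT : adv true (P, d) = (next true P, d) := by simp [adv, ht.upd_eq]
    have eF : adv false (P, d) = (next false P, d) := by simp [adv, ht.upd_eq]
    have eT' : adv true (P, d') = (next true P, d') := by simp [adv, ht.upd_eq]
    have eF' : adv false (P, d') = (next false P, d') := by simp [adv, ht.upd_eq]
    by_cases hab : ∀ k, d (x k) = d' (x k)
    · have hqq : (⟨p, fun k => d' (x k)⟩ : Query Γ) = ⟨p, fun k => d (x k)⟩ := by simp [hab]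
      rw [hqq] at hq' fT'
      by_cases hqe : (⟨p, fun k => d (x k)⟩ : Query Γ) ∈ e
      · have hcard := Finset.card_erase_lt_of_mem hqe
        rw [out_adv_true (c := (P, d)) hq hqe, out_adv_true (c := (P, d')) hq' hqe,
          ← fT.out_erase, ← fT'.out_erase, eT, eT'] at hne
        obtain ⟨m, hm, h⟩ := exists_influence_of_out_ne_of_same_point hlab hlin hfree hB
          (e.erase ⟨p, fun k => d (x k)⟩) (next true P) d d' (hcard.le.trans he) (eT ▸ hT)
          (eT' ▸ hT') hne
        exact ⟨m + 1, by omega, .pass_true ht h⟩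
      · rw [out_adv_false (c := (P, d)) hq hqe, out_adv_false (c := (P, d')) hq' hqe,
          eF, eF'] at hne
        obtain ⟨m, hm, h⟩ := exists_influence_of_out_ne_of_same_point hlab hlin hfree hB
          e (next false P) d d' he (eF ▸ hF) (eF' ▸ hF') hne
        exact ⟨m, hm, .pass_false ht h⟩
    · push Not at hab
      obtain ⟨k₀, hk⟩ := hab
      by_cases hhit : ∃ m < e.card, Influence v P none m
      · obtain ⟨m, hm, h⟩ := hhit
        exact ⟨m + 1, hm, .hit k₀ ht hk h⟩
      · push Not at hhit
        have hrem : ∀ q : Query Γ, q.1 = p → ∀ c' l x, Reach S c' → IsTest c'.1 q.1 l x →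
            ∀ m < e.card, ¬ Influence v c'.1 none m := by
          rintro q rfl c' l' x' ⟨σ, h1, -⟩ h2
          obtain ⟨τ, h3, -⟩ := hc
          rw [test_unique hlab hlin h1 h3 h2 ht]
          exact hhit
        have hboth : ∀ q ∈ ({⟨p, fun k => d (x k)⟩, ⟨p, fun k => d' (x k)⟩} : Finset (Query Γ)),
            q.1 = p := by simp
        -- the two executions make different queries at `P`, neither of which matters
        set F : Finset (Query Γ) := {⟨p, fun k => d (x k)⟩, ⟨p, fun k => d' (x k)⟩} with hFdef
        by_cases hdis : Disjoint e F
        · rw [hFdef, Finset.disjoint_insert_right, Finset.disjoint_singleton_right] at hdis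
          rw [out_adv_false (c := (P, d)) hq hdis.1, out_adv_false (c := (P, d')) hq' hdis.2,
            eF, eF'] at hne
          obtain ⟨m, hm, h⟩ := exists_influence_of_out_ne_of_same_point hlab hlin hfree hB
            e (next false P) d d' he (eF ▸ hF) (eF' ▸ hF') hne
          exact ⟨m, hm, .pass_false ht h⟩
        · have hcard : (e \ F).card < e.card := by
            obtain ⟨q, hq1, hq2⟩ := Finset.not_disjoint_iff.1 hdis
            exact Finset.card_lt_card ⟨Finset.sdiff_subset, fun h =>
              (Finset.mem_sdiff.1 (h hq1)).2 hq2⟩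
          rw [← out_sdiff_eq hfree hB he F (fun q hq => hrem q (hboth q hq)) hc,
            ← out_sdiff_eq hfree hB he F (fun q hq => hrem q (hboth q hq)) hc'] at hne
          obtain ⟨m, hm, h⟩ := exists_influence_of_out_ne_of_same_point hlab hlin hfree hB
            (e \ F) P d d' (hcard.le.trans he) hc hc' hne
          exact ⟨m, hm.trans hcard.le, h⟩
  · obtain ⟨y, f, l, x, R, hP⟩ : ∃ y f l x R, P = assign y f l x R := by
      cases P with
      | skip => exact absurd rfl hskip
      | ifte => exact absurd ⟨_, _, _, .ifte _ _ _ _ _ _⟩ htest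
      | loop => exact absurd ⟨_, _, _, .loop _ _ _ _ _⟩ htest
      | assign y f l x R => exact ⟨y, f, l, x, R, rfl⟩
    have hR : R.size < P.size := by rw [hP]; simp [size]
    rw [hP] at hne hF hF'
    rw [out_adv_of_none rfl, out_adv_of_none (c := (assign y f l x R, d')) rfl] at hne
    obtain ⟨m, hm, h⟩ := exists_influence_of_out_ne_of_same_point hlab hlin hfree hB
      e R ((assign y f l x R).upd d) ((assign y f l x R).upd d') he hF hF' hne
    rw [setOf_upd_ne] at h
    exact ⟨m, hm, hP ▸ .assign h⟩
termination_by (e.card, P.size)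
decreasing_by
  · exact Prod.Lex.left _ _ hcard
  · exact Prod.Lex.right _ hsize
  · exact Prod.Lex.right _ hsize
  · exact Prod.Lex.left _ _ hcard
  · exact Prod.Lex.right _ hR

open Classical in
/-- If the outcome of a test matters for the final value of `v` in an execution with true queries
`e`, then it has an influence of cost at most the number of queries in `e`. -/
theorem exists_influence_of_out_ne {S : Schema Γ} (hlab : S.DistinctLabels) (hS : S.IsSpecial)
    {v : Γ.Var} (k : ℕ) :
    ∀ e : Finset (Query Γ), e.card < k → ∀ c p l x, Reach S c → IsTest c.1 p l x →
      out v e (adv true c) ≠ out v e (adv false c) → ∃ m ≤ e.card, Influence v c.1 none m := by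
  induction k with
  | zero => intro e he; omega
  | succ k hB =>
    rintro e he ⟨K, d⟩ p l x hc ht hne
    have hfree := hS.2.1
    replace he : e.card ≤ k := by omega
    by_contra hno
    push Not at hno
    obtain ⟨L₁, hL₁⟩ := exists_falsePath_join ht true
    obtain ⟨L₂, hL₂⟩ := exists_falsePath_join ht false
    have hT := hc.adv true
    have hF := hc.adv false
    have eT : adv true (K, d) = (next true K, d) := by simp [adv, ht.upd_eq]
    have eF : adv false (K, d) = (next false K, d) := by simp [adv, ht.upd_eq]
    rw [eT] at hT hne
    rw [eF] at hF hne
    obtain ⟨σ₁, h1, h2, F₁, -, h3, h4⟩ := hL₁.exec hfree (v := v) hT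
    obtain ⟨σ₂, h5, h6, F₂, -, h7, h8⟩ := hL₂.exec hfree (v := v) hF
    -- tests between `K` and its join have no cheap influence, so that their queries can be made
    -- false; then both executions reach the join on all-false paths
    have hrem : ∀ q ∈ F₁ ∪ F₂, ∀ c' l x, Reach S c' → IsTest c'.1 q.1 l x →
        ∀ m < e.card, ¬ Influence v c'.1 none m := by
      have key : ∀ {Z L}, FalsePath (next Z K) L (join K) → Reach S (next Z K, d) → ∀ {q : Query Γ},
          (∃ R ∈ L, ∃ l x, IsTest R q.1 l x) → ∀ c' l x, Reach S c' → IsTest c'.1 q.1 l x →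
          ∀ m < e.card, ¬ Influence v c'.1 none m := by
        rintro Z L hL hr q ⟨R, hR, l', x', h⟩ c' l'' x'' hc' h' m hm hinf
        obtain ⟨L', hL', -⟩ := hL.split hR
        obtain ⟨τ, hτ⟩ := hL'.exists_run
        obtain ⟨ρ, hρ, -⟩ := hr
        obtain ⟨ρ', hρ', -⟩ := hc'
        rw [test_unique hlab hS.1 hρ' (hρ.append hτ) h' h] at hinf
        exact hno (m + 1) hm (.zone ht hL hR hinf)
      intro q hq
      rcases Finset.mem_union.1 hq with hq | hq
      · exact key hL₁ hT (h3 q hq)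
      · exact key hL₂ hF (h7 q hq)
    rw [← out_sdiff_eq hfree hB he _ hrem hT, ← out_sdiff_eq hfree hB he _ hrem hF,
      h4 _ (Finset.disjoint_of_subset_right Finset.subset_union_left Finset.sdiff_disjoint),
      h8 _ (Finset.disjoint_of_subset_right Finset.subset_union_right Finset.sdiff_disjoint)] at hne
    have hcard := Finset.card_le_card (Finset.sdiff_subset (s := e) (t := F₁ ∪ F₂))
    obtain ⟨m, hm, h⟩ := exists_influence_of_out_ne_of_same_point hlab hS.1 hfree hB _ (join K)
      (after d σ₁) (after d σ₂) (hcard.trans he) (hT.leads ⟨σ₁, h1, rfl⟩) (hF.leads ⟨σ₂, h5, rfl⟩) hne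
    rw [setOf_after_ne_eq_assigned hS hc ht hL₁ hL₂ h1 h5 h2 h6] at h
    exact hno m (hm.trans hcard) (.flow ht hL₁ hL₂ h)

/-! ### Every syntactic influence of least cost is realised by an execution -/

theorem IsTest.adv_eq {P : Schema Γ} {p l x} (h : IsTest P p l x) (Z : Bool) (d : State Γ) :
    adv Z (P, d) = (next Z P, d) := by
  simp [adv, h.upd_eq]

open Classical in
/-- A query whose test is not on the all-false path from the current point can only be made after
another test has been true; then too few true queries are left for it to matter. -/
theorem out_insert_eq_of_not_falsePath {S : Schema Γ} (hlab : S.DistinctLabels) (hS : S.IsSpecial)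
    {v : Γ.Var} {m : ℕ} (q : Query Γ) (e : Finset (Query Γ)) (c : Cfg Γ) (he : e.card ≤ m)
    (hc : Reach S c)
    (hinf : ∀ c' l x, Reach S c' → IsTest c'.1 q.1 l x → ∀ m' < m, ¬ Influence v c'.1 none m')
    (hno : ∀ L P l x, FalsePath c.1 L P → ¬ IsTest P q.1 l x) :
    out v (insert q e) c = out v e c := by
  by_cases hskip : c.1 = skip
  · rw [out_skip hskip, out_skip hskip]
  have hsize := size_next_false hskip
  have hno' : ∀ L P l x, FalsePath (adv false c).1 L P → ¬ IsTest P q.1 l x :=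
    fun L P l x h => hno _ P l x (.cons hskip h)
  cases hquery : c.1.query c.2 with
  | none =>
    rw [out_adv_of_none hquery, out_adv_of_none hquery]
    exact out_insert_eq_of_not_falsePath hlab hS q e (adv false c) he (hc.adv _) hinf hno'
  | some t =>
    have hfT := hc.fresh hS.2.1 hquery true
    have htq : t ≠ q := by
      rintro rfl
      obtain ⟨p, l, x, ht, rfl⟩ := exists_isTest_of_query hquery
      exact hno _ _ l x (.nil _) ht
    by_cases hte : t ∈ e
    · have hcard := Finset.card_erase_lt_of_mem hte
      rw [out_adv_true hquery (Finset.mem_insert_of_mem hte), out_adv_true hquery hte,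
        ← hfT.out_erase, ← hfT.out_erase (e := e), Finset.erase_insert_of_ne (Ne.symm htq)]
      exact out_insert_eq hS.2.1 (exists_influence_of_out_ne hlab hS m) q _ _ (by omega) (hc.adv _)
        fun c' l x h1 h2 m' hm => hinf c' l x h1 h2 m' (by omega)
    · rw [out_adv_false hquery (by simp [htq, hte]), out_adv_false hquery hte]
      exact out_insert_eq_of_not_falsePath hlab hS q e (adv false c) he (hc.adv _) hinf hno'
termination_by c.1.size
decreasing_by
  · exact hsize
  · exact hsize

open Classical in
/-- If `n` is the least cost of an influence of the variables in which two states at the same point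
differ, then the executions from these states are told apart by at most `n` true queries, provided
that less costly influences of tests are realised at every configuration. -/
theorem exists_out_ne_of_influence_of_same_point {S : Schema Γ} (hlab : S.DistinctLabels)
    (hS : S.IsSpecial) {v : Γ.Var} (n : ℕ)
    (hA : ∀ m < n, ∀ K, Influence v K none m → (∀ m' < m, ¬ Influence v K none m') →
      ∀ d, Reach S (K, d) → ∃ e : Finset (Query Γ), e.card ≤ m ∧
        out v e (next true K, d) ≠ out v e (next false K, d))
    (P : Schema Γ) (D : Set Γ.Var) (d d' : State Γ) (hD : D = {z | d z ≠ d' z})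
    (hc : Reach S (P, d)) (hc' : Reach S (P, d')) (hi : Influence v P (some D) n)
    (hmin : ∀ m < n, ¬ Influence v P (some D) m) :
    ∃ e : Finset (Query Γ), e.card ≤ n ∧ out v e (P, d) ≠ out v e (P, d') := by
  by_cases hskip : P = skip
  · subst hskip
    cases hi with
    | final h =>
      refine ⟨∅, by simp, ?_⟩
      rw [out_skip rfl, out_skip rfl]
      rw [hD] at h
      exact h
    | pass_false h => exact absurd rfl h.ne_skip
    | pass_true h => exact absurd rfl h.ne_skip
    | hit _ h => exact absurd rfl h.ne_skip
  have hsize := size_next_false hskip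
  by_cases htest : ∃ p l x, IsTest P p l x
  · obtain ⟨p, l, x, ht⟩ := htest
    have hq := ht.query_eq d
    have hq' := ht.query_eq d'
    have hF := hc.adv false
    have hF' := hc'.adv false
    have hT := hc.adv true
    have hT' := hc'.adv true
    have fT := hc.fresh hS.2.1 hq true
    have fT' := hc'.fresh hS.2.1 hq' true
    have fF := hc.fresh hS.2.1 hq false
    have fF' := hc'.fresh hS.2.1 hq' false
    rw [ht.adv_eq] at hF hF' hT hT' fT fT' fF fF'
    have oT : ∀ {e}, _ ∈ e → out v e (P, d) = out v e (next true P, d) := fun h => by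
      rw [out_adv_true (c := (P, d)) hq h, ht.adv_eq]
    have oT' : ∀ {e}, _ ∈ e → out v e (P, d') = out v e (next true P, d') := fun h => by
      rw [out_adv_true (c := (P, d')) hq' h, ht.adv_eq]
    have oF : ∀ {e}, _ ∉ e → out v e (P, d) = out v e (next false P, d) := fun h => by
      rw [out_adv_false (c := (P, d)) hq h, ht.adv_eq]
    have oF' : ∀ {e}, _ ∉ e → out v e (P, d') = out v e (next false P, d') := fun h => by
      rw [out_adv_false (c := (P, d')) hq' h, ht.adv_eq]
    have recF : Influence v (next false P) (some D) n → ∃ e : Finset (Query Γ), e.card ≤ n ∧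
        out v e (next false P, d) ≠ out v e (next false P, d') := fun h =>
      exists_out_ne_of_influence_of_same_point hlab hS n hA (next false P) D d d' hD hF hF' h
        fun m hm h => hmin m hm (.pass_false ht h)
    have recT : ∀ m < n, Influence v (next true P) (some D) m → m + 1 = n →
        ∃ e : Finset (Query Γ), e.card ≤ m ∧
        out v e (next true P, d) ≠ out v e (next true P, d') := fun m hm h hmn =>
      exists_out_ne_of_influence_of_same_point hlab hS m (fun m' hm' => hA m' (hm'.trans hm))
        (next true P) D d d' hD hT hT' h
        fun m' hm' h => hmin (m' + 1) (by omega) (.pass_true ht h)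
    have cases_hi : (Influence v (next false P) (some D) n) ∨
        (∃ m < n, Influence v (next true P) (some D) m ∧ m + 1 = n) ∨
        (∃ m < n, Influence v P none m ∧ ∃ k, x k ∈ D) := by
      cases hi with
      | final => exact absurd rfl hskip
      | assign => cases ht
      | pass_false _ h => exact .inl h
      | @pass_true _ _ _ _ _ m _ h => exact .inr (.inl ⟨m, by omega, h, rfl⟩)
      | @hit _ _ _ _ _ m k ht' hk h =>
        have : ∃ k, x k ∈ D := by
          cases ht <;> cases ht' <;> exact ⟨k, hk⟩
        exact .inr (.inr ⟨m, by omega, h, this⟩)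
    by_cases hab : ∀ k, x k ∉ D
    · have hqq : (⟨p, fun k => d' (x k)⟩ : Query Γ) = ⟨p, fun k => d (x k)⟩ := by
        congr 1
        funext k
        have := hab k
        rw [hD, Set.mem_ofPred_eq, not_not] at this
        exact this.symm
      rw [hqq] at oT' oF' fT' fF'
      rcases cases_hi with h | ⟨m, hm, h, hmn⟩ | ⟨m, hm, h, k, hk⟩
      · obtain ⟨e, he, hne⟩ := recF h
        refine ⟨e.erase ⟨p, fun k => d (x k)⟩, (Finset.card_erase_le).trans he, ?_⟩
        rw [oF (Finset.notMem_erase _ _), oF' (Finset.notMem_erase _ _), fF.out_erase,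
          fF'.out_erase]
        exact hne
      · obtain ⟨e, he, hne⟩ := recT m hm h hmn
        refine ⟨insert ⟨p, fun k => d (x k)⟩ e, (Finset.card_insert_le _ _).trans (by omega), ?_⟩
        rw [oT (Finset.mem_insert_self _ _), oT' (Finset.mem_insert_self _ _), fT.out_insert,
          fT'.out_insert]
        exact hne
      · exact absurd hk (hab k)
    · push Not at hab
      obtain ⟨k₀, hk⟩ := hab
      set qa : Query Γ := ⟨p, fun k => d (x k)⟩ with hqa
      set qb : Query Γ := ⟨p, fun k => d' (x k)⟩ with hqb
      have hqq : qa ≠ qb := by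
        intro h
        simp only [hqa, hqb, Sigma.mk.injEq, heq_eq_eq, true_and] at h
        rw [hD] at hk
        exact hk (congrFun h k₀)
      have huniq : ∀ c' l x, Reach S c' → IsTest c'.1 p l x → c'.1 = P := by
        rintro c' l' x' ⟨σ, h1, -⟩ h2
        obtain ⟨τ, h3, -⟩ := hc
        exact test_unique hlab hS.1 h1 h3 h2 ht
      by_cases hhit : ∃ m < n, Influence v P none m
      · obtain ⟨m, hm, h⟩ := hhit
        have hno : ∀ m' < m, ¬ Influence v P none m' := fun m' hm' h' =>
          hmin (m' + 1) (by omega) (.hit k₀ ht hk h')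
        obtain ⟨e, he, hne⟩ := hA m hm P h hno d hc
        have hrem : ∀ c' l x, Reach S c' → IsTest c'.1 qa.1 l x → ∀ m' < m,
            ¬ Influence v c'.1 none m' := by
          intro c' l x h1 h2
          rw [huniq c' l x h1 h2]
          exact hno
        have hcard : (e.erase qa).card ≤ m := Finset.card_erase_le.trans he
        have e1 : out v (e.erase qa) (P, d) = out v e (next false P, d) := by
          rw [oF (Finset.notMem_erase _ _), fF.out_erase]
        have e2 : out v (insert qa (e.erase qa)) (P, d) = out v e (next true P, d) := by
          rw [oT (Finset.mem_insert_self _ _), fT.out_insert, fT.out_erase]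
        -- making `qa` true changes the outcome from `d`, but not from `d'`, where `qb` is asked
        -- instead; so the outcomes differ either before or after the change
        have e3 : out v (insert qa (e.erase qa)) (P, d') = out v (e.erase qa) (P, d') := by
          by_cases hb : qb ∈ e.erase qa
          · have hc1 := Finset.card_erase_lt_of_mem hb
            rw [oT' (Finset.mem_insert_of_mem hb), oT' hb, ← fT'.out_erase,
              ← fT'.out_erase (e := e.erase qa), Finset.erase_insert_of_ne hqq]
            exact out_insert_eq hS.2.1 (exists_influence_of_out_ne hlab hS m) _ _ _ (by omega) hT'
              fun c' l x h1 h2 m' hm' => hrem c' l x h1 h2 m' (by omega)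
          · rw [oF' (by simp only [Finset.mem_insert, hb, or_false]; exact hqq.symm), oF' hb]
            refine out_insert_eq_of_not_falsePath hlab hS _ _ _ hcard hF' hrem ?_
            intro L P' l' x' hL ht'
            obtain ⟨σ, hσ⟩ := hL.exists_run
            obtain ⟨τ, hτ, -⟩ := hF'
            obtain ⟨ρ, hρ, -⟩ := hc
            have := hL.size_le
            rw [test_unique hlab hS.1 (hτ.append hσ) hρ ht' ht] at this
            exact absurd hsize this.not_gt
        by_cases h0 : out v (e.erase qa) (P, d) = out v (e.erase qa) (P, d')
        · refine ⟨insert qa (e.erase qa), (Finset.card_insert_le _ _).trans (by omega), ?_⟩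
          rw [e3, ← h0, e1, e2]
          exact hne
        · exact ⟨_, by omega, h0⟩
      · push Not at hhit
        have hrem : ∀ q ∈ ({qa, qb} : Finset (Query Γ)), ∀ c' l x, Reach S c' →
            IsTest c'.1 q.1 l x → ∀ m' < n, ¬ Influence v c'.1 none m' := by
          intro q hq c' l x h1 h2
          have hqp : q.1 = p := by
            simp only [Finset.mem_insert, Finset.mem_singleton] at hq
            rcases hq with rfl | rfl <;> rfl
          rw [huniq c' l (hqp ▸ x) h1 (by subst hqp; exact h2)]
          exact hhit
        have hB := exists_influence_of_out_ne (v := v) hlab hS n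
        have sd : ∀ {e c}, e.card ≤ n → Reach S c → out v (e \ {qa, qb}) c = out v e c :=
          fun {e c} he h => out_sdiff_eq hS.2.1 hB he _
            (fun q hq c' l x h1 h2 m hm => hrem q hq c' l x h1 h2 m (by omega)) h
        have cs : ∀ e : Finset (Query Γ), (e \ {qa, qb}).card ≤ e.card := fun e =>
          Finset.card_le_card Finset.sdiff_subset
        have na : ∀ e : Finset (Query Γ), qa ∉ e \ {qa, qb} := by simp
        have nb : ∀ e : Finset (Query Γ), qb ∉ e \ {qa, qb} := by simp
        rcases cases_hi with h | ⟨m, hm, h, hmn⟩ | ⟨m, hm, h, -⟩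
        · obtain ⟨e, he, hne⟩ := recF h
          refine ⟨e \ {qa, qb}, (cs e).trans he, ?_⟩
          rw [oF (na e), oF' (nb e), sd he hF, sd he hF']
          exact hne
        · obtain ⟨e, he, hne⟩ := recT m hm h hmn
          have hlt : e.card < n := by omega
          -- the outcome of the test at `P` is irrelevant for so few true queries
          have irr : ∀ {d₀}, Reach S (P, d₀) →
              out v e (next true P, d₀) = out v e (next false P, d₀) := by
            intro d₀ h₀
            by_contra hne
            rw [← ht.adv_eq, ← ht.adv_eq] at hne
            obtain ⟨m', hm', h'⟩ := hB e hlt _ p l x h₀ ht hne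
            exact hhit m' (by omega) h'
          refine ⟨e \ {qa, qb}, (cs e).trans hlt.le, ?_⟩
          rw [oF (na e), oF' (nb e), sd hlt.le hF, sd hlt.le hF', ← irr hc, ← irr hc']
          exact hne
        · exact absurd h (hhit m hm)
  · obtain ⟨y, f, l, x, R, hP⟩ : ∃ y f l x R, P = assign y f l x R := by
      cases P with
      | skip => exact absurd rfl hskip
      | ifte => exact absurd ⟨_, _, _, .ifte _ _ _ _ _ _⟩ htest
      | loop => exact absurd ⟨_, _, _, .loop _ _ _ _ _⟩ htest
      | assign y f l x R => exact ⟨y, f, l, x, R, rfl⟩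
    have hR : R.size < P.size := by rw [hP]; simp [size]
    have hF := hc.adv false
    have hF' := hc'.adv false
    rw [hP] at hi hmin hF hF' ⊢
    have hi' : Influence v R (some (taint D y x)) n := by
      cases hi with
      | assign h => exact h
      | pass_false h => cases h
      | pass_true h => cases h
      | hit _ h => cases h
    obtain ⟨e, he, hne⟩ := exists_out_ne_of_influence_of_same_point hlab hS n hA R
      (taint D y x) ((assign y f l x R).upd d) ((assign y f l x R).upd d')
      (by rw [setOf_upd_ne, hD]) hF hF' hi' fun m hm h => hmin m hm (.assign h)
    refine ⟨e, he, ?_⟩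
    rw [out_adv_of_none rfl, out_adv_of_none (c := (assign y f l x R, d')) rfl]
    exact hne
termination_by (n, P.size)
decreasing_by
  · exact Prod.Lex.right _ hsize
  · exact Prod.Lex.left _ _ hm
  · exact Prod.Lex.right _ hR

open Classical in
/-- If `k` is the least cost of an influence of a test, then at every configuration at which the
test is made there is an execution with at most `k` true queries in which its outcome matters. -/
theorem exists_out_ne_of_influence {S : Schema Γ} (hlab : S.DistinctLabels) (hS : S.IsSpecial)
    {v : Γ.Var} (k : ℕ) : ∀ K, Influence v K none k → (∀ m < k, ¬ Influence v K none m) →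
      ∀ d, Reach S (K, d) → ∃ e : Finset (Query Γ), e.card ≤ k ∧
        out v e (next true K, d) ≠ out v e (next false K, d) := by
  induction k using Nat.strong_induction_on with
  | _ k hA =>
  intro K hi hmin d hc
  have hfree := hS.2.1
  have hreach : ∀ Z, ∀ {p l x}, IsTest K p l x → Reach S (next Z K, d) := fun Z p l x ht => by
    rw [← ht.adv_eq]; exact hc.adv Z
  obtain ⟨p, l, x, ht⟩ := hi.isTest
  by_cases hz : ∃ Z L Q m, m < k ∧ FalsePath (next Z K) L (join K) ∧ Q ∈ L ∧ Influence v Q none m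
  · obtain ⟨Z, L, Q, m, hm, hL, hQ, h⟩ := hz
    have hQK : Q ≠ K := by
      rintro rfl
      exact hmin m (by omega) h
    have hmin' : ∀ m' < m, ¬ Influence v Q none m' := fun m' hm' h' =>
      hmin (m' + 1) (by omega) (.zone ht hL hQ h')
    have hr := hreach Z ht
    have hr' := hreach (!Z) ht
    obtain ⟨L', hL', -⟩ := hL.split hQ
    obtain ⟨σ, h1, -, F, h2, -, h3⟩ := hL'.exec hfree (v := v) hr
    have hrQ : Reach S (Q, after d σ) := hr.leads ⟨σ, h1, rfl⟩
    obtain ⟨e, he, hne⟩ := hA m (by omega) Q h hmin' _ hrQ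
    obtain ⟨p', l', x', ht'⟩ := h.isTest
    have hq := ht'.query_eq (after d σ)
    set a : Query Γ := ⟨p', fun k => after d σ (x' k)⟩ with ha
    have haF : a ∉ F := fun h => h2 a h _ (.refl _) hq
    have fa : ∀ Z', Fresh a (next Z' Q, after d σ) := fun Z' => by
      rw [← ht'.adv_eq]; exact hrQ.fresh hfree hq Z'
    have fF : ∀ q ∈ F, ∀ Z', Fresh q (next Z' Q, after d σ) := fun q hq Z' => by
      rw [← ht'.adv_eq]; exact (h2 q hq).adv Z'
    -- `a` decides the outcome after the outcome `Z` of `K`, but it does not matter after the other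
    -- outcome; so the outcomes of `K` lead to different values either for `e₂` or with `a` added
    set e₂ := (e \ F).erase a with he₂
    have o : ∀ Z', out v e₂ (next Z' Q, after d σ) = out v e (next Z' Q, after d σ) := by
      intro Z'
      rw [he₂, (fa Z').out_erase]
      refine out_congr fun q => ?_
      by_cases hqF : q ∈ F
      · exact .inr (fF q hqF Z')
      · exact .inl (by simp [hqF])
    have hdis : Disjoint e₂ F :=
      Finset.disjoint_of_subset_left (Finset.erase_subset _ _) Finset.sdiff_disjoint
    have hae : a ∉ e₂ := Finset.notMem_erase _ _
    have hcard : e₂.card ≤ m :=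
      (Finset.card_le_card ((Finset.erase_subset _ _).trans Finset.sdiff_subset)).trans he
    have i1 : out v e₂ (next Z K, d) = out v e (next false Q, after d σ) := by
      rw [h3 _ hdis, out_adv_false (c := (Q, after d σ)) hq hae, ht'.adv_eq, o]
    have i2 : out v (insert a e₂) (next Z K, d) = out v e (next true Q, after d σ) := by
      rw [h3 _ (Finset.disjoint_insert_left.2 ⟨haF, hdis⟩),
        out_adv_true (c := (Q, after d σ)) hq (Finset.mem_insert_self _ _), ht'.adv_eq,
        (fa _).out_insert, o]
    obtain ⟨τQ, hτQ, -⟩ := hrQ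
    obtain ⟨τK, hτK, -⟩ := id hc
    have i3 : out v (insert a e₂) (next (!Z) K, d) = out v e₂ (next (!Z) K, d) := by
      refine out_insert_eq_of_not_falsePath hlab hS a e₂ _ hcard hr' ?_ ?_
      · rintro c' l'' x'' ⟨τ, hτ, -⟩ h'
        rw [test_unique hlab hS.1 hτ hτQ h' ht']
        exact hmin'
      · intro L'' P l'' x'' hL'' h'
        obtain ⟨ρ, hρ⟩ := hL''.exists_run
        obtain ⟨τ, hτ, -⟩ := hr'
        rw [test_unique hlab hS.1 (hτ.append hρ) hτQ h' ht'] at hL''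
        exact not_falsePath_of_mem hlab hτK ht hL hQ hQK _ hL''
    have main : ∃ e : Finset (Query Γ), e.card ≤ m + 1 ∧
        out v e (next Z K, d) ≠ out v e (next (!Z) K, d) := by
      by_cases h0 : out v e₂ (next Z K, d) = out v e₂ (next (!Z) K, d)
      · refine ⟨insert a e₂, (Finset.card_insert_le _ _).trans (by omega), ?_⟩
        rw [i3, ← h0, i1, i2]
        exact hne
      · exact ⟨_, by omega, h0⟩
    obtain ⟨e, he, hne⟩ := main
    cases Z
    · exact ⟨e, by omega, hne.symm⟩
    · exact ⟨e, by omega, hne⟩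
  · -- no test between `K` and its join has a cheap influence, so that the influence of `K` is that
    -- of the variables assigned on the way
    obtain ⟨L₁, L₂, hL₁, hL₂, h⟩ : ∃ L₁ L₂, FalsePath (next true K) L₁ (join K) ∧
        FalsePath (next false K) L₂ (join K) ∧
        Influence v (join K) (some (assigned (L₁ ++ L₂))) k := by
      cases hi with
      | @zone _ p l x Z L Q m ht hL hQ h => exact absurd ⟨Z, L, Q, m, by omega, hL, hQ, h⟩ hz
      | flow _ hL₁ hL₂ h => exact ⟨_, _, hL₁, hL₂, h⟩
    have hrT := hreach true ht
    have hrF := hreach false ht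
    obtain ⟨σ₁, h1, h2, F₁, -, h3, h4⟩ := hL₁.exec hfree (v := v) hrT
    obtain ⟨σ₂, h5, h6, F₂, -, h7, h8⟩ := hL₂.exec hfree (v := v) hrF
    have hrem : ∀ q ∈ F₁ ∪ F₂, ∀ c' l x, Reach S c' → IsTest c'.1 q.1 l x →
        ∀ m < k, ¬ Influence v c'.1 none m := by
      have key : ∀ {Z L}, FalsePath (next Z K) L (join K) → ∀ {q : Query Γ},
          (∃ R ∈ L, ∃ l x, IsTest R q.1 l x) → ∀ c' l x, Reach S c' → IsTest c'.1 q.1 l x →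
          ∀ m < k, ¬ Influence v c'.1 none m := by
        rintro Z L hL q ⟨R, hR, l', x', h⟩ c' l'' x'' hc' h' m hm hinf
        obtain ⟨L', hL', -⟩ := hL.split hR
        obtain ⟨τ, hτ⟩ := hL'.exists_run
        obtain ⟨ρ, hρ, -⟩ := hreach Z ht
        obtain ⟨ρ', hρ', -⟩ := hc'
        rw [test_unique hlab hS.1 hρ' (hρ.append hτ) h' h] at hinf
        exact hz ⟨Z, L, R, m, hm, hL, hR, hinf⟩
      intro q hq
      rcases Finset.mem_union.1 hq with hq | hq
      · exact key hL₁ (h3 q hq)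
      · exact key hL₂ (h7 q hq)
    obtain ⟨e, he, hne⟩ := exists_out_ne_of_influence_of_same_point hlab hS k hA (join K)
      (assigned (L₁ ++ L₂)) (after d σ₁) (after d σ₂)
      (setOf_after_ne_eq_assigned hS hc ht hL₁ hL₂ h1 h5 h2 h6).symm
      (hrT.leads ⟨σ₁, h1, rfl⟩) (hrF.leads ⟨σ₂, h5, rfl⟩) h
      fun m hm h => hmin m hm (.flow ht hL₁ hL₂ h)
    have sd : ∀ {c}, Reach S c → out v (e \ (F₁ ∪ F₂)) c = out v e c := fun {c} h =>
      out_sdiff_eq hfree (exists_influence_of_out_ne (v := v) hlab hS k) he _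
        (fun q hq c' l x h1 h2 m hm => hrem q hq c' l x h1 h2 m (by omega)) h
    refine ⟨e \ (F₁ ∪ F₂), (Finset.card_le_card Finset.sdiff_subset).trans he, ?_⟩
    rw [h4 _ (Finset.disjoint_of_subset_right Finset.subset_union_left Finset.sdiff_disjoint),
      h8 _ (Finset.disjoint_of_subset_right Finset.subset_union_right Finset.sdiff_disjoint),
      sd (hrT.leads ⟨σ₁, h1, rfl⟩), sd (hrF.leads ⟨σ₂, h5, rfl⟩)]
    exact hne

/-! ### Weiser's dependences give influences -/

theorem taint_mono {n : ℕ} {D D' : Set Γ.Var} (h : D ⊆ D') (y : Γ.Var) (x : Fin n → Γ.Var) :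
    taint D y x ⊆ taint D' y x := by
  rintro z (⟨rfl, k, hk⟩ | ⟨hz, hD⟩)
  · exact .inl ⟨rfl, k, h hk⟩
  · exact .inr ⟨hz, h hD⟩

theorem Influence.mono {v : Γ.Var} {P : Schema Γ} {D D' : Set Γ.Var} {n : ℕ}
    (h : Influence v P (some D) n) (hD : D ⊆ D') : Influence v P (some D') n := by
  generalize ho : some D = o at h
  induction h generalizing D D' with
  | final h => cases ho; exact .final (hD h)
  | assign _ ih => cases ho; exact .assign (ih (taint_mono hD _ _) rfl)
  | pass_false ht _ ih => cases ho; exact .pass_false ht (ih hD rfl)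
  | pass_true ht _ ih => cases ho; exact .pass_true ht (ih hD rfl)
  | hit k ht hk h => cases ho; exact .hit k ht (hD hk) h
  | flow => cases ho
  | zone => cases ho

/-- An influence of a set of variables is an influence of one of them. -/
theorem Influence.exists_singleton {v : Γ.Var} {P : Schema Γ} {D : Set Γ.Var} {n : ℕ}
    (h : Influence v P (some D) n) : ∃ z ∈ D, Influence v P (some {z}) n := by
  generalize ho : some D = o at h
  induction h generalizing D with
  | final h => cases ho; exact ⟨_, h, .final rfl⟩
  | @assign y f l x R D₀ n _ ih =>
    cases ho
    obtain ⟨z, hz, h⟩ := ih rfl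
    rcases hz with ⟨rfl, k, hk⟩ | ⟨hz, hD⟩
    · refine ⟨_, hk, .assign (h.mono ?_)⟩
      rintro _ rfl
      exact .inl ⟨rfl, k, rfl⟩
    · refine ⟨_, hD, .assign (h.mono ?_)⟩
      rintro _ rfl
      exact .inr ⟨hz, rfl⟩
  | pass_false ht _ ih =>
    cases ho
    obtain ⟨z, hz, h⟩ := ih rfl
    exact ⟨z, hz, .pass_false ht h⟩
  | pass_true ht _ ih =>
    cases ho
    obtain ⟨z, hz, h⟩ := ih rfl
    exact ⟨z, hz, .pass_true ht h⟩
  | hit k ht hk h => cases ho; exact ⟨_, hk, .hit k ht rfl h⟩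
  | flow => cases ho
  | zone => cases ho

/-- An influence at some cost: `Influences v P (some D)` concerns the values of the variables in `D`
at the point `P`, and `Influences v K none` the outcome of the test at the point `K`. -/
def Influences (v : Γ.Var) (P : Schema Γ) (o : Option (Set Γ.Var)) : Prop :=
  ∃ n, Influence v P o n

theorem Influences.of_step {v z : Γ.Var} {P Q : Schema Γ} {a} (hs : Step P a Q)
    (ha : a.target ≠ some z) (h : Influences v Q (some {z})) : Influences v P (some {z}) := by
  obtain ⟨n, h⟩ := h
  cases hs with
  | assign y f l x =>
    refine ⟨n, .assign (h.mono ?_)⟩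
    rintro _ rfl
    exact .inr ⟨by rintro rfl; simp [Letter.target] at ha, rfl⟩
  | test ht Z =>
    cases Z
    · exact ⟨_, .pass_false ht h⟩
    · exact ⟨_, .pass_true ht h⟩

theorem Influences.of_run {v z : Γ.Var} {P Q : Schema Γ} {σ} (hσ : Run P σ Q)
    (hz : ∀ b ∈ σ, b.target ≠ some z) (h : Influences v Q (some {z})) :
    Influences v P (some {z}) := by
  induction hσ with
  | nil => exact h
  | cons hs _ ih =>
    exact .of_step hs (hz _ List.mem_cons_self) (ih (fun b hb => hz b (List.mem_cons_of_mem _ hb)) h)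

/-- An influence of a variable that is not assigned on an all-false path is carried back to the
start of the path. -/
theorem Influences.of_falsePath {v z : Γ.Var} {P Q : Schema Γ} {L} (hL : FalsePath P L Q)
    (hz : z ∉ assigned L) (h : Influences v Q (some {z})) : Influences v P (some {z}) := by
  induction hL with
  | nil => exact h
  | @cons P L Q h0 hL ih =>
    obtain ⟨a, ha, -⟩ := exists_step h0 false Term.var
    refine .of_step ha ?_ (ih (fun ⟨f, l, x, R, hR⟩ => hz ⟨f, l, x, R, List.mem_cons_of_mem _ hR⟩) h)
    intro hat
    generalize next false P = Q' at ha
    cases ha with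
    | assign y f l x =>
      simp only [Letter.target, Option.some.injEq] at hat
      subst hat
      exact hz ⟨f, l, x, _, List.mem_cons_self⟩
    | test => simp [Letter.target] at hat

theorem Influences.zone {v : Γ.Var} {K : Schema Γ} {p l x Z L Q} (ht : IsTest K p l x)
    (hL : FalsePath (next Z K) L (join K)) (hQ : Q ∈ L) (h : Influences v Q none) :
    Influences v K none :=
  h.imp' _ fun _ h => .zone ht hL hQ h

theorem Influences.flow {v z : Γ.Var} {K : Schema Γ} {p l x Z L} (ht : IsTest K p l x)
    (hL : FalsePath (next Z K) L (join K)) (hz : z ∈ assigned L)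
    (h : Influences v (join K) (some {z})) : Influences v K none := by
  obtain ⟨n, h⟩ := h
  obtain ⟨L', hL'⟩ := exists_falsePath_join ht (!Z)
  obtain ⟨f, l, x, R, hz⟩ := hz
  cases Z
  · refine ⟨n, .flow ht hL' hL (h.mono ?_)⟩
    rintro _ rfl
    exact ⟨f, l, x, R, List.mem_append_right _ hz⟩
  · refine ⟨n, .flow ht hL hL' (h.mono ?_)⟩
    rintro _ rfl
    exact ⟨f, l, x, R, List.mem_append_left _ hz⟩

/-- A test with an influence anywhere in a block gives such a test on the all-false path through
the block. -/
theorem Influences.exists_mem_falsePath {v : Γ.Var} {A J P : Schema Γ} (hP : P ∈ A.points J)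
    (h : Influences v P none) {L} (hL : FalsePath (A.seq J) L J) :
    ∃ Q ∈ L, Influences v Q none := by
  induction A generalizing J L with
  | skip => simp [points] at hP
  | assign y f l x R ih =>
    obtain ⟨L₁, h1, -⟩ := exists_falsePath_block R J
    obtain rfl := hL.unique (.cons (by simp [seq]) h1)
    simp only [points, List.mem_cons] at hP
    rcases hP with rfl | hP
    · obtain ⟨n, h⟩ := h
      obtain ⟨_, _, _, h⟩ := h.isTest
      cases h
    · obtain ⟨Q, hQ, h⟩ := ih hP h1
      exact ⟨Q, List.mem_cons_of_mem _ hQ, h⟩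
  | ifte p l x T₁ T₂ R ih₁ ih₂ ih =>
    obtain ⟨L₁, h1, -⟩ := exists_falsePath_block R J
    obtain ⟨L₂, h2, -⟩ := exists_falsePath_block T₂ (R.seq J)
    obtain ⟨L₃, h3, -⟩ := exists_falsePath_block T₁ (R.seq J)
    obtain rfl := hL.unique (.cons (by simp [seq]) (h2.append h1))
    simp only [points, List.mem_cons, List.mem_append] at hP
    rcases hP with rfl | (hP | hP) | hP
    · exact ⟨_, List.mem_cons_self, h⟩
    · obtain ⟨Q, hQ, h⟩ := ih₁ hP h3
      exact ⟨_, List.mem_cons_self, .zone (Z := true) (.ifte _ _ _ _ _ _) h3 hQ h⟩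
    · obtain ⟨Q, hQ, h⟩ := ih₂ hP h2
      exact ⟨Q, by simp [hQ], h⟩
    · obtain ⟨Q, hQ, h⟩ := ih hP h1
      exact ⟨Q, by simp [hQ], h⟩
  | loop p l x T R ihT ih =>
    obtain ⟨L₁, h1, -⟩ := exists_falsePath_block R J
    obtain ⟨L₂, h2, -⟩ := exists_falsePath_block T ((loop p l x T R).seq J)
    obtain rfl := hL.unique (.cons (by simp [seq]) h1)
    simp only [points, List.mem_cons, List.mem_append] at hP
    rcases hP with rfl | hP | hP
    · exact ⟨_, List.mem_cons_self, h⟩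
    · obtain ⟨Q, hQ, h⟩ := ihT hP h2
      exact ⟨_, List.mem_cons_self, .zone (Z := true) (.loop _ _ _ _ _)
        (h2.append (.cons (by simp [seq]) (.nil _))) (List.mem_append_left _ hQ) h⟩
    · obtain ⟨Q, hQ, h⟩ := ih hP h1
      exact ⟨Q, by simp [hQ], h⟩

/-- If a variable that is assigned somewhere in a block has an influence after the block, then it
is assigned on the all-false path through the block, or there is a test with an influence on this
path. -/
theorem Influences.mem_assigned_or {v z : Γ.Var} {A J : Schema Γ} (hz : z ∈ assigned (A.points J))
    (h : Influences v J (some {z})) {L} (hL : FalsePath (A.seq J) L J) :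
    z ∈ assigned L ∨ ∃ Q ∈ L, Influences v Q none := by
  have sub : ∀ {L L' : List (Schema Γ)}, L' ⊆ L → (z ∈ assigned L' ∨ ∃ Q ∈ L', Influences v Q none) →
      (z ∈ assigned L ∨ ∃ Q ∈ L, Influences v Q none) := by
    rintro L L' hL' (⟨f, l, x, R, h⟩ | ⟨Q, hQ, h⟩)
    · exact .inl ⟨f, l, x, R, hL' h⟩
    · exact .inr ⟨Q, hL' hQ, h⟩
  obtain ⟨f, l, x, P, hP⟩ := hz
  induction A generalizing J L with
  | skip => simp [points] at hP
  | assign y f' l' x' R ih =>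
    obtain ⟨L₁, h1, -⟩ := exists_falsePath_block R J
    obtain rfl := hL.unique (.cons (by simp [seq]) h1)
    simp only [points, List.mem_cons] at hP
    rcases hP with hP | hP
    · exact .inl ⟨f, l, x, P, by simp [hP]⟩
    · exact sub (by simp) (ih h h1 hP)
  | ifte p l' x' T₁ T₂ R ih₁ ih₂ ih =>
    obtain ⟨L₁, h1, -⟩ := exists_falsePath_block R J
    obtain ⟨L₂, h2, -⟩ := exists_falsePath_block T₂ (R.seq J)
    obtain ⟨L₃, h3, -⟩ := exists_falsePath_block T₁ (R.seq J)
    obtain rfl := hL.unique (.cons (by simp [seq]) (h2.append h1))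
    by_cases hz : z ∈ assigned L₁
    · exact sub (by simp) (.inl hz)
    have hR := h.of_falsePath h1 hz
    simp only [points, List.mem_cons, List.mem_append] at hP
    rcases hP with hP | (hP | hP) | hP
    · simp [seq] at hP
    · refine .inr ⟨_, List.mem_cons_self, ?_⟩
      rcases ih₁ hR h3 hP with hz | ⟨Q, hQ, h⟩
      · exact .flow (Z := true) (.ifte _ _ _ _ _ _) h3 hz hR
      · exact .zone (Z := true) (.ifte _ _ _ _ _ _) h3 hQ h
    · exact sub (by simp) (ih₂ hR h2 hP)
    · exact sub (by simp) (ih h h1 hP)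
  | loop p l' x' T R ihT ih =>
    obtain ⟨L₁, h1, -⟩ := exists_falsePath_block R J
    obtain ⟨L₂, h2, -⟩ := exists_falsePath_block T ((loop p l' x' T R).seq J)
    obtain rfl := hL.unique (.cons (by simp [seq]) h1)
    by_cases hz : z ∈ assigned L₁
    · exact sub (by simp) (.inl hz)
    have hR := h.of_falsePath h1 hz
    have hloop : Influences v ((loop p l' x' T R).seq J) (some {z}) :=
      .of_step (.test (.loop p l' x' T _) false) (by simp [Letter.target]) hR
    have hjoin := h2.append (.cons (by simp [seq]) (.nil _))
    simp only [points, List.mem_cons, List.mem_append] at hP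
    rcases hP with hP | hP | hP
    · simp [seq] at hP
    · refine .inr ⟨_, List.mem_cons_self, ?_⟩
      rcases ihT hloop h2 hP with ⟨f, l, x, R', hz⟩ | ⟨Q, hQ, h⟩
      · exact .flow (Z := true) (.loop _ _ _ _ _) hjoin
          ⟨f, l, x, R', List.mem_append_left _ hz⟩ hR
      · exact .zone (Z := true) (.loop _ _ _ _ _) hjoin (List.mem_append_left _ hQ) h
    · exact sub (by simp) (ih h h1 hP)

/-- `K.Block Z A J`: the test at the head of `K` with outcome `Z` leads to the block `A`, which is
followed by `J`.  The second condition says that `J` is the join of an if-statement, or the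
while-statement itself whose body is `A`. -/
def Block (K : Schema Γ) (Z : Bool) (A J : Schema Γ) : Prop :=
  next Z K = A.seq J ∧ (J = join K ∨ (J = K ∧ next false K = join K ∧ Z = true))

theorem Block.exists_falsePath {K A J : Schema Γ} {Z} (h : K.Block Z A J) (hK : K ≠ skip) :
    ∃ L L', FalsePath (A.seq J) L J ∧ L ⊆ L' ∧ FalsePath (next Z K) L' (join K) := by
  obtain ⟨h1, h2⟩ := h
  obtain ⟨L, hL, -⟩ := exists_falsePath_block A J
  rcases h2 with rfl | ⟨rfl, h2, -⟩
  · exact ⟨L, L, hL, List.Subset.refl _, h1 ▸ hL⟩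
  · exact ⟨L, L ++ [J], hL, by simp, h1 ▸ hL.append (.cons hK (h2 ▸ .nil _))⟩

theorem Block.influences_of_join {v z : Γ.Var} {K A J : Schema Γ} {Z} (hb : K.Block Z A J) {p l x}
    (ht : IsTest K p l x) (hz : z ∈ assigned (A.points J))
    (h : Influences v (join K) (some {z})) : Influences v K none := by
  obtain ⟨L, L', hL, hsub, hL'⟩ := hb.exists_falsePath ht.ne_skip
  have hJ : Influences v J (some {z}) := by
    rcases hb.2 with rfl | ⟨rfl, h2, -⟩
    · exact h
    · exact .of_step (.test ht false) (by simp [Letter.target]) (h2 ▸ h)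
  rcases hJ.mem_assigned_or hz hL with ⟨f, l, x, R, h1⟩ | ⟨Q, hQ, h1⟩
  · exact .flow ht hL' ⟨f, l, x, R, hsub h1⟩ h
  · exact .zone ht hL' (hsub hQ) h1

theorem Block.influences_of_mem {v : Γ.Var} {K A J P : Schema Γ} {Z} (hb : K.Block Z A J) {p l x}
    (ht : IsTest K p l x) (hP : P ∈ A.points J) (h : Influences v P none) :
    Influences v K none := by
  obtain ⟨L, L', hL, hsub, hL'⟩ := hb.exists_falsePath ht.ne_skip
  obtain ⟨Q, hQ, h⟩ := h.exists_mem_falsePath hP hL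
  exact .zone ht hL' (hsub hQ) h

/-- If variables that are assigned only under the control of a test have an influence, then so has
the test. -/
theorem Block.influences_of_subset_assigned {v : Γ.Var} {K A J P : Schema Γ} {Z}
    (hb : K.Block Z A J) {p l x} (ht : IsTest K p l x) {D : Set Γ.Var} {n}
    (h : Influence v P (some D) n) (hP : P ∈ A.points J ∨ P = J) (hD : D ⊆ assigned (A.points J)) :
    Influences v K none := by
  generalize ho : some D = o at h
  induction h generalizing D with
  | @final D' h =>
    cases ho
    rcases hP with hP | rfl
    · exact absurd rfl (ne_skip_of_mem_points hP)
    · rcases hb.2 with h1 | ⟨rfl, -⟩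
      · exact hb.influences_of_join ht (hD h) ⟨0, h1 ▸ .final rfl⟩
      · exact absurd rfl ht.ne_skip
  | @assign y f l' x' R D' n h ih =>
    cases ho
    rcases hP with hP | rfl
    · refine ih ((Step.assign y f l' x' R).mem_points hP) ?_ rfl
      rintro z (⟨rfl, -⟩ | ⟨-, hz⟩)
      · exact ⟨f, l', x', R, hP⟩
      · exact hD hz
    · rcases hb.2 with h1 | ⟨rfl, -⟩
      · obtain ⟨z, hz, h⟩ := (Influence.assign h).exists_singleton
        exact hb.influences_of_join ht (hD hz) ⟨n, h1 ▸ h⟩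
      · cases ht
  | @pass_false P p' l' x' D' n ht' h ih =>
    cases ho
    rcases hP with hP | rfl
    · exact ih ((Step.test ht' false).mem_points hP) hD rfl
    · obtain ⟨z, hz, h⟩ := h.exists_singleton
      rcases hb.2 with h1 | ⟨rfl, h1, -⟩
      · exact hb.influences_of_join ht (hD hz) ⟨n, h1 ▸ .pass_false ht' h⟩
      · exact hb.influences_of_join ht (hD hz) ⟨n, h1 ▸ h⟩
  | @pass_true P p' l' x' D' n ht' h ih =>
    cases ho
    rcases hP with hP | rfl
    · exact ih ((Step.test ht' true).mem_points hP) hD rfl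
    · rcases hb.2 with h1 | ⟨rfl, -, rfl⟩
      · obtain ⟨z, hz, h⟩ := h.exists_singleton
        exact hb.influences_of_join ht (hD hz) ⟨n + 1, h1 ▸ .pass_true ht' h⟩
      · exact ih (hb.1 ▸ seq_mem_points A P) hD rfl
  | @hit P p' l' x' D' n k ht' hk h =>
    cases ho
    rcases hP with hP | rfl
    · exact hb.influences_of_mem ht hP ⟨n, h⟩
    · rcases hb.2 with h1 | ⟨rfl, -⟩
      · exact hb.influences_of_join ht (hD hk) ⟨n + 1, h1 ▸ .hit k ht' rfl h⟩
      · exact ⟨n, h⟩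
  | flow => cases ho
  | zone => cases ho

/-- What a test controls lies in the block to which one of its outcomes leads. -/
theorem exists_block_of_controls {A : Schema Γ} {p l Z y} (h : A.Controls p l Z y) (J : Schema Γ) :
    ∃ K ∈ A.points J, ∃ x, IsTest K p l x ∧ ∃ B J', K.Block Z B J' ∧ y ∈ B.occs := by
  induction A generalizing J with
  | skip => exact h.elim
  | assign y' f' l' x' R ih =>
    obtain ⟨K, hK, h⟩ := ih h J
    exact ⟨K, by simp [points, hK], h⟩
  | ifte p' l' x' T₁ T₂ R ih₁ ih₂ ih =>
    simp only [points, List.mem_cons, List.mem_append]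
    rcases h with ⟨rfl, rfl, h⟩ | h | h | h
    · refine ⟨_, .inl rfl, x', .ifte _ _ _ _ _ _, ?_⟩
      rcases h with ⟨rfl, h⟩ | ⟨rfl, h⟩
      · exact ⟨T₁, _, ⟨rfl, .inl rfl⟩, h⟩
      · exact ⟨T₂, _, ⟨rfl, .inl rfl⟩, h⟩
    · obtain ⟨K, hK, h⟩ := ih₁ h (R.seq J)
      exact ⟨K, by simp [hK], h⟩
    · obtain ⟨K, hK, h⟩ := ih₂ h (R.seq J)
      exact ⟨K, by simp [hK], h⟩
    · obtain ⟨K, hK, h⟩ := ih h J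
      exact ⟨K, by simp [hK], h⟩
  | loop p' l' x' T R ihT ih =>
    simp only [points, List.mem_cons, List.mem_append]
    rcases h with ⟨rfl, rfl, rfl, h⟩ | h | h
    · exact ⟨_, .inl rfl, x', .loop _ _ _ _ _, T, _, ⟨rfl, .inr ⟨rfl, rfl, rfl⟩⟩, h⟩
    · obtain ⟨K, hK, h⟩ := ihT h ((loop p' l' x' T R).seq J)
      exact ⟨K, by simp [hK], h⟩
    · obtain ⟨K, hK, h⟩ := ih h J
      exact ⟨K, by simp [hK], h⟩

theorem exists_app_of_isWordTerm_singleton {F : Type u} {ar : F → ℕ} {V : Type u} {f : F}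
    {t : Term F ar V} (h : t.IsWordTerm [f]) : ∃ ts, t = Term.app f ts := by
  generalize hw : [f] = w at h
  cases h with
  | single g ts => cases hw; exact ⟨ts, rfl⟩
  | snoc w g ts k h =>
    cases w with
    | nil => simp only [List.nil_append, List.cons.injEq, and_true] at hw; subst hw; exact ⟨ts, rfl⟩
    | cons => simp at hw

theorem exists_app_of_isWordTerm_pair {F : Type u} {ar : F → ℕ} {V : Type u} {f g : F}
    {t : Term F ar V} (h : t.IsWordTerm [f, g]) :
    ∃ ts k ts', t = Term.app g ts ∧ ts k = Term.app f ts' := by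
  generalize hw : [f, g] = w at h
  cases h with
  | single => simp at hw
  | snoc w g' ts k h =>
    rw [show [f, g] = [f] ++ [g] from rfl] at hw
    obtain ⟨rfl, h'⟩ := List.append_inj' hw rfl
    cases h'
    obtain ⟨ts', h⟩ := exists_app_of_isWordTerm_singleton h
    exact ⟨ts, k, ts', rfl, h⟩

/-- Data dependence in terms of paths: a path leads from an assignment to a point that references
the assigned variable, which is not assigned again on the way. -/
theorem DataDep.exists_run {S : Schema Γ} {f l s} (h : S.DataDep f l s) :
    ∃ α y a R ν Q, Run S α (assign y f l a R) ∧ Run R ν Q ∧ (∀ b ∈ ν, b.target ≠ some y) ∧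
      ((∃ w g m b R', s = (.inl g, m) ∧ Q = assign w g m b R' ∧ ∃ k, b k = y) ∨
        ∃ p m x, s = (.inr p, m) ∧ IsTest Q p m x ∧ ∃ k, x k = y) := by
  have split : ∀ {μ : List (Letter Γ)} {P Q : Schema Γ} {y f l a ν}, Run P (μ ++ Letter.assign y f l a :: ν) Q →
      ∃ R, Run P μ (assign y f l a R) ∧ Run R ν Q := by
    intro μ P Q y f l a ν h
    obtain ⟨P', h1, h2⟩ := run_append_iff.1 h
    obtain ⟨R, h3, h4⟩ := run_cons_iff.1 h2
    cases h3
    exact ⟨R, h1, h4⟩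
  obtain ⟨s | p, m⟩ := s
  · obtain ⟨σ, hσ, w, hw⟩ := h
    obtain ⟨ts, k, ts', h1, h2⟩ := exists_app_of_isWordTerm_pair hw
    obtain ⟨μ, a, ν, rfl, -, h3⟩ := exists_of_symbolic_eq_app h1
    rw [h3] at h2
    obtain ⟨μ', b, ν', rfl, h4, -⟩ := exists_of_symbolic_eq_app h2
    obtain ⟨α, Q, R, hα, hQ⟩ := mem_pathSegments_iff.1 hσ
    obtain ⟨R', h5, -⟩ := split hQ
    obtain ⟨R'', h6, h7⟩ := split h5
    exact ⟨_, _, _, _, _, _, hα.append h6, h7, h4, .inl ⟨w, s, m, a, R', rfl, rfl, k, rfl⟩⟩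
  · obtain ⟨σ, x, Z, hσ, k, hk⟩ := h
    obtain ⟨ts, h1⟩ := exists_app_of_isWordTerm_singleton hk
    obtain ⟨μ, a, ν, rfl, h2, -⟩ := exists_of_symbolic_eq_app h1
    obtain ⟨α, Q, R, hα, hQ⟩ := mem_pathSegments_iff.1 hσ
    obtain ⟨R', h3, h4⟩ := run_append_iff.1 hQ
    obtain ⟨R'', h5, h6⟩ := split h3
    obtain ⟨_, h4, -⟩ := run_cons_iff.1 h4
    cases h4 with
    | test ht => exact ⟨_, _, _, _, _, _, hα.append h5, h6, h2, .inr ⟨p, m, x, rfl, ht, k, rfl⟩⟩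

/-- Dependence of the final value in terms of paths: a path leads from an assignment to the end
without a further assignment to the variable. -/
theorem FinalDep.exists_run {S : Schema Γ} {f l v} (h : S.FinalDep f l v) :
    ∃ α a R ν, Run S α (assign v f l a R) ∧ Run R ν skip ∧ ∀ b ∈ ν, b.target ≠ some v := by
  obtain ⟨σ, hσ, hw⟩ := h
  obtain ⟨ts, h1⟩ := exists_app_of_isWordTerm_singleton hw
  obtain ⟨μ, a, ν, rfl, h2, -⟩ := exists_of_symbolic_eq_app h1
  obtain ⟨α, Q, hα, hQ⟩ := mem_terminalSegments_iff.1 hσ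
  obtain ⟨P', h3, h4⟩ := run_append_iff.1 hQ
  obtain ⟨R, h5, h6⟩ := run_cons_iff.1 h4
  cases h5
  exact ⟨_, a, R, ν, hα.append h3, h6, h2⟩

/-- The symbols in Weiser's set have an influence. -/
theorem influences_of_mem_need {S : Schema Γ} (hlab : S.DistinctLabels) {v : Γ.Var} {s}
    (h : S.need v s) :
    (∀ f l y a R σ, s = (.inl f, l) → Run S σ (assign y f l a R) → Influences v R (some {y})) ∧
    ∀ p l x K σ, s = (.inr p, l) → Run S σ K → IsTest K p l x → Influences v K none := by
  induction h with
  | final f l h =>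
    refine ⟨?_, by simp⟩
    rintro f' l' y a R σ heq hσ
    cases heq
    obtain ⟨α, a', R', ν, h1, h2, h3⟩ := h.exists_run
    cases point_unique hlab hσ h1 rfl
    exact .of_run h2 h3 ⟨0, .final rfl⟩
  | data f l s _ h ih =>
    refine ⟨?_, by simp⟩
    rintro f' l' y a R σ heq hσ
    cases heq
    obtain ⟨α, y', a', R', ν, Q, h1, h2, h3, h4⟩ := h.exists_run
    cases point_unique hlab hσ h1 rfl
    refine .of_run h2 h3 ?_
    have hQ := (h1.append (.single (.assign _ _ _ _ _))).append h2
    rcases h4 with ⟨w, g, m, b, R'', rfl, rfl, k, rfl⟩ | ⟨p, m, x, rfl, ht, k, rfl⟩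
    · obtain ⟨n, h⟩ := ih.1 g m w b R'' _ rfl hQ
      refine ⟨n, .assign (h.mono ?_)⟩
      rintro _ rfl
      exact .inl ⟨rfl, k, rfl⟩
    · obtain ⟨n, h⟩ := ih.2 p m x Q _ rfl hQ ht
      exact ⟨n + 1, .hit k ht rfl h⟩
  | control p l Z s _ h ih =>
    refine ⟨by simp, ?_⟩
    rintro p' l' x K σ heq hσ ht
    cases heq
    obtain ⟨K', hK', x', ht', B, J, hb, hs⟩ := exists_block_of_controls h skip
    obtain ⟨τ, hτ⟩ := exists_run_of_mem_points hK'
    rw [seq_skip] at hτ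
    cases point_unique hlab hσ hτ (by rw [ht.head?_eq, ht'.head?_eq])
    obtain ⟨P, hP, hPs⟩ := exists_point_of_mem_occs hs J
    obtain ⟨ρ, hρ⟩ := exists_run_of_mem_points hP
    rw [← hb.1] at hρ
    have hrun := hσ.append (.cons (.test ht Z) hρ)
    cases P with
    | skip => cases hPs
    | assign y f l a R =>
      cases hPs
      obtain ⟨n, h⟩ := ih.1 f l y a R _ rfl hrun
      refine hb.influences_of_subset_assigned ht h ((Step.assign y f l a R).mem_points hP) ?_
      rintro _ rfl
      exact ⟨f, l, a, R, hP⟩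
    | ifte p l x T₁ T₂ R =>
      cases hPs
      exact hb.influences_of_mem ht hP (ih.2 p l x _ _ rfl hrun (.ifte _ _ _ _ _ _))
    | loop p l x T R =>
      cases hPs
      exact hb.influences_of_mem ht hP (ih.2 p l x _ _ rfl hrun (.loop _ _ _ _ _))

end Schema

/-- The function symbols that occur in a term. -/
def Term.symbols {F : Type u} {ar : F → ℕ} {V : Type u} : Term F ar V → Set F
  | .var _ => ∅
  | .app f ts => {f} ∪ ⋃ k, (ts k).symbols

theorem symbols_after_subset {A : Set Γ.Func} {d : State Γ} {σ : List (Letter Γ)}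
    (hd : ∀ z, (d z).symbols ⊆ A) (hσ : ∀ y f l a, Letter.assign y f l a ∈ σ → f ∈ A) (z : Γ.Var) :
    (after d σ z).symbols ⊆ A := by
  induction σ generalizing d with
  | nil => exact hd z
  | cons b σ ih =>
    refine ih (d := (herb ∅).step d b) (fun z => ?_)
      fun y f l a h => hσ y f l a (List.mem_cons_of_mem _ h)
    cases b with
    | assign y f l a =>
      by_cases hz : z = y
      · subst hz
        simp only [Interp.step, herb, Function.update_self, Term.symbols]
        exact Set.union_subset (Set.singleton_subset_iff.2 (hσ _ _ _ _ List.mem_cons_self))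
          (Set.iUnion_subset fun k => hd _)
      · simpa [Interp.step, hz] using hd z
    | test => exact hd z

namespace Schema

/-! ### The meaning of a schema and its executed path -/

theorem Step.unique {P Q Q' : Schema Γ} {a} (h : Step P a Q) (h' : Step P a Q') : Q = Q' := by
  cases h with
  | assign => cases h' with | assign => rfl
  | test =>
    generalize hb : Letter.test _ _ _ _ = b at h'
    cases h' with
    | assign => cases hb
    | test => cases hb; rfl

/-- A followed path is unique, in the sense that it is a prefix of the terminated one. -/
theorem Run.prefix_of_follows {D : Type u} {i : Interp Γ D} {d : Γ.Var → D} {P Q : Schema Γ}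
    {σ τ} (hσ : Run P σ skip) (hτ : Run P τ Q) (fσ : i.Follows d σ) (fτ : i.Follows d τ) :
    τ <+: σ := by
  induction hτ generalizing d σ with
  | nil => exact List.nil_prefix
  | @cons P a Q' τ R hs _ ih =>
    cases hσ with
    | nil => cases hs with | test h => cases h
    | @cons _ b Q'' σ _ hs' hσ =>
      rw [i.follows_cons] at fσ fτ
      have hab : a = b := by
        cases hs with
        | assign => cases hs' with
          | assign => rfl
          | test h => cases h
        | test ht Z =>
          have f1 := fτ.1
          have f2 := fσ.1
          rw [i.follows_test] at f1
          generalize hP : P = P' at hs'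
          cases hs' with
          | assign => subst hP; cases ht
          | test ht' Z' =>
            subst hP
            rw [i.follows_test] at f2
            cases ht <;> cases ht' <;> rw [← f1, ← f2]
      subst hab
      cases hs.unique hs'
      exact (List.prefix_cons_inj a).2 (ih hσ fσ.2 fτ.2)

theorem meaning_eq {D : Type u} {i : Interp Γ D} {d : Γ.Var → D} {S : Schema Γ} {σ}
    (hσ : Run S σ skip) (fσ : i.Follows d σ) : S.meaning i d = some (i.run d σ) := by
  have h : ∃ σ, σ ∈ S.paths ∧ σ ∈ S.execPrefixes i d :=
    ⟨σ, mem_paths_iff.2 hσ, mem_pathPrefixes_iff.2 ⟨_, hσ⟩, fσ⟩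
  rw [meaning, dif_pos h]
  obtain ⟨h1, -, h2⟩ := h.choose_spec
  have h1 := mem_paths_iff.1 h1
  have : σ = h.choose := List.IsPrefix.eq_of_length_le (h1.prefix_of_follows hσ h2 fσ)
    (hσ.prefix_of_follows h1 fσ h2).length_le
  rw [← this]

theorem exists_run_of_meaning_eq {D : Type u} {i : Interp Γ D} {d d₁ : Γ.Var → D} {S : Schema Γ}
    (h : S.meaning i d = some d₁) : ∃ σ, Run S σ skip ∧ i.Follows d σ ∧ i.run d σ = d₁ := by
  rw [meaning] at h
  split_ifs at h with hex
  obtain ⟨h1, -, h2⟩ := hex.choose_spec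
  exact ⟨_, mem_paths_iff.1 h1, h2, Option.some.inj h⟩

/-- Executions with finitely many true queries terminate, because no query is made twice.  The set
`e'` contains those true queries that can still be made. -/
theorem exists_run_out {S : Schema Γ} (hS : S.Free) (e e' : Finset (Query Γ)) (P : Schema Γ)
    (d : State Γ) (hc : Reach S (P, d)) (he : ∀ q ∈ e, q ∈ e' ∨ Fresh q (P, d)) :
    ∃ σ, Run P σ skip ∧ (herb e).Follows d σ ∧ ∀ v, out v e (P, d) = after d σ v := by
  classical
  by_cases hskip : P = skip
  · refine ⟨[], hskip ▸ .nil _, fun ρ p l x Z h => by simp at h, fun v => out_skip hskip⟩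
  have hsize := size_next_false hskip
  cases hquery : P.query d with
  | none =>
    obtain ⟨σ, h1, h2, h3⟩ := exists_run_out hS e e' (next false P) (P.upd d) (hc.adv false)
      fun q hq => (he q hq).imp_right fun h => h.adv false
    cases P with
    | skip => exact absurd rfl hskip
    | ifte => cases hquery
    | loop => cases hquery
    | assign y f l x R =>
      refine ⟨_, .cons (.assign y f l x R) h1, ?_, fun v => ?_⟩
      · rw [Interp.follows_cons]
        exact ⟨Interp.follows_assign _ _ _ _ _ _, h2⟩
      · rw [out_adv_of_none (c := (assign y f l x R, d)) hquery]
        exact h3 v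
  | some t =>
    obtain ⟨p, l, x, ht, rfl⟩ := exists_isTest_of_query hquery
    have step : ∀ {Z σ}, Run (next Z P) σ skip → (herb e).Follows d σ →
        ((⟨p, fun k => d (x k)⟩ : Query Γ) ∈ e ↔ Z = true) →
        Run P (Letter.test p l x Z :: σ) skip ∧ (herb e).Follows d (Letter.test p l x Z :: σ) := by
      intro Z σ h1 h2 hZ
      refine ⟨.cons (.test ht Z) h1, ?_⟩
      rw [Interp.follows_cons, Interp.follows_test]
      refine ⟨?_, h2⟩
      simp only [herb, hZ, Bool.decide_eq_true]
    by_cases hte : (⟨p, fun k => d (x k)⟩ : Query Γ) ∈ e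
    · have hte' : (⟨p, fun k => d (x k)⟩ : Query Γ) ∈ e' :=
        (he _ hte).resolve_right fun h => h _ (.refl _) hquery
      have hcard := Finset.card_erase_lt_of_mem hte'
      obtain ⟨σ, h1, h2, h3⟩ := exists_run_out hS e (e'.erase ⟨p, fun k => d (x k)⟩)
        (next true P) (P.upd d) (hc.adv true) fun q hq => by
          by_cases hqt : q = ⟨p, fun k => d (x k)⟩
          · exact .inr (hqt ▸ hc.fresh hS hquery true)
          · exact (he q hq).imp (fun h => Finset.mem_erase.2 ⟨hqt, h⟩) fun h => h.adv true
      rw [ht.upd_eq] at h2 h3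
      obtain ⟨h4, h5⟩ := step h1 h2 (by simp [hte])
      refine ⟨_, h4, h5, fun v => ?_⟩
      rw [out_adv_true (c := (P, d)) hquery hte, ht.adv_eq, h3]
      rfl
    · obtain ⟨σ, h1, h2, h3⟩ := exists_run_out hS e e'
        (next false P) (P.upd d) (hc.adv false) fun q hq => (he q hq).imp_right fun h => h.adv false
      rw [ht.upd_eq] at h2 h3
      obtain ⟨h4, h5⟩ := step h1 h2 (by simp [hte])
      refine ⟨_, h4, h5, fun v => ?_⟩
      rw [out_adv_false (c := (P, d)) hquery hte, ht.adv_eq, h3]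
      rfl
termination_by (e'.card, P.size)
decreasing_by
  · exact Prod.Lex.right _ hsize
  · exact Prod.Lex.left _ _ hcard
  · exact Prod.Lex.right _ hsize

theorem exists_meaning_eq {S : Schema Γ} (hS : S.Free) (e : Finset (Query Γ)) :
    ∃ d₁, S.meaning (herb e) Term.var = some d₁ ∧ ∀ v, out v e (S, Term.var) = d₁ v := by
  obtain ⟨σ, h1, h2, h3⟩ := exists_run_out hS e e S Term.var ⟨[], .nil _, rfl⟩
    fun q hq => .inl hq
  refine ⟨_, meaning_eq h1 h2, fun v => ?_⟩
  rw [h3, (herb_isHerbrand e).run_eq]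

open Classical in
/-- A path determines the answers to the queries made along it, and these are not made again. -/
theorem Run.exec {S : Schema Γ} (hS : S.Free) {v : Γ.Var} {P Q : Schema Γ} {σ} (h : Run P σ Q)
    {d : State Γ} (hr : Reach S (P, d)) :
    ∃ B G : Finset (Query Γ), (∀ q ∈ G, Fresh q (Q, after d σ) ∧ ¬ Fresh q (P, d)) ∧
      ∀ e, (∀ q ∈ G, q ∈ e ↔ q ∈ B) → out v e (P, d) = out v e (Q, after d σ) := by
  induction h generalizing d with
  | nil => exact ⟨∅, ∅, by simp, fun e _ => rfl⟩
  | @cons P a Q' σ R hs hσ ih =>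
    cases hs with
    | assign y f l x =>
      obtain ⟨B, G, h1, h2⟩ := ih (hr.adv false)
      refine ⟨B, G, fun q hq => ⟨(h1 q hq).1, fun h => (h1 q hq).2 (h.adv false)⟩, fun e he => ?_⟩
      rw [out_adv_of_none (c := (assign y f l x Q', d)) rfl]
      exact h2 e he
    | @test _ p l x ht Z =>
      have hq := ht.query_eq d
      have hf := hr.fresh hS hq Z
      have hr' := hr.adv Z
      rw [ht.adv_eq] at hf hr'
      obtain ⟨B, G, h1, h2⟩ := ih hr'
      have hG : (⟨p, fun k => d (x k)⟩ : Query Γ) ∉ G := fun h => (h1 _ h).2 hf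
      have hn : ∀ q ∈ insert (⟨p, fun k => d (x k)⟩ : Query Γ) G,
          Fresh q (R, after d σ) ∧ ¬ Fresh q (P, d) := by
        intro q hqG
        rcases Finset.mem_insert.1 hqG with rfl | hqG
        · exact ⟨hf.leads ⟨σ, hσ, rfl⟩, fun h => h _ (.refl _) hq⟩
        · refine ⟨(h1 q hqG).1, fun h => (h1 q hqG).2 ?_⟩
          have := h.adv Z
          rwa [ht.adv_eq] at this
      cases Z
      · refine ⟨B.erase ⟨p, fun k => d (x k)⟩, _, hn, fun e he => ?_⟩
        have h3 := he _ (Finset.mem_insert_self _ _)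
        simp only [Finset.mem_erase, ne_eq, not_true, false_and, iff_false] at h3
        rw [out_adv_false (c := (P, d)) hq h3, ht.adv_eq]
        refine h2 e fun q hqG => (he q (Finset.mem_insert_of_mem hqG)).trans ?_
        have : q ≠ ⟨p, fun k => d (x k)⟩ := fun h => hG (h ▸ hqG)
        simp [this]
      · refine ⟨insert ⟨p, fun k => d (x k)⟩ B, _, hn, fun e he => ?_⟩
        have h3 := he _ (Finset.mem_insert_self _ _)
        simp only [Finset.mem_insert, true_or, iff_true] at h3
        rw [out_adv_true (c := (P, d)) hq h3, ht.adv_eq]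
        refine h2 e fun q hqG => (he q (Finset.mem_insert_of_mem hqG)).trans ?_
        have : q ≠ ⟨p, fun k => d (x k)⟩ := fun h => hG (h ▸ hqG)
        simp [this]

open Classical in
/-- If a test has an influence, then each query that it can make matters in some execution of the
whole schema. -/
theorem exists_out_insert_ne {S : Schema Γ} (hlab : S.DistinctLabels) (hS : S.IsSpecial)
    {v : Γ.Var} {K : Schema Γ} {σ p l x} (hσ : Run S σ K) (ht : IsTest K p l x)
    (hK : Influences v K none) :
    ∃ e : Finset (Query Γ), out v e (S, Term.var) ≠
      out v (insert ⟨p, fun k => after Term.var σ (x k)⟩ e) (S, Term.var) := by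
  have hfree := hS.2.1
  have hr : Reach S (K, after Term.var σ) := ⟨σ, hσ, rfl⟩
  set d := after Term.var σ
  obtain ⟨e₀, -, hne⟩ := exists_out_ne_of_influence hlab hS (Nat.find hK) K (Nat.find_spec hK)
    (fun m hm => Nat.find_min hK hm) d hr
  have hr₀ : Reach S (S, Term.var) := ⟨[], .nil _, rfl⟩
  obtain ⟨B, G, h1, h2⟩ := hσ.exec hfree (v := v) hr₀
  have hq := ht.query_eq d
  set a : Query Γ := ⟨p, fun k => d (x k)⟩
  have haG : a ∉ G := fun h => (h1 a h).1 _ (.refl _) hq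
  -- add the answers that lead from the start of `S` to `K`
  set e := (e₀ \ G) ∪ (B ∩ G) with he
  have o : ∀ Z, out v e (next Z K, d) = out v e₀ (next Z K, d) := by
    refine fun Z => out_congr fun q => ?_
    by_cases hqG : q ∈ G
    · right
      have := (h1 q hqG).1.adv Z
      rwa [ht.adv_eq] at this
    · exact .inl (by simp [he, hqG])
  have fa : ∀ Z, Fresh a (next Z K, d) := fun Z => by
    rw [← ht.adv_eq]; exact hr.fresh hfree hq Z
  have heG : ∀ q ∈ G, (q ∈ e ↔ q ∈ B) := fun q hqG => by simp [he, hqG]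
  refine ⟨e.erase a, ?_⟩
  rw [h2 (e.erase a), h2 (insert a (e.erase a)),
    out_adv_false (c := (K, d)) hq (Finset.notMem_erase _ _),
    out_adv_true (c := (K, d)) hq (Finset.mem_insert_self _ _), ht.adv_eq, ht.adv_eq,
    (fa _).out_insert, (fa _).out_erase, (fa _).out_erase, o, o]
  · exact hne.symm
  · intro q hqG
    have : q ≠ a := fun h => haG (h ▸ hqG)
    simp [this, heG q hqG]
  · intro q hqG
    have : q ≠ a := fun h => haG (h ▸ hqG)
    simp [this, heG q hqG]

/-! ### The symbols of a slice -/

theorem Run.mem_occs_of_assign_mem {T Q : Schema Γ} {σ y f l a} (h : Run T σ Q)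
    (ha : Letter.assign y f l a ∈ σ) : (Sum.inl f, l) ∈ T.occs := by
  obtain ⟨μ, ν, rfl⟩ := List.append_of_mem ha
  obtain ⟨P, h1, h2⟩ := run_append_iff.1 h
  obtain ⟨R, h3, -⟩ := run_cons_iff.1 h2
  cases h3
  exact head?_mem_occs (h1.mem_points_skip (by simp)) rfl

theorem Run.symbols_subset {T Q : Schema Γ} {σ} (h : Run T σ Q) (z : Γ.Var) :
    (after Term.var σ z).symbols ⊆ {f | Sum.inl f ∈ T.sym} :=
  symbols_after_subset (A := {f | Sum.inl f ∈ T.sym}) (fun _ => Set.empty_subset _)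
    (fun _ f l _ ha => ⟨(.inl f, l), h.mem_occs_of_assign_mem ha, rfl⟩) z

open Classical in
/-- If a query matters for the final value of `v`, then every slice has to make this query. -/
theorem IsSlice.mem_sym_of_out_insert_ne {S T : Schema Γ} (hS : S.Free) {v : Γ.Var}
    (hT : IsSlice v T S) {e : Finset (Query Γ)} {q : Query Γ}
    (hne : out v e (S, Term.var) ≠ out v (insert q e) (S, Term.var)) :
    Sum.inr q.1 ∈ T.sym ∧ ∀ k, (q.2 k).symbols ⊆ {f | Sum.inl f ∈ T.sym} := by
  obtain ⟨d₁, h1, h2⟩ := exists_meaning_eq hS e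
  obtain ⟨d₂, h3, h4⟩ := exists_meaning_eq hS (insert q e)
  obtain ⟨d₃, h5, h6⟩ := hT.2 _ _ _ _ h1
  obtain ⟨d₄, h7, h8⟩ := hT.2 _ _ _ _ h3
  obtain ⟨σ, hσ, fσ, rfl⟩ := exists_run_of_meaning_eq h5
  by_cases hq : ∃ τ p l x Z, τ ++ [Letter.test p l x Z] <+: σ ∧
      (⟨p, fun k => after Term.var τ (x k)⟩ : Query Γ) = q
  · obtain ⟨τ, p, l, x, Z, ⟨ρ, rfl⟩, rfl⟩ := hq
    obtain ⟨Q, h9, -⟩ := run_append_iff.1 hσ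
    obtain ⟨K, h10, h11⟩ := run_append_iff.1 h9
    obtain ⟨_, h12, -⟩ := run_cons_iff.1 h11
    cases h12 with
    | test ht =>
      exact ⟨⟨_, head?_mem_occs (h10.mem_points_skip ht.ne_skip) ht.head?_eq, rfl⟩,
        fun k => h10.symbols_subset _⟩
  · push Not at hq
    have fσ' : (herb (insert q e)).Follows Term.var σ := by
      intro τ p l x Z hτ
      have h9 := fσ τ p l x Z hτ
      have h10 := hq τ p l x Z hτ
      rw [(herb_isHerbrand _).run_eq] at h9 ⊢
      simpa only [herb, Finset.mem_insert, h10, false_or] using h9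
    rw [meaning_eq hσ fσ', Option.some.injEq] at h7
    rw [h2, h4, h6, h8, ← h7, (herb_isHerbrand _).run_eq, (herb_isHerbrand _).run_eq] at hne
    exact absurd rfl hne

/-- Whenever an assignment in Weiser's set has been made, a slice contains all function symbols of
the term that it creates: either this term ends up in the final value of `v`, or it is an argument
of a query that matters. -/
theorem symbols_subset_of_mem_need {S T : Schema Γ} (hlab : S.DistinctLabels) (hS : S.IsSpecial)
    {v : Γ.Var} (hT : IsSlice v T S) {s} (h : S.need v s) :
    ∀ f l y a R σ, s = (.inl f, l) → Run S σ (assign y f l a R) →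
      (after Term.var (σ ++ [Letter.assign y f l a]) y).symbols ⊆ {f | Sum.inl f ∈ T.sym} := by
  have carry : ∀ {σ ν : List (Letter Γ)} {y}, (∀ b ∈ ν, b.target ≠ some y) →
      after Term.var (σ ++ ν) y = after Term.var σ y := by
    intro σ ν y h
    rw [after_append, after, Interp.run_of_forall_ne _ _ h]
  induction h with
  | final f l h =>
    rintro f' l' y a R σ heq hσ
    cases heq
    obtain ⟨α, a', R', ν, h1, h2, h3⟩ := h.exists_run
    cases point_unique hlab hσ h1 rfl
    have hrun := (hσ.append (.single (.assign _ _ _ _ _))).append h2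
    obtain ⟨i, hi, -, hf⟩ := hS.2.1 _ (mem_pathPrefixes_iff.2 ⟨_, hrun⟩)
    obtain ⟨d₂, h4, h5⟩ := hT.2 _ _ _ _ (meaning_eq hrun hf)
    obtain ⟨τ, h6, -, rfl⟩ := exists_run_of_meaning_eq h4
    rw [hi.run_eq, hi.run_eq, carry h3] at h5
    rw [h5]
    exact h6.symbols_subset _
  | data f l s hs h ih =>
    rintro f' l' y a R σ heq hσ
    cases heq
    obtain ⟨α, y', a', R', ν, Q, h1, h2, h3, h4⟩ := h.exists_run
    cases point_unique hlab hσ h1 rfl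
    have hQ := (hσ.append (.single (.assign _ _ _ _ _))).append h2
    rw [← carry h3]
    rcases h4 with ⟨w, g, m, b, R'', rfl, rfl, k, rfl⟩ | ⟨p, m, x, rfl, ht, k, rfl⟩
    · refine Set.Subset.trans ?_ (ih g m w b R'' _ rfl hQ)
      conv_rhs => rw [after_append]
      simp only [after, Interp.run, List.foldl_cons, List.foldl_nil, Interp.step, herb,
        Function.update_self, Term.symbols]
      exact fun f hf => .inr (Set.mem_iUnion.2 ⟨k, hf⟩)
    · have hK := (influences_of_mem_need hlab hs).2 p m x Q _ rfl hQ ht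
      obtain ⟨e, hne⟩ := exists_out_insert_ne hlab hS hQ ht hK
      exact (hT.mem_sym_of_out_insert_ne hS.2.1 hne).2 k
  | control => simp

/-- A slice contains an occurrence of every symbol of Weiser's set. -/
theorem IsSlice.mem_sym {S T : Schema Γ} (hlab : S.DistinctLabels) (hS : S.IsSpecial)
    {v : Γ.Var} (hT : IsSlice v T S) {s} (h : S.need v s) : s.1 ∈ T.sym := by
  have func : ∀ {f l y a R σ}, S.need v (.inl f, l) → Run S σ (assign y f l a R) →
      Sum.inl f ∈ T.sym := by
    intro f l y a R σ h hσ
    have := symbols_subset_of_mem_need hlab hS hT h f l y a R σ rfl hσ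
    rw [after_append] at this
    refine this ?_
    simp [after, Interp.run, Interp.step, herb, Term.symbols]
  cases id h with
  | final f l h' =>
    obtain ⟨α, a, R, ν, h1, -⟩ := h'.exists_run
    exact func h h1
  | data f l s _ h' =>
    obtain ⟨α, y, a, R, ν, Q, h1, -⟩ := h'.exists_run
    exact func h h1
  | control p l Z s _ h' =>
    obtain ⟨K, hK, x, ht, -⟩ := exists_block_of_controls h' skip
    obtain ⟨τ, hτ⟩ := exists_run_of_mem_points hK
    rw [seq_skip] at hτ
    obtain ⟨e, hne⟩ := exists_out_insert_ne hlab hS hτ ht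
      ((influences_of_mem_need hlab h).2 p l x K τ rfl hτ ht)
    exact (hT.mem_sym_of_out_insert_ne hS.2.1 hne).1

end Schema

/-- The labelled symbol of a letter. -/
def Letter.sym : Letter Γ → Γ.LSym
  | .assign _ f l _ => (.inl f, l)
  | .test p l _ _ => (.inr p, l)

namespace Schema

/-! ### Restriction of a schema to a set of labelled symbols -/

open Classical in
/-- The schema that remains if all statements whose labelled symbol is not in `N` are deleted,
together with their parts. -/
noncomputable def restrict (N : Set Γ.LSym) : Schema Γ → Schema Γ
  | skip => skip
  | assign y f l x R => if (.inl f, l) ∈ N then assign y f l x (R.restrict N) else R.restrict N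
  | ifte p l x T₁ T₂ R =>
      if (.inr p, l) ∈ N then ifte p l x (T₁.restrict N) (T₂.restrict N) (R.restrict N)
      else R.restrict N
  | loop p l x T R =>
      if (.inr p, l) ∈ N then loop p l x (T.restrict N) (R.restrict N) else R.restrict N

theorem occs_seq (S T : Schema Γ) : (S.seq T).occs = S.occs ++ T.occs := by
  induction S <;> simp_all [seq, occs]

theorem restrict_seq (N : Set Γ.LSym) (S T : Schema Γ) :
    (S.seq T).restrict N = (S.restrict N).seq (T.restrict N) := by
  induction S with
  | skip => rfl
  | assign _ _ _ _ _ ih => simp only [seq, restrict, ih]; split_ifs <;> rfl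
  | ifte _ _ _ _ _ _ _ _ ih => simp only [seq, restrict, ih]; split_ifs <;> rfl
  | loop _ _ _ _ _ _ ih => simp only [seq, restrict, ih]; split_ifs <;> rfl

theorem restrict_congr {N M : Set Γ.LSym} {S : Schema Γ} (h : ∀ y ∈ S.occs, y ∈ N ↔ y ∈ M) :
    S.restrict N = S.restrict M := by
  induction S <;> grind [restrict, occs]

theorem restrict_eq_self {N : Set Γ.LSym} {S : Schema Γ} (h : ∀ y ∈ S.occs, y ∈ N) :
    S.restrict N = S := by
  induction S <;> grind [restrict, occs]

theorem restrict_eq_skip {N : Set Γ.LSym} {S : Schema Γ} (h : ∀ y ∈ S.occs, y ∉ N) :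
    S.restrict N = skip := by
  induction S <;> grind [restrict, occs]

theorem restrict_restrict {N M : Set Γ.LSym} (h : N ⊆ M) (S : Schema Γ) :
    (S.restrict M).restrict N = S.restrict N := by
  have h' : ∀ y, y ∈ N → y ∈ M := fun y hy => h hy
  induction S <;> grind [restrict]

theorem Subschema.refl (S : Schema Γ) : S.Subschema S := by
  have := Subschema.left S Schema.skip
  rwa [seq_skip] at this

theorem restrict_subschema (N : Set Γ.LSym) (S : Schema Γ) : (S.restrict N).Subschema S := by
  have drop : ∀ {A R R' : Schema Γ}, R'.Subschema R → R'.Subschema (A.seq R) := fun h =>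
    h.trans _ _ _ (.right _ _)
  induction S with
  | skip => exact .refl _
  | assign y f l x R ih =>
    rw [restrict]
    split_ifs
    · exact .seq_right _ _ (assign y f l x skip) ih
    · exact drop (A := assign y f l x skip) ih
  | ifte p l x T₁ T₂ R ih₁ ih₂ ih =>
    rw [restrict]
    split_ifs
    · have h1 := (Subschema.true_part p l x _ _ (T₂.restrict N) ih₁).trans _ _ _
        (.false_part p l x _ _ T₁ ih₂)
      exact (Subschema.seq_left _ _ (R.restrict N) h1).trans _ _ _
        (.seq_right _ _ (ifte p l x T₁ T₂ skip) ih)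
    · exact drop (A := ifte p l x T₁ T₂ skip) ih
  | loop p l x T R ihT ih =>
    rw [restrict]
    split_ifs
    · exact (Subschema.seq_left _ _ (R.restrict N) (.body p l x _ _ ihT)).trans _ _ _
        (.seq_right _ _ (loop p l x T skip) ih)
    · exact drop (A := loop p l x T skip) ih

theorem Subschema.occs_sublist {T S : Schema Γ} (h : T.Subschema S) : T.occs.Sublist S.occs := by
  induction h with
  | skip => exact List.nil_sublist _
  | left => rw [occs_seq]; exact List.sublist_append_left _ _
  | right => rw [occs_seq]; exact List.sublist_append_right _ _
  | seq_left _ _ T _ ih => rw [occs_seq, occs_seq]; exact ih.append_right _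
  | seq_right _ _ T _ ih => rw [occs_seq, occs_seq]; exact ih.append_left _
  | body _ _ _ _ _ _ ih => simpa [occs] using ih
  | true_part _ _ _ _ _ U _ ih => simpa [occs] using List.Sublist.append_right ih U.occs
  | false_part _ _ _ _ _ U _ ih => simpa [occs] using List.Sublist.append_left ih U.occs
  | trans _ _ _ _ _ ih₁ ih₂ => exact ih₁.trans ih₂

/-- A subschema of a schema with distinct labels is determined by its labelled symbols. -/
theorem Subschema.eq_restrict {T S : Schema Γ} (h : T.Subschema S) (hS : S.DistinctLabels) :
    T = S.restrict T.lsym := by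
  unfold DistinctLabels at hS
  induction h with
  | skip S => exact (restrict_eq_skip (by simp [lsym, occs])).symm
  | left A B =>
    rw [occs_seq, List.nodup_append'] at hS
    rw [restrict_seq, restrict_eq_self (N := A.lsym) (S := A) fun y hy => hy,
      restrict_eq_skip (N := A.lsym) (S := B) fun y hB hA => hS.2.2 hA hB, seq_skip]
  | right A B =>
    rw [occs_seq, List.nodup_append'] at hS
    rw [restrict_seq, restrict_eq_self (N := B.lsym) (S := B) fun y hy => hy,
      restrict_eq_skip (N := B.lsym) (S := A) fun y hA hB => hS.2.2 hA hB, seq]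
  | seq_left A' A B h ih =>
    rw [occs_seq, List.nodup_append'] at hS
    rw [restrict_seq, restrict_eq_self (S := B) (by simp +contextual [lsym, occs_seq]),
      restrict_congr (S := A) (M := A'.lsym), ← ih hS.1]
    intro y hy
    have : y ∉ B.occs := fun hB => hS.2.2 hy hB
    simp [lsym, occs_seq, this]
  | seq_right A' A B h ih =>
    rw [occs_seq, List.nodup_append'] at hS
    rw [restrict_seq, restrict_eq_self (S := B) (by simp +contextual [lsym, occs_seq]),
      restrict_congr (S := A) (M := A'.lsym), ← ih hS.2.1]
    intro y hy
    have : y ∉ B.occs := fun hB => hS.2.2 hB hy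
    simp [lsym, occs_seq, this]
  | body p l x A' A h ih =>
    simp only [occs, List.append_nil, List.nodup_cons] at hS
    rw [restrict, if_pos (by simp [lsym, occs]), restrict, restrict_congr (S := A) (M := A'.lsym),
      ← ih hS.2]
    intro y hy
    have : y ≠ (.inr p, l) := by rintro rfl; exact hS.1 hy
    simp [lsym, occs, this]
  | true_part p l x A' A B h ih =>
    simp only [occs, List.append_nil, List.nodup_cons, List.nodup_append', List.mem_append] at hS
    rw [restrict, if_pos (by simp [lsym, occs]), restrict, restrict_congr (S := A) (M := A'.lsym),
      ← ih hS.2.1, restrict_eq_self (by simp +contextual [lsym, occs])]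
    intro y hy
    have : y ≠ (.inr p, l) := by rintro rfl; exact hS.1 (.inl hy)
    have hB : y ∉ B.occs := fun hB => hS.2.2.2 hy hB
    simp [lsym, occs, this, hB]
  | false_part p l x A' A B h ih =>
    simp only [occs, List.append_nil, List.nodup_cons, List.nodup_append', List.mem_append] at hS
    rw [restrict, if_pos (by simp [lsym, occs]), restrict, restrict_congr (S := A) (M := A'.lsym),
      ← ih hS.2.2.1, restrict_eq_self (by simp +contextual [lsym, occs])]
    intro y hy
    have : y ≠ (.inr p, l) := by rintro rfl; exact hS.1 (.inr hy)
    have hB : y ∉ B.occs := fun hB => hS.2.2.2 hB hy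
    simp [lsym, occs, this, hB]
  | trans R T S hR hT ih₁ ih₂ =>
    have h1 := ih₁ (hS.sublist hT.occs_sublist)
    rw [ih₂ hS, restrict_restrict (N := R.lsym) (M := T.lsym) fun y hy => hR.occs_sublist.subset hy] at h1
    exact h1

/-- A set of labelled symbols that contains the tests that control its members. -/
def ControlClosed (N : Set Γ.LSym) (S : Schema Γ) : Prop :=
  ∀ p l Z y, S.Controls p l Z y → y ∈ N → (.inr p, l) ∈ N

theorem controls_seq {S T : Schema Γ} {p l Z y} :
    (S.seq T).Controls p l Z y ↔ S.Controls p l Z y ∨ T.Controls p l Z y := by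
  induction S <;> simp_all [seq, Controls, or_assoc]

theorem ControlClosed.step {N : Set Γ.LSym} {P Q : Schema Γ} {a} (h : ControlClosed N P)
    (hs : Step P a Q) : ControlClosed N Q := by
  intro p l Z y hc hy
  refine h p l Z y ?_ hy
  cases hs with
  | assign => exact hc
  | test ht Z' =>
    cases ht <;> cases Z' <;> simp only [next, controls_seq] at hc <;>
      simp only [Controls] at hc ⊢ <;> tauto

theorem mem_occs_restrict {N : Set Γ.LSym} {S : Schema Γ} (h : ControlClosed N S) {y} :
    y ∈ (S.restrict N).occs ↔ y ∈ S.occs ∧ y ∈ N := by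
  induction S with
  | skip => simp [restrict, occs]
  | assign y' f l x R ih =>
    have ih := ih h
    simp only [restrict, occs, List.mem_cons]
    split_ifs <;> grind [occs]
  | ifte p l x T₁ T₂ R ih₁ ih₂ ih =>
    have ih₁ := ih₁ fun p l Z y hc => h p l Z y (.inr (.inl hc))
    have ih₂ := ih₂ fun p l Z y hc => h p l Z y (.inr (.inr (.inl hc)))
    have ih := ih fun p l Z y hc => h p l Z y (.inr (.inr (.inr hc)))
    have h1 : y ∈ T₁.occs → y ∈ N → (.inr p, l) ∈ N := fun hy =>
      h p l true y (.inl ⟨rfl, rfl, .inl ⟨rfl, hy⟩⟩)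
    have h2 : y ∈ T₂.occs → y ∈ N → (.inr p, l) ∈ N := fun hy =>
      h p l false y (.inl ⟨rfl, rfl, .inr ⟨rfl, hy⟩⟩)
    simp only [restrict, occs, List.mem_cons, List.mem_append]
    split_ifs <;> grind [occs]
  | loop p l x T R ihT ih =>
    have ihT := ihT fun p l Z y hc => h p l Z y (.inr (.inl hc))
    have ih := ih fun p l Z y hc => h p l Z y (.inr (.inr hc))
    have h1 : y ∈ T.occs → y ∈ N → (.inr p, l) ∈ N := fun hy =>
      h p l true y (.inl ⟨rfl, rfl, rfl, hy⟩)
    simp only [restrict, occs, List.mem_cons, List.mem_append]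
    split_ifs <;> grind [occs]

/-- A step at a statement that is deleted does not change the restricted schema. -/
theorem ControlClosed.restrict_eq_of_step {N : Set Γ.LSym} {P Q : Schema Γ} {a}
    (h : ControlClosed N P) (hs : Step P a Q) (ha : a.sym ∉ N) : P.restrict N = Q.restrict N := by
  cases hs with
  | assign y f l x => exact if_neg ha
  | @test _ p l x ht Z =>
    cases ht with
    | ifte _ _ _ T₁ T₂ R =>
      have hn : (Sum.inr p, l) ∉ N := ha
      have h1 : T₁.restrict N = skip := restrict_eq_skip fun y hy hN =>
        hn (h p l true y (.inl ⟨rfl, rfl, .inl ⟨rfl, hy⟩⟩) hN)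
      have h2 : T₂.restrict N = skip := restrict_eq_skip fun y hy hN =>
        hn (h p l false y (.inl ⟨rfl, rfl, .inr ⟨rfl, hy⟩⟩) hN)
      cases Z <;> simp [next, restrict_seq, restrict, hn, h1, h2, seq]
    | loop _ _ _ T R =>
      have hn : (Sum.inr p, l) ∉ N := ha
      have h1 : T.restrict N = skip := restrict_eq_skip fun y hy hN =>
        hn (h p l true y (.inl ⟨rfl, rfl, rfl, hy⟩) hN)
      cases Z <;> simp [next, restrict_seq, restrict, hn, h1, seq]

theorem Step.restrict {N : Set Γ.LSym} {P Q : Schema Γ} {a} (hs : Step P a Q) (ha : a.sym ∈ N) :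
    Step (P.restrict N) a (Q.restrict N) := by
  cases hs with
  | assign y f l x =>
    rw [Schema.restrict, if_pos (show (Sum.inl f, l) ∈ N from ha)]
    exact .assign _ _ _ _ _
  | @test _ p l x ht Z =>
    cases ht with
    | ifte _ _ _ T₁ T₂ R =>
      have e : next Z (ifte p l x (T₁.restrict N) (T₂.restrict N) (R.restrict N)) =
          (next Z (ifte p l x T₁ T₂ R)).restrict N := by
        cases Z <;> simp [next, restrict_seq]
      rw [← e, Schema.restrict, if_pos (show (Sum.inr p, l) ∈ N from ha)]
      exact .test (.ifte _ _ _ _ _ _) Z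
    | loop _ _ _ T R =>
      have hn : (Sum.inr p, l) ∈ N := ha
      have e : next Z (loop p l x (T.restrict N) (R.restrict N)) =
          (next Z (loop p l x T R)).restrict N := by
        cases Z <;> simp [next, restrict_seq, Schema.restrict, hn]
      rw [← e, Schema.restrict, if_pos hn]
      exact .test (.loop _ _ _ _ _) Z

/-! ### Weiser's set gives a slice -/

/-- The first statement of the schema references the variable `z` and has the given labelled
symbol. -/
inductive References : Schema Γ → Γ.Var → Γ.LSym → Prop
  | assign {y f l x R} (k) : References (assign y f l x R) (x k) (.inl f, l)
  | test {P : Schema Γ} {p l x} (h : IsTest P p l x) (k) : References P (x k) (.inr p, l)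

/-- The value of the variable `z` at the point `Q` may be referenced by a symbol in `N`, or be the
final value of `v`, before `z` is assigned again. -/
def Live (N : Set Γ.LSym) (v z : Γ.Var) (Q : Schema Γ) : Prop :=
  ∃ ν R, Run Q ν R ∧ (∀ b ∈ ν, b.target ≠ some z) ∧
    ((R = skip ∧ z = v) ∨ ∃ s ∈ N, References R z s)

theorem Live.of_step {N : Set Γ.LSym} {v z : Γ.Var} {P Q : Schema Γ} {a} (hs : Step P a Q)
    (ha : a.target ≠ some z) (h : Live N v z Q) : Live N v z P := by
  obtain ⟨ν, R, h1, h2, h3⟩ := h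
  refine ⟨a :: ν, R, .cons hs h1, ?_, h3⟩
  simpa using ⟨ha, h2⟩

/-- An assignment to a live variable belongs to Weiser's set. -/
theorem Live.mem_need {S : Schema Γ} {v y : Γ.Var} {f l a R σ}
    (hσ : Run S σ (assign y f l a R)) (h : Live (S.need v) v y R) : S.need v (.inl f, l) := by
  obtain ⟨ν, Q, h1, h2, h3⟩ := h
  have hrun : Run (assign y f l a R) (Letter.assign y f l a :: ν) Q := .cons (.assign _ _ _ _ _) h1
  have hval := symbolic_last [] f l a h2
  rw [List.nil_append] at hval
  rcases h3 with ⟨rfl, rfl⟩ | ⟨s, hs, h3⟩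
  · refine .final f l ⟨_, mem_terminalSegments_iff.2 ⟨_, _, hσ, hrun⟩, ?_⟩
    rw [hval]
    exact .single _ _
  · refine .data f l s hs ?_
    cases h3 with
    | @assign w g m b R' k =>
      refine ⟨Letter.assign (b k) f l a :: ν ++ [Letter.assign w g m b],
        mem_pathSegments_iff.2 ⟨_, _, _, hσ, hrun.append (.single (.assign _ _ _ _ _))⟩, w, ?_⟩
      rw [symbolic_concat]
      refine .snoc [(f, l)] (g, m) _ k ?_
      rw [hval]
      exact .single _ _
    | @test _ p m x ht k =>
      refine ⟨Letter.assign (x k) f l a :: ν, x, true,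
        mem_pathSegments_iff.2 ⟨_, _, _, hσ, hrun.append (.single (.test ht true))⟩, k, ?_⟩
      rw [hval]
      exact .single _ _

open Classical in
/-- Executing the restriction of a schema to Weiser's set alongside the schema: the states agree on
the live variables. -/
theorem Run.restrict_need {S : Schema Γ} {v : Γ.Var} {D : Type u} {i : Interp Γ D}
    {d d' : Γ.Var → D} {τ P Q ρ} (hτ : Run S τ P) (hρ : Run P ρ Q) (hQ : Q = skip)
    (hN : ControlClosed (S.need v) P) (hf : i.Follows d ρ)
    (hd : ∀ z, Live (S.need v) v z P → d z = d' z) :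
    ∃ ρ', Run (P.restrict (S.need v)) ρ' skip ∧ i.Follows d' ρ' ∧ i.run d ρ v = i.run d' ρ' v := by
  induction hρ generalizing d d' τ with
  | nil P =>
    subst hQ
    exact ⟨[], .nil _, fun ρ p l x Z h => by simp at h,
      hd v ⟨[], skip, .nil _, by simp, .inl ⟨rfl, rfl⟩⟩⟩
  | @cons P a P' ρ R hs hρ ih =>
    have hτ' := hτ.append (.single hs)
    rw [i.follows_cons] at hf
    by_cases ha : S.need v a.sym
    · have hfa : i.Follows d' [a] ∧
          ∀ z, Live (S.need v) v z P' → i.step d a z = i.step d' a z := by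
        cases hs with
        | assign y f l x =>
          refine ⟨i.follows_assign _ _ _ _ _, fun z hz => ?_⟩
          by_cases hzy : z = y
          · subst hzy
            simp only [Interp.step, Function.update_self]
            congr 1
            funext k
            exact hd _ ⟨[], _, .nil _, by simp, .inr ⟨_, ha, .assign k⟩⟩
          · have := hd z (hz.of_step (.assign y f l x _)
              (by simpa [Letter.target] using Ne.symm hzy))
            simpa [Interp.step, hzy] using this
        | @test _ p l x ht Z =>
          refine ⟨?_, fun z hz => hd z (hz.of_step (.test ht Z) (by simp [Letter.target]))⟩
          have hf1 := hf.1
          rw [i.follows_test] at hf1 ⊢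
          rw [← hf1]
          congr 1
          funext k
          exact (hd _ ⟨[], _, .nil _, by simp, .inr ⟨_, ha, .test ht k⟩⟩).symm
      obtain ⟨ρ', h1, h2, h3⟩ := ih hτ' hQ (hN.step hs) hf.2 hfa.2
      exact ⟨a :: ρ', .cons (hs.restrict ha) h1, (i.follows_cons _ _ _).2 ⟨hfa.1, h2⟩, h3⟩
    · rw [hN.restrict_eq_of_step hs ha]
      refine ih hτ' hQ (hN.step hs) hf.2 fun z hz => ?_
      cases hs with
      | assign y f l x =>
        have hzy : z ≠ y := by
          rintro rfl
          exact ha (hz.mem_need hτ)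
        have := hd z (hz.of_step (.assign y f l x _) (by simpa [Letter.target] using hzy.symm))
        simpa [Interp.step, hzy] using this
      | test ht Z => exact hd z (hz.of_step (.test ht Z) (by simp [Letter.target]))

theorem controlClosed_need (S : Schema Γ) (v : Γ.Var) : ControlClosed (S.need v) S :=
  fun p l Z y hc hy => .control p l Z y hy hc

theorem restrict_need_isSlice (S : Schema Γ) (v : Γ.Var) : IsSlice v (S.restrict (S.need v)) S := by
  refine ⟨restrict_subschema _ _, fun D i d d₁ h => ?_⟩
  obtain ⟨σ, h1, h2, rfl⟩ := exists_run_of_meaning_eq h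
  obtain ⟨ρ, h3, h4, h5⟩ := Run.restrict_need (.nil S) h1 rfl (controlClosed_need S v) h2
    (d' := d) fun _ _ => rfl
  exact ⟨_, meaning_eq h3 h4, h5⟩

theorem need_subset_lsym (S : Schema Γ) (v : Γ.Var) : S.need v ⊆ S.lsym := by
  intro s hs
  cases hs with
  | final f l h =>
    obtain ⟨α, a, R, ν, h1, -⟩ := h.exists_run
    exact head?_mem_occs (h1.mem_points_skip (by simp)) rfl
  | data f l s _ h =>
    obtain ⟨α, y, a, R, ν, Q, h1, -⟩ := h.exists_run
    exact head?_mem_occs (h1.mem_points_skip (by simp)) rfl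
  | control p l Z s _ h =>
    obtain ⟨K, hK, x, ht, -⟩ := exists_block_of_controls h skip
    exact head?_mem_occs hK ht.head?_eq

theorem lsym_restrict_need (S : Schema Γ) (v : Γ.Var) :
    (S.restrict (S.need v)).lsym = S.need v := by
  ext y
  rw [lsym, Set.mem_ofPred_eq, mem_occs_restrict (controlClosed_need S v)]
  exact and_iff_right_of_imp fun h => need_subset_lsym S v h

end Schema

end ProgramSchema

theorem theorem8p5 (Γ : ProgramSchema.Signature.{u}) (S : ProgramSchema.Schema Γ)
    (hlab : S.DistinctLabels) (hS : S.IsSpecial) (v : Γ.Var) :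
    (∃! T : ProgramSchema.Schema Γ, T.Subschema S ∧ T.lsym = S.need v) ∧
    (∀ T : ProgramSchema.Schema Γ, T.Subschema S → T.lsym = S.need v →
      ProgramSchema.Schema.IsSlice v T S) ∧
    (∀ T : ProgramSchema.Schema Γ, ProgramSchema.Schema.IsSlice v T S →
      ∀ x ∈ S.need v, x.1 ∈ T.sym) ∧
    (∀ T T' : ProgramSchema.Schema Γ, T.Subschema S → T.lsym = S.need v →
      T'.Subschema T → T' ≠ T → ProgramSchema.Schema.IsSlice v T' S →
        ∃ f : Γ.Func, 2 ≤ (T.funcOccs f).encard ∧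
          (T'.funcOccs f).Nonempty ∧ ∃ l ∈ T.funcOccs f, l ∉ T'.funcOccs f) := by
  have huniq : ∀ T : ProgramSchema.Schema Γ, T.Subschema S → T.lsym = S.need v →
      T = S.restrict (S.need v) := fun T h1 h2 => h2 ▸ h1.eq_restrict hlab
  refine ⟨⟨_, ⟨ProgramSchema.Schema.restrict_subschema _ S, S.lsym_restrict_need v⟩, fun T h => huniq T h.1 h.2⟩,
    fun T h1 h2 => huniq T h1 h2 ▸ S.restrict_need_isSlice v,
    fun T hT x hx => hT.mem_sym hlab hS hx, fun T T' h1 h2 h3 hne hT' => ?_⟩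
  have hsub : T'.lsym ⊆ T.lsym := fun y hy => h3.occs_sublist.subset hy
  obtain ⟨⟨s, l⟩, hx, hx'⟩ : ∃ x ∈ S.need v, x ∉ T'.lsym := by
    by_contra h
    push Not at h
    have hT'S : T'.lsym = S.need v := (h2 ▸ hsub).antisymm h
    exact hne ((huniq T' (h3.trans _ _ _ h1) hT'S).trans (huniq T h1 h2).symm)
  obtain ⟨⟨s', m⟩, hm, heq⟩ := hT'.mem_sym hlab hS hx
  cases heq
  have hm' : S.need v (s, m) := h2 ▸ hsub hm
  cases s with
  | inr p =>
    have hlm := ProgramSchema.Schema.label_unique hS.1 (S.need_subset_lsym v hx) (S.need_subset_lsym v hm')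
    exact absurd (hlm ▸ hm) hx'
  | inl f =>
    have hl : (Sum.inl f, l) ∈ T.lsym := h2 ▸ hx
    refine ⟨f, ?_, ⟨m, hm⟩, l, hl, hx'⟩
    have hlm : l ≠ m := by
      rintro rfl
      exact hx' hm
    rw [← Set.encard_pair hlm]
    exact Set.encard_le_encard (Set.pair_subset hl (hsub hm))
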